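/- Let $X$ be a set with $27$ elements. A \emph{factor pair} of $X$ is a pair $(\theta_1,\theta_2)$ of equivalence relations on $X$ for which the natural map $X\to X/\theta_1\times X/\theta_2$ is a bijection. Let $\mathrm{Fact}\,X$ be the set of factor pairs, with $(\theta_1,\theta_2)'=(\theta_2,\theta_1)$, with $(\theta_1,\theta_2)\perp(\psi_1,\psi_2)$ iff $\theta_1\subseteq\psi_2$, $\psi_1\subseteq\theta_2$ and $\theta_1\circ\psi_1=\psi_1\circ\theta_1$, and with $s\le t$ iff $s\perp t'$. Let $\mathrm{Aut}(\mathrm{Fact}\,X)$ be the group of order isomorphisms of $\mathrm{Fact}\,X$ that preserve $'$. Let $\mathrm{Req}\,X$ be the poset, under inclusion, of the regular equivalence relations on $X$ (those whose classes all have the same cardinality), and $\mathrm{Aut}(\mathrm{Req}\,X)$ its group of order automorphisms. An equivalence relation is \emph{small} if it has $9$ classes of $3$ elements each, and \emph{large} if it has $3$ classes of $9$ elements each. Let $\mathrm{Block}\,X$ be the set of $3$-element subsets of $X$, and for $\alpha\in\mathrm{Block}\,X$ let $\mathfrak X_\alpha$ be the set of small relations that have $\alpha$ as a class. A permutation $\rho$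 of $\mathrm{Block}\,X$ is \emph{special} if for all $\alpha,\beta,\gamma\in\mathrm{Block}\,X$ we have $|\alpha\cap\beta|=|\rho(\alpha)\cap\rho(\beta)|$, and $\gamma\subseteq\alpha\cup\beta$ iff $\rho(\gamma)\subseteq\rho(\alpha)\cup\rho(\beta)$; the special permutations form a group $\mathrm{Spec}(\mathrm{Block}\,X)$ under composition. Then the four groups $\mathrm{Aut}(\mathrm{Fact}\,X)$, $\mathrm{Aut}(\mathrm{Req}\,X)$, $\mathrm{Spec}(\mathrm{Block}\,X)$ and $\mathrm{Sym}(X)$ are isomorphic. More precisely, each of the following rules determines exactly one map, and this map is a group isomorphism: 1. $\Gamma:\mathrm{Sym}(X)\to\mathrm{Aut}(\mathrm{Fact}\,X)$, $(\Gamma\sigma)(\theta_1,\theta_2)=(\sigma\theta_1,\sigma\theta_2)$, where $\sigma\theta=\{(\sigma x,\sigma y):(x,y)\in\theta\}$; 2. $\mathrm R:\mathrm{Aut}(\mathrm{Fact}\,X)\to\mathrm{Aut}(\mathrm{Req}\,X)$, where for every factor pair $(a,A)$ with $a$ small and $A$ large, $(\mathrm R\Phi)(a)$ is the first component and $(\mathrm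 R\Phi)(A)$ the second component of $\Phi(a,A)$; 3. $\mathrm B:\mathrm{Aut}(\mathrm{Req}\,X)\to\mathrm{Spec}(\mathrm{Block}\,X)$, where $(\mathrm B\Lambda)(\alpha)=\beta$ iff $\Lambda[\mathfrak X_\alpha]=\mathfrak X_\beta$; 4. $\mathrm P:\mathrm{Spec}(\mathrm{Block}\,X)\to\mathrm{Sym}(X)$, where $\alpha\cap\beta=\{p\}$ and $\rho(\alpha)\cap\rho(\beta)=\{x\}$ imply $(\mathrm P\rho)(p)=x$. In particular, every automorphism of $\mathrm{Fact}\,X$ is induced, through $\Gamma$, by a (unique) permutation of $X$. -/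

import Mathlib

/-! ### Equivalence relations on a set -/

/-- Two equivalence relations permute if their relational products in the two orders agree. -/
def EquivPermute {X : Type*} (r s : Setoid X) : Prop :=
  Relation.Comp (fun x y => r x y) (fun x y => s x y) =
    Relation.Comp (fun x y => s x y) (fun x y => r x y)

/-- An equivalence relation is regular if all its classes have the same cardinality. -/
def IsRegularEquiv {X : Type*} (r : Setoid X) : Prop :=
  ∀ x y : X, Cardinal.mk {z : X | r z x} = Cardinal.mk {z : X | r z y}

/-- Nine blocks, each with three elements. -/
def IsSmallEquiv {X : Type*} (r : Setoid X) : Prop :=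
  r.classes.ncard = 9 ∧ ∀ c ∈ r.classes, c.ncard = 3

/-- Three blocks, each with nine elements. -/
def IsLargeEquiv {X : Type*} (r : Setoid X) : Prop :=
  r.classes.ncard = 3 ∧ ∀ c ∈ r.classes, c.ncard = 9

/-- The image `{(σ x, σ y) : (x, y) ∈ r}` of an equivalence relation under a permutation
(see `permEquiv_iff`). -/
def permEquiv {X : Type*} (σ : Equiv.Perm X) (r : Setoid X) : Setoid X :=
  Setoid.comap σ.symm r

theorem permEquiv_apply {X : Type*} (σ : Equiv.Perm X) (r : Setoid X) (u v : X) :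
    permEquiv σ r u v ↔ r (σ.symm u) (σ.symm v) := Iff.rfl

theorem permEquiv_iff {X : Type*} (σ : Equiv.Perm X) (r : Setoid X) (u v : X) :
    permEquiv σ r u v ↔ ∃ x y, r x y ∧ σ x = u ∧ σ y = v := by
  constructor
  · intro h
    exact ⟨σ.symm u, σ.symm v, h, by simp, by simp⟩
  · rintro ⟨x, y, h, rfl, rfl⟩
    simpa [permEquiv_apply] using h

/-- The poset of regular equivalence relations on `X`, ordered by inclusion. -/
abbrev Req (X : Type*) : Type _ := {r : Setoid X // IsRegularEquiv r}

/-! ### The orthomodular poset of binary decompositions of a set, as factor pairs -/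

/-- A factor pair: two equivalence relations for which the natural map
`X → X/θ₁ × X/θ₂` is a bijection. -/
@[ext] structure FactorPair (X : Type*) where
  fst : Setoid X
  snd : Setoid X
  bij : Function.Bijective
    (fun x : X => ((Quotient.mk fst x, Quotient.mk snd x) : Quotient fst × Quotient snd))

namespace FactorPair

variable {X : Type*}

theorem eq_of_rel (t : FactorPair X) {x y : X} (h₁ : t.fst x y) (h₂ : t.snd x y) : x = y :=
  t.bij.1 (Prod.ext (Quotient.sound h₁) (Quotient.sound h₂))

theorem exists_rel (t : FactorPair X) (x y : X) : ∃ z, t.fst z x ∧ t.snd z y := by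
  obtain ⟨z, hz⟩ := t.bij.2 (Quotient.mk t.fst x, Quotient.mk t.snd y)
  exact ⟨z, Quotient.exact (congrArg Prod.fst hz), Quotient.exact (congrArg Prod.snd hz)⟩

theorem bij_of_rel (r s : Setoid X) (h₁ : ∀ x y, r x y → s x y → x = y)
    (h₂ : ∀ x y, ∃ z, r z x ∧ s z y) : Function.Bijective
    (fun x : X => ((Quotient.mk r x, Quotient.mk s x) : Quotient r × Quotient s)) := by
  constructor
  · intro x y h
    exact h₁ x y (Quotient.exact (congrArg Prod.fst h)) (Quotient.exact (congrArg Prod.snd h))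
  · rintro ⟨p, q⟩
    induction p using Quotient.inductionOn with
    | h x =>
      induction q using Quotient.inductionOn with
      | h y =>
        obtain ⟨z, hz₁, hz₂⟩ := h₂ x y
        exact ⟨z, Prod.ext (Quotient.sound hz₁) (Quotient.sound hz₂)⟩

/-- The orthocomplementation `(θ₁, θ₂)' = (θ₂, θ₁)`. -/
instance instCompl : Compl (FactorPair X) where
  compl t := ⟨t.snd, t.fst, bij_of_rel _ _ (fun _ _ h₁ h₂ => t.eq_of_rel h₂ h₁)
    (fun x y => (t.exists_rel y x).imp fun _ h => ⟨h.2, h.1⟩)⟩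

/-- Orthogonality: `(θ₁, θ₂) ⊥ (ψ₁, ψ₂)` iff `θ₁ ⊆ ψ₂`, `ψ₁ ⊆ θ₂` and `θ₁`, `ψ₁` permute. -/
def Orth (t u : FactorPair X) : Prop :=
  t.fst ≤ u.snd ∧ u.fst ≤ t.snd ∧ EquivPermute t.fst u.fst

/-- The order is determined by orthogonality: `t ≤ u` iff `t ⊥ u'`. -/
instance instPartialOrder : PartialOrder (FactorPair X) where
  le t u := Orth t uᶜ
  le_refl t := by
    refine ⟨le_refl t.fst, le_refl t.snd, ?_⟩
    change EquivPermute t.fst t.snd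
    funext x y
    refine propext ⟨fun _ => ?_, fun _ => ?_⟩
    · obtain ⟨z, h₁, h₂⟩ := t.exists_rel y x
      exact ⟨z, t.snd.symm h₂, h₁⟩
    · obtain ⟨z, h₁, h₂⟩ := t.exists_rel x y
      exact ⟨z, t.fst.symm h₁, h₂⟩
  le_trans t u v h k := by
    obtain ⟨h₁, h₂, h₃⟩ := h
    obtain ⟨k₁, k₂, k₃⟩ := k
    change t.fst ≤ u.fst at h₁
    change u.snd ≤ t.snd at h₂
    change EquivPermute t.fst u.snd at h₃
    change u.fst ≤ v.fst at k₁
    change v.snd ≤ u.snd at k₂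
    change EquivPermute u.fst v.snd at k₃
    have key : ∀ x y z, t.fst x y → v.snd y z → ∃ w, v.snd x w ∧ t.fst w z := by
      intro x y z hxy hyz
      obtain ⟨w, hw₁, hw₂⟩ : Relation.Comp (fun x y => u.snd x y) (fun x y => t.fst x y) x z :=
        (congrFun (congrFun h₃ x) z).mp ⟨y, hxy, k₂ hyz⟩
      obtain ⟨w', hw'₁, hw'₂⟩ :
          Relation.Comp (fun x y => v.snd x y) (fun x y => u.fst x y) x z :=
        (congrFun (congrFun k₃ x) z).mp ⟨y, h₁ hxy, hyz⟩
      have e : w = w' := u.eq_of_rel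
        (u.fst.trans (h₁ hw₂) (u.fst.symm hw'₂)) (u.snd.trans (u.snd.symm hw₁) (k₂ hw'₁))
      subst e
      exact ⟨w, hw'₁, hw₂⟩
    refine ⟨h₁.trans k₁, k₂.trans h₂, ?_⟩
    change EquivPermute t.fst v.snd
    funext x z
    refine propext ⟨?_, ?_⟩
    · rintro ⟨y, hxy, hyz⟩
      exact key x y z hxy hyz
    · rintro ⟨y, hxy, hyz⟩
      obtain ⟨w, hw₁, hw₂⟩ := key z y x (t.fst.symm hyz) (v.snd.symm hxy)
      exact ⟨w, t.fst.symm hw₂, v.snd.symm hw₁⟩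
  le_antisymm t u h k := by
    obtain ⟨h₁, h₂, _⟩ := h
    obtain ⟨k₁, k₂, _⟩ := k
    exact FactorPair.ext (le_antisymm h₁ k₁) (le_antisymm k₂ h₂)

theorem le_iff_orth_compl (t u : FactorPair X) : t ≤ u ↔ Orth t uᶜ := Iff.rfl

theorem regular_fst (t : FactorPair X) : IsRegularEquiv t.fst := by
  have key : ∀ x : X, Nonempty ({z : X | t.fst z x} ≃ Quotient t.snd) := by
    intro x
    refine ⟨Equiv.ofBijective (fun z => Quotient.mk t.snd z.1) ⟨?_, ?_⟩⟩
    · rintro ⟨z, hz⟩ ⟨w, hw⟩ h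
      exact Subtype.ext (t.eq_of_rel (t.fst.trans hz (t.fst.symm hw)) (Quotient.exact h))
    · intro q
      induction q using Quotient.inductionOn with
      | h y =>
        obtain ⟨z, hz₁, hz₂⟩ := t.exists_rel x y
        exact ⟨⟨z, hz₁⟩, Quotient.sound hz₂⟩
  intro x y
  obtain ⟨e⟩ := key x
  obtain ⟨f⟩ := key y
  exact Cardinal.mk_congr (e.trans f.symm)

/-- The first spot of a factor pair, as a regular equivalence relation. -/
def fstReq (t : FactorPair X) : Req X := ⟨t.fst, t.regular_fst⟩

/-- The second spot of a factor pair, as a regular equivalence relation. -/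
def sndReq (t : FactorPair X) : Req X := ⟨t.snd, tᶜ.regular_fst⟩

/-- The factor pair `(σθ₁, σθ₂)`. -/
def perm (σ : Equiv.Perm X) (t : FactorPair X) : FactorPair X :=
  ⟨permEquiv σ t.fst, permEquiv σ t.snd, bij_of_rel _ _
    (fun _ _ h₁ h₂ => σ.symm.injective (t.eq_of_rel h₁ h₂))
    (fun x y => by
      obtain ⟨z, hz₁, hz₂⟩ := t.exists_rel (σ.symm x) (σ.symm y)
      exact ⟨σ z, by simpa [permEquiv_apply] using hz₁,
        by simpa [permEquiv_apply] using hz₂⟩)⟩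

theorem perm_le (σ : Equiv.Perm X) {t u : FactorPair X} (h : t ≤ u) : perm σ t ≤ perm σ u := by
  obtain ⟨h₁, h₂, h₃⟩ := h
  refine ⟨fun _ _ h => h₁ h, fun _ _ h => h₂ h, ?_⟩
  change EquivPermute t.fst u.snd at h₃
  change EquivPermute (permEquiv σ t.fst) (permEquiv σ u.snd)
  funext x z
  refine propext ⟨?_, ?_⟩
  · rintro ⟨y, hxy, hyz⟩
    obtain ⟨w, hw₁, hw₂⟩ := (congrFun (congrFun h₃ (σ.symm x)) (σ.symm z)).mp
      ⟨σ.symm y, hxy, hyz⟩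
    exact ⟨σ w, by simpa [permEquiv_apply] using hw₁,
      by simpa [permEquiv_apply] using hw₂⟩
  · rintro ⟨y, hxy, hyz⟩
    obtain ⟨w, hw₁, hw₂⟩ := (congrFun (congrFun h₃ (σ.symm x)) (σ.symm z)).mpr
      ⟨σ.symm y, hxy, hyz⟩
    exact ⟨σ w, by simpa [permEquiv_apply] using hw₁,
      by simpa [permEquiv_apply] using hw₂⟩

theorem perm_mul (σ τ : Equiv.Perm X) (t : FactorPair X) :
    perm (σ * τ) t = perm σ (perm τ t) := rfl

theorem perm_one (t : FactorPair X) : perm 1 t = t := rfl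

/-- The automorphisms of the orthomodular poset of factor pairs: order isomorphisms that
preserve the orthocomplementation, with composition as multiplication. -/
def aut (X : Type*) : Subgroup (FactorPair X ≃o FactorPair X) where
  carrier := {Φ | ∀ t, Φ tᶜ = (Φ t)ᶜ}
  mul_mem' {Φ Ψ} hΦ hΨ t := by
    change Φ (Ψ tᶜ) = (Φ (Ψ t))ᶜ
    rw [hΨ, hΦ]
  one_mem' _ := rfl
  inv_mem' {Φ} hΦ t := by
    apply Φ.injective
    rw [hΦ]
    change Φ (Φ.symm tᶜ) = (Φ (Φ.symm t))ᶜ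
    simp

/-- The homomorphism `Γ` with `(Γσ)(θ₁, θ₂) = (σθ₁, σθ₂)`. -/
def gamma (X : Type*) : Equiv.Perm X →* aut X where
  toFun σ := ⟨
    { toFun := perm σ
      invFun := perm σ⁻¹
      left_inv := fun t => by rw [← perm_mul, inv_mul_cancel, perm_one]
      right_inv := fun t => by rw [← perm_mul, mul_inv_cancel, perm_one]
      map_rel_iff' := fun {t u} => ⟨fun h => by
        have := perm_le σ⁻¹ h
        simpa only [Equiv.coe_fn_mk, ← perm_mul, inv_mul_cancel, perm_one] using this,
        perm_le σ⟩ },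
    fun _ => rfl⟩
  map_one' := rfl
  map_mul' _ _ := rfl

end FactorPair

/-! ### Small blocks -/

/-- The three-element subsets of `X`. -/
abbrev SmallBlock (X : Type*) : Type _ := {α : Set X // α.ncard = 3}

/-- The small relations having `α` as a block. -/
def smallWithBlock {X : Type*} (α : SmallBlock X) : Set (Req X) :=
  {a | IsSmallEquiv a.1 ∧ α.1 ∈ a.1.classes}

/-- The group of special permutations of the set of small blocks. -/
def specialPerm (X : Type*) : Subgroup (Equiv.Perm (SmallBlock X)) where
  carrier := {ρ |
    (∀ α β : SmallBlock X, (α.1 ∩ β.1).ncard = ((ρ α).1 ∩ (ρ β).1).ncard) ∧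
    (∀ α β γ : SmallBlock X, γ.1 ⊆ α.1 ∪ β.1 ↔ (ρ γ).1 ⊆ (ρ α).1 ∪ (ρ β).1)}
  mul_mem' {ρ π} hρ hπ :=
    ⟨fun α β => (hπ.1 α β).trans (hρ.1 (π α) (π β)),
      fun α β γ => (hπ.2 α β γ).trans (hρ.2 (π α) (π β) (π γ))⟩
  one_mem' := ⟨fun _ _ => rfl, fun _ _ _ => Iff.rfl⟩
  inv_mem' {ρ} hρ := by
    refine ⟨fun α β => ?_, fun α β γ => ?_⟩
    · have := hρ.1 (ρ⁻¹ α) (ρ⁻¹ β)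
      simpa using this.symm
    · have := hρ.2 (ρ⁻¹ α) (ρ⁻¹ β) (ρ⁻¹ γ)
      simpa using this.symm

/-! ### The rules that determine the maps `R`, `B` and `P` -/

/-- The rule for `R`: for each atom `t = (a, A)`, with `a` small and `A` large, `R Φ` takes `a`
to the first spot of `Φ t` and `A` to the second spot of `Φ t`. -/
def IsMapR {X : Type*} (f : FactorPair.aut X → (Req X ≃o Req X)) : Prop :=
  ∀ (Φ : FactorPair.aut X) (t : FactorPair X), IsSmallEquiv t.fst → IsLargeEquiv t.snd →
    f Φ t.fstReq = (Φ.1 t).fstReq ∧ f Φ t.sndReq = (Φ.1 t).sndReq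

/-- The rule for `B`: `(B Λ) α = β` iff `Λ` takes the set of small relations with block `α` onto
the set of small relations with block `β`. -/
def IsMapB {X : Type*} (f : (Req X ≃o Req X) → specialPerm X) : Prop :=
  ∀ (Λ : Req X ≃o Req X) (α β : SmallBlock X),
    (f Λ).1 α = β ↔ Λ '' smallWithBlock α = smallWithBlock β

/-- The rule for `P`: if `α ∩ β = {p}` and `ρ α ∩ ρ β = {x}`, then `(P ρ) p = x`. -/
def IsMapP {X : Type*} (f : specialPerm X → Equiv.Perm X) : Prop :=
  ∀ (ρ : specialPerm X) (α β : SmallBlock X) (p x : X),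
    α.1 ∩ β.1 = {p} → (ρ.1 α).1 ∩ (ρ.1 β).1 = {x} → f ρ p = x

/-!
Every automorphism of the poset of factor pairs of a `27`-element set is induced by a permutation
of the points. A factor pair `(a, A)` with `a` small (classes of size three) and `A` large (classes
of size nine) is called an atom; automorphisms preserve atoms and their orthogonality.

*The components of atoms.* The atoms orthogonal to `(a, A)` correspond to the factor pairs of the
nine-element set `X / a` (`FactorPair.link`). Counting them shows that two atoms have at most
`336` common orthogonal atoms if their first components differ (`FactorPair.ncard_common_le`), and
at least `360` if these agree and the second components agree on a union of three classes of `a` and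
on its complement (`FactorPair.lt_ncard_common`). The moves of the latter kind generate all changes
of the second component (`forall_pi_mem_of_triples`), so the first component of the image of an
atom depends only on its first component (`FactorPair.fst_map_eq`). A large relation is the
product of two small relations that lie below it and meet trivially, and any two atoms with the
same second component are linked by changes that keep two such small relations
(`FactorPair.forall_pi_mem_of_stabilizer`), so the second component of the image depends only on the
second component (`FactorPair.snd_map_eq`). Hence an automorphism acts on the small and on
the large relations, and it preserves containment, which can be read off from orthogonality. The
same holds for an automorphism of the poset of regular relations. Both kinds of automorphisms are
thereby reduced to `IncidenceAut`.

*From relations to classes.* For a small relation `a`, the maximal sets among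
`{A | a ≤ A and b ≤ A}` with `b ≠ a` are the sets of large relations above `a` that merge two given
classes of `a`. So an incidence automorphism acts on the pairs of classes of `a`. Whether two pairs
share a class can be told from which third pairs they force to be merged, and this yields the action
on the classes of `a` (`IncidenceAut.Corresponds`). The image of a class does not change when
two points outside it are exchanged in `a` (`IncidenceAut.Corresponds.class_eq`), so it depends
only on the class as a set, which gives a permutation of the three-element subsets.

*From blocks to points.* This permutation preserves disjointness, because disjoint blocks are those
that are classes of a common small relation. Therefore it is special
(`mem_specialPerm_of_disjoint_iff`), and a special permutation determines the image of the
intersection point of two blocks (`SmallBlock.mem_iff_of_inter_eq`). So it is induced by a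
permutation of `X`.

The permutations of `X` thus map isomorphically onto the three other groups, and the maps `R`, `B`
and `P` are composites of these isomorphisms and their inverses.
-/

/-! ### Equivalence relations with classes of constant finite size -/

/-- Every class of `r` has `n` elements. -/
def ClassCard {X : Type*} (r : Setoid X) (n : ℕ) : Prop :=
  ∀ x : X, {z | r z x}.ncard = n

instance setoid_finite (X : Type*) [Finite X] : Finite (Setoid X) :=
  Finite.of_injective (fun r : Setoid X => (fun x y => r x y : X → X → Prop))
    (fun _ _ h => Setoid.ext fun x y => iff_of_eq (congrFun (congrFun h x) y))

theorem ClassCard.eq_of_le {X : Type*} [Finite X] {r s : Setoid X} {n : ℕ}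
    (hr : ClassCard r n) (hs : ClassCard s n) (h : r ≤ s) : r = s := by
  refine le_antisymm h fun x y hxy => ?_
  have : {z | r z y} = {z | s z y} :=
    Set.eq_of_subset_of_ncard_le (fun z hz => h hz) (by rw [hr y, hs y])
  exact this.ge hxy

theorem ClassCard.exists_not_rel {X : Type*} [Finite X] {r s : Setoid X} {n : ℕ}
    (hr : ClassCard r n) (hs : ClassCard s n) (h : r ≠ s) : ∃ x y, r x y ∧ ¬ s x y := by
  by_contra! hc
  exact h (hr.eq_of_le hs fun {x y} hxy => hc x y hxy)

theorem ClassCard.card_fiber {X : Type*} {r : Setoid X} {n : ℕ} (hr : ClassCard r n)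
    (q : Quotient r) : Nat.card {x // Quotient.mk r x = q} = n := by
  induction q using Quotient.inductionOn with
  | h y =>
    rw [← hr y, ← Nat.card_coe_set_eq]
    exact Nat.card_congr (Equiv.subtypeEquivRight fun x => Quotient.eq)

theorem ClassCard.card_quotient {X : Type*} [Finite X] {r : Setoid X} {n : ℕ}
    (hr : ClassCard r n) : Nat.card X = Nat.card (Quotient r) * n := by
  rw [Nat.card_congr (Equiv.sigmaFiberEquiv (Quotient.mk r)).symm]
  have := Fintype.ofFinite (Quotient r)
  rw [Nat.card_sigma, Finset.sum_congr rfl (fun q _ => hr.card_fiber q)]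
  simp

theorem ClassCard.exists_equiv {X : Type*} [Finite X] {r : Setoid X} {n : ℕ}
    (hr : ClassCard r n) (m : ℕ) (hn : 0 < n) (hX : Nat.card X = m * n) :
    ∃ e : X ≃ Fin m × Fin n, ∀ x y, r x y ↔ (e x).1 = (e y).1 := by
  have hq : Nat.card (Quotient r) = m := by
    have := hr.card_quotient
    rw [hX] at this
    exact (Nat.eq_of_mul_eq_mul_right hn this).symm
  let eq := Finite.equivFinOfCardEq hq
  let ef := fun q => Finite.equivFinOfCardEq (hr.card_fiber q)
  refine ⟨(Equiv.sigmaFiberEquiv (Quotient.mk r)).symm.trans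
    ((Equiv.sigmaEquivProdOfEquiv ef).trans (eq.prodCongr (Equiv.refl _))), fun x y => ?_⟩
  change r x y ↔ eq (Quotient.mk r x) = eq (Quotient.mk r y)
  rw [eq.injective.eq_iff]
  exact Quotient.eq.symm

theorem classCard_ker_fst {X Q J : Type*} [Finite J] (e : X ≃ Q × J) :
    ClassCard (Setoid.ker fun x => (e x).1) (Nat.card J) := by
  intro x
  rw [← Nat.card_coe_set_eq]
  refine Nat.card_congr ⟨fun z => (e z.1).2, fun j => ⟨e.symm ((e x).1, j), ?_⟩, ?_, ?_⟩
  · change (e (e.symm _)).1 = _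
    simp
  · rintro ⟨z, hz⟩
    change (e z).1 = (e x).1 at hz
    simp [← hz]
  · intro j
    simp

theorem classCard_ker_snd {X Q J : Type*} [Finite Q] (e : X ≃ Q × J) :
    ClassCard (Setoid.ker fun x => (e x).2) (Nat.card Q) :=
  classCard_ker_fst (e.trans (Equiv.prodComm Q J))

theorem ClassCard.exists_ne_rel {X : Type*} [Finite X] {r : Setoid X} {n : ℕ}
    (hr : ClassCard r n) (hn : 1 < n) (x : X) : ∃ y, y ≠ x ∧ r y x := by
  rw [← hr x] at hn
  obtain ⟨y, hy, hne⟩ := Set.exists_ne_of_one_lt_ncard hn x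
  exact ⟨y, hne, hy⟩

theorem class_eq_of_rel {X : Type*} {r : Setoid X} {x y : X} (h : r x y) :
    {z | r z x} = {z | r z y} :=
  Set.ext fun _ => ⟨fun hz => r.trans hz h, fun hz => r.trans hz (r.symm h)⟩

theorem class_disjoint_of_not_rel {X : Type*} {r : Setoid X} {x y : X} (h : ¬ r x y) :
    Disjoint {z | r z x} {z | r z y} :=
  Set.disjoint_left.mpr fun _ hx hy => h (r.trans (r.symm hx) hy)

/-- Two partitions of a nine-element set into triples that share two classes are equal. -/
theorem ClassCard.eq_of_two_classes {Q : Type*} (hQ : Nat.card Q = 9)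
    {r s : Setoid Q} (hr : ClassCard r 3) (hs : ClassCard s 3) {x y : Q} (hxy : ¬ r x y)
    (hx : {z | r z x} = {z | s z x}) (hy : {z | r z y} = {z | s z y}) : r = s := by
  have : Finite Q := Nat.finite_of_card_ne_zero (by omega)
  have hU : ({z | r z x} ∪ {z | r z y})ᶜ.ncard = 3 := by
    rw [Set.ncard_compl, Set.ncard_union_eq (class_disjoint_of_not_rel hxy), hr, hr, hQ]
  have third : ∀ (t : Setoid Q), ClassCard t 3 → {z | r z x} = {z | t z x} →
      {z | r z y} = {z | t z y} → ∀ u, ¬ r u x → ¬ r u y →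
      {z | t z u} = ({z | r z x} ∪ {z | r z y})ᶜ := by
    intro t ht htx hty u hux huy
    refine Set.eq_of_subset_of_ncard_le (fun z hz hz' => ?_) (by rw [hU, ht])
    rw [htx, hty] at hz'
    rcases hz' with h | h
    · exact hux (htx.ge (t.trans (t.symm hz) h))
    · exact huy (hty.ge (t.trans (t.symm hz) h))
  refine hr.eq_of_le hs fun {u v} huv => ?_
  by_cases h1 : r u x
  · exact s.trans (hx.le h1) (s.symm (hx.le (r.trans (r.symm huv) h1)))
  by_cases h2 : r u y
  · exact s.trans (hy.le h2) (s.symm (hy.le (r.trans (r.symm huv) h2)))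
  have e1 := third r hr rfl rfl u h1 h2
  have e2 := third s hs hx hy u h1 h2
  exact s.symm ((e1.trans e2.symm).le (r.symm huv))

theorem class_ncard_of_mem_classes {X : Type*} {r : Setoid X} {n : ℕ} (hr : ClassCard r n)
    {c : Set X} (hc : c ∈ r.classes) : c.ncard = n := by
  obtain ⟨y, rfl⟩ := hc
  exact hr y

theorem isSmallEquiv_iff {X : Type*} (hX : Nat.card X = 27) (r : Setoid X) :
    IsSmallEquiv r ↔ ClassCard r 3 := by
  have : Finite X := Nat.finite_of_card_ne_zero (by omega)
  refine ⟨fun h x => h.2 _ (Setoid.mem_classes r x), fun h => ⟨?_, fun c hc => ?_⟩⟩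
  · have := h.card_quotient
    rw [Nat.card_congr (Setoid.quotientEquivClasses r), Nat.card_coe_set_eq] at this
    omega
  · exact class_ncard_of_mem_classes h hc

theorem isLargeEquiv_iff {X : Type*} (hX : Nat.card X = 27) (r : Setoid X) :
    IsLargeEquiv r ↔ ClassCard r 9 := by
  have : Finite X := Nat.finite_of_card_ne_zero (by omega)
  refine ⟨fun h x => h.2 _ (Setoid.mem_classes r x), fun h => ⟨?_, fun c hc => ?_⟩⟩
  · have := h.card_quotient
    rw [Nat.card_congr (Setoid.quotientEquivClasses r), Nat.card_coe_set_eq] at this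
    omega
  · exact class_ncard_of_mem_classes h hc

theorem ClassCard.isRegularEquiv {X : Type*} [Finite X] {r : Setoid X} {n : ℕ}
    (hr : ClassCard r n) : IsRegularEquiv r := by
  intro x y
  rw [← Set.cast_ncard (Set.toFinite _), ← Set.cast_ncard (Set.toFinite _), hr, hr]

theorem IsRegularEquiv.exists_classCard {X : Type*} [Finite X] {r : Setoid X}
    (hr : IsRegularEquiv r) : ∃ n, ClassCard r n := by
  cases isEmpty_or_nonempty X with
  | inl h => exact ⟨0, fun x => h.elim x⟩
  | inr h =>
    obtain ⟨x⟩ := h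
    refine ⟨{z | r z x}.ncard, fun y => ?_⟩
    have := hr y x
    rw [← Set.cast_ncard (Set.toFinite _), ← Set.cast_ncard (Set.toFinite _)] at this
    exact_mod_cast this

theorem ClassCard.eq_bot {X : Type*} [Finite X] {r : Setoid X} (hr : ClassCard r 1) : r = ⊥ := by
  refine le_antisymm (fun x y h => ?_) bot_le
  obtain ⟨w, hw⟩ := Set.ncard_eq_one.mp (hr y)
  have h1 : x ∈ ({w} : Set X) := hw ▸ h
  have h2 : y ∈ ({w} : Set X) := hw ▸ r.refl y
  exact (Set.mem_singleton_iff.mp h1).trans (Set.mem_singleton_iff.mp h2).symm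

theorem ClassCard.eq_top {X : Type*} [Finite X] {r : Setoid X} (hr : ClassCard r (Nat.card X)) :
    r = ⊤ := by
  refine le_antisymm le_top fun x y _ => ?_
  have : {z | r z y} = Set.univ :=
    Set.eq_of_subset_of_ncard_le (Set.subset_univ _) (by rw [hr y, Set.ncard_univ])
  exact this.ge trivial

theorem classCard_bot (X : Type*) : ClassCard (⊥ : Setoid X) 1 := by
  intro x
  rw [Set.ncard_eq_one]
  exact ⟨x, Set.ext fun z => Iff.rfl⟩

theorem classCard_top (X : Type*) : ClassCard (⊤ : Setoid X) (Nat.card X) := by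
  intro x
  rw [← Set.ncard_univ]
  congr 1

/-- The class sizes of a regular equivalence relation on `27` points are the divisors of `27`. -/
theorem IsRegularEquiv.cases {X : Type*} (hX : Nat.card X = 27) {r : Setoid X}
    (hr : IsRegularEquiv r) : r = ⊥ ∨ ClassCard r 3 ∨ ClassCard r 9 ∨ r = ⊤ := by
  have : Finite X := Nat.finite_of_card_ne_zero (by omega)
  obtain ⟨n, hn⟩ := hr.exists_classCard
  have hd : n ∣ 3 ^ 3 := by
    have := hn.card_quotient
    rw [hX] at this
    exact ⟨_, by rw [mul_comm, ← this]; norm_num⟩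
  obtain ⟨k, hk, rfl⟩ := (Nat.dvd_prime_pow Nat.prime_three).mp hd
  interval_cases k
  · exact Or.inl (ClassCard.eq_bot (by simpa using hn))
  · exact Or.inr (Or.inl (by simpa using hn))
  · exact Or.inr (Or.inr (Or.inl (by simpa using hn)))
  · exact Or.inr (Or.inr (Or.inr (ClassCard.eq_top (by rw [hX]; simpa using hn))))

theorem ClassCard.le_of_le {X : Type*} [Finite X] [Nonempty X] {r s : Setoid X} {m n : ℕ}
    (hr : ClassCard r m) (hs : ClassCard s n) (h : r ≤ s) : m ≤ n := by
  obtain ⟨x⟩ := ‹Nonempty X›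
  rw [← hr x, ← hs x]
  exact Set.ncard_le_ncard fun z hz => h hz

theorem ClassCard.permEquiv {X : Type*} {r : Setoid X} {n : ℕ} (hr : ClassCard r n)
    (σ : Equiv.Perm X) : ClassCard (permEquiv σ r) n := by
  intro x
  rw [← hr (σ.symm x), ← Set.ncard_image_of_injective {z | r z (σ.symm x)} σ.injective]
  congr 1
  ext z
  constructor
  · intro h
    exact ⟨σ.symm z, h, by simp⟩
  · rintro ⟨w, hw, rfl⟩
    change r (σ.symm (σ w)) _
    simpa using hw

/-- In a set with nine elements, two disjoint triples and their complement form a partition. -/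
theorem exists_classCard_of_disjoint {Q : Type*} (hQ : Nat.card Q = 9) {D E : Set Q}
    (hD : D.ncard = 3) (hE : E.ncard = 3) (h : Disjoint D E) :
    ∃ r : Setoid Q, ClassCard r 3 ∧ ∀ x y, r x y ↔ ((x ∈ D ↔ y ∈ D) ∧ (x ∈ E ↔ y ∈ E)) := by
  have : Finite Q := Nat.finite_of_card_ne_zero (by omega)
  refine ⟨Setoid.ker fun x => (x ∈ D, x ∈ E), fun x => ?_, fun x y => ?_⟩
  · have key : ∀ z x, (Setoid.ker fun x => (x ∈ D, x ∈ E)) z x ↔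
        ((z ∈ D ↔ x ∈ D) ∧ (z ∈ E ↔ x ∈ E)) := fun z x => by
      rw [Setoid.ker_def]; simp
    simp only [key]
    by_cases h1 : x ∈ D
    · have h2 : x ∉ E := Set.disjoint_left.mp h h1
      rw [← hD]
      congr 1
      ext z
      have := fun hz : z ∈ D => Set.disjoint_left.mp h hz
      change ((z ∈ D ↔ x ∈ D) ∧ (z ∈ E ↔ x ∈ E)) ↔ z ∈ D
      grind
    · by_cases h2 : x ∈ E
      · rw [← hE]
        congr 1
        ext z
        have := fun hz : z ∈ D => Set.disjoint_left.mp h hz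
        change ((z ∈ D ↔ x ∈ D) ∧ (z ∈ E ↔ x ∈ E)) ↔ z ∈ E
        grind
      · have : (D ∪ E)ᶜ.ncard = 3 := by
          rw [Set.ncard_compl, Set.ncard_union_eq h, hD, hE, hQ]
        rw [← this]
        congr 1
        ext z
        change ((z ∈ D ↔ x ∈ D) ∧ (z ∈ E ↔ x ∈ E)) ↔ ¬ (z ∈ D ∨ z ∈ E)
        grind
  · rw [Setoid.ker_def]; simp

/-! ### Factor pairs in coordinates -/

theorem equivPermute_of_forall {X : Type*} {r s : Setoid X}
    (h : ∀ x y z, r x y → s y z → ∃ w, s x w ∧ r w z) : EquivPermute r s := by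
  funext x z
  refine propext ⟨?_, ?_⟩
  · rintro ⟨y, hxy, hyz⟩
    exact h x y z hxy hyz
  · rintro ⟨y, hxy, hyz⟩
    obtain ⟨w, hw₁, hw₂⟩ := h z y x (r.symm hyz) (s.symm hxy)
    exact ⟨w, r.symm hw₂, s.symm hw₁⟩

theorem EquivPermute.exists_rel {X : Type*} {r s : Setoid X} (h : EquivPermute r s) {x y z : X}
    (hxy : r x y) (hyz : s y z) : ∃ w, s x w ∧ r w z :=
  (congrFun (congrFun h x) z).mp ⟨y, hxy, hyz⟩

namespace FactorPair

variable {X Q J : Type*}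

instance instFinite [Finite X] : Finite (FactorPair X) :=
  Finite.of_injective (fun t : FactorPair X => (t.fst, t.snd))
    (fun _ _ h => FactorPair.ext (congrArg Prod.fst h) (congrArg Prod.snd h))

theorem orth_iff_le_compl (t u : FactorPair X) : Orth t u ↔ t ≤ uᶜ := Iff.rfl

/-- The factor pair of the two coordinate maps of a bijection onto a product. -/
def ofEquiv (e : X ≃ Q × J) : FactorPair X where
  fst := Setoid.ker fun x => (e x).1
  snd := Setoid.ker fun x => (e x).2
  bij := bij_of_rel _ _ (fun _ _ h₁ h₂ => e.injective (Prod.ext h₁ h₂))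
    (fun x y => ⟨e.symm ((e x).1, (e y).2), by
      constructor
      · change (e (e.symm _)).1 = _
        simp
      · change (e (e.symm _)).2 = _
        simp⟩)

theorem ofEquiv_fst (e : X ≃ Q × J) (x y : X) : (ofEquiv e).fst x y ↔ (e x).1 = (e y).1 := Iff.rfl

theorem ofEquiv_snd (e : X ≃ Q × J) (x y : X) : (ofEquiv e).snd x y ↔ (e x).2 = (e y).2 := Iff.rfl

theorem exists_eq_ofEquiv (t : FactorPair X) (f : Quotient t.fst ≃ Q) (g : Quotient t.snd ≃ J) :
    ∃ e : X ≃ Q × J, t = ofEquiv e := by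
  refine ⟨(Equiv.ofBijective _ t.bij).trans (f.prodCongr g), FactorPair.ext ?_ ?_⟩
  · ext x y
    change _ ↔ f (Quotient.mk t.fst x) = f (Quotient.mk t.fst y)
    rw [f.injective.eq_iff]
    exact Quotient.eq.symm
  · ext x y
    change _ ↔ g (Quotient.mk t.snd x) = g (Quotient.mk t.snd y)
    rw [g.injective.eq_iff]
    exact Quotient.eq.symm

theorem card_eq (t : FactorPair X) :
    Nat.card X = Nat.card (Quotient t.fst) * Nat.card (Quotient t.snd) := by
  rw [Nat.card_congr (Equiv.ofBijective _ t.bij), Nat.card_prod]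

theorem classCard_snd [Finite X] (t : FactorPair X) {m n : ℕ} (hX : Nat.card X = m * n)
    (h0 : Nat.card X ≠ 0) (h : ClassCard t.fst m) : ClassCard t.snd n := by
  obtain ⟨k, hk⟩ := tᶜ.regular_fst.exists_classCard
  change ClassCard t.snd k at hk
  have h1 := t.card_eq
  have h2 := h.card_quotient
  have h3 := hk.card_quotient
  have hq : 0 < Nat.card (Quotient t.fst) := by
    rcases Nat.eq_zero_or_pos (Nat.card (Quotient t.fst)) with h | h
    · rw [h, zero_mul] at h1; exact absurd h1 h0
    · exact h
  have h4 : Nat.card (Quotient t.snd) = m := by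
    rw [h1] at h2
    exact Nat.eq_of_mul_eq_mul_left hq h2
  rw [h4, hX] at h3
  have hm : 0 < m := by
    rcases Nat.eq_zero_or_pos m with h | h
    · rw [h, zero_mul] at hX; exact absurd hX h0
    · exact h
  rw [Nat.eq_of_mul_eq_mul_left hm h3]
  exact hk

theorem classCard_fst [Finite X] (t : FactorPair X) {m n : ℕ} (hX : Nat.card X = m * n)
    (h0 : Nat.card X ≠ 0) (h : ClassCard t.snd n) : ClassCard t.fst m :=
  tᶜ.classCard_snd (by rw [hX, mul_comm]) h0 h

theorem exists_eq_ofEquiv_of_classCard (hX : Nat.card X = 27) {t : FactorPair X}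
    (h : ClassCard t.fst 3) : ∃ e : X ≃ Fin 9 × Fin 3, t = ofEquiv e := by
  have : Finite X := Nat.finite_of_card_ne_zero (by omega)
  have h2 := t.classCard_snd (n := 9) (by rw [hX]) (by omega) h
  have e1 := h.card_quotient
  have e2 := h2.card_quotient
  exact t.exists_eq_ofEquiv (Finite.equivFinOfCardEq (by omega))
    (Finite.equivFinOfCardEq (by omega))

theorem classCard_fst_ofEquiv (e : X ≃ Q × Fin 3) : ClassCard (ofEquiv e).fst 3 := by
  have := classCard_ker_fst e
  rwa [Nat.card_fin] at this

/-- The factor pair of `X ≃ Q × J` that refines the second coordinate by a factor pair of `Q`: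
if `Q ≃ Q₁ × Q₂` through `s`, it is the decomposition of `X` with factors
`Q₁ × J` and `Q₂`. -/
def link (e : X ≃ Q × J) (s : FactorPair Q) : FactorPair X where
  fst := Setoid.ker (fun x => (e x).2) ⊓ Setoid.comap (fun x => (e x).1) s.fst
  snd := Setoid.comap (fun x => (e x).1) s.snd
  bij := bij_of_rel _ _
    (fun _ _ h₁ h₂ => e.injective (Prod.ext (s.eq_of_rel h₁.2 h₂) h₁.1))
    (fun x y => by
      obtain ⟨q, h₁, h₂⟩ := s.exists_rel (e x).1 (e y).1
      refine ⟨e.symm (q, (e x).2), ⟨?_, ?_⟩, ?_⟩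
      · change (e (e.symm _)).2 = _
        simp
      · change s.fst (e (e.symm _)).1 _
        simpa using h₁
      · change s.snd (e (e.symm _)).1 _
        simpa using h₂)

theorem link_fst (e : X ≃ Q × J) (s : FactorPair Q) (x y : X) :
    (link e s).fst x y ↔ (e x).2 = (e y).2 ∧ s.fst (e x).1 (e y).1 := Iff.rfl

theorem link_snd (e : X ≃ Q × J) (s : FactorPair Q) (x y : X) :
    (link e s).snd x y ↔ s.snd (e x).1 (e y).1 := Iff.rfl

theorem orth_link (e : X ≃ Q × J) (s : FactorPair Q) : Orth (ofEquiv e) (link e s) := by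
  refine ⟨fun x y h => ?_, fun x y h => h.1, equivPermute_of_forall fun x y z h h' => ?_⟩
  · change s.snd (e x).1 (e y).1
    rw [(ofEquiv_fst e x y).mp h]
  · refine ⟨e.symm ((e z).1, (e x).2), ⟨?_, ?_⟩, ?_⟩
    · change _ = (e (e.symm _)).2
      simp
    · change s.fst (e x).1 (e (e.symm _)).1
      rw [(ofEquiv_fst e x y).mp h, Equiv.apply_symm_apply]
      exact h'.2
    · change (e (e.symm _)).1 = _
      simp

theorem orth_link_compl (e : X ≃ Q × J) (s : FactorPair Q) : Orth (link e s) (link e sᶜ) := by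
  refine ⟨fun x y h => h.2, fun x y h => h.2, equivPermute_of_forall fun x y z h h' => ?_⟩
  obtain ⟨q, h₁, h₂⟩ := s.exists_rel (e z).1 (e x).1
  refine ⟨e.symm (q, (e x).2), ⟨?_, ?_⟩, ?_, ?_⟩
  · change _ = (e (e.symm _)).2
    simp
  · change s.snd _ (e (e.symm _)).1
    simpa using s.snd.symm h₂
  · change (e (e.symm _)).2 = _
    simpa using h.1.trans h'.1
  · change s.fst (e (e.symm _)).1 _
    simpa using h₁

theorem link_fst_symm (e : X ≃ Q × J) (s : FactorPair Q) (j : J) (p q : Q) :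
    (link e s).fst (e.symm (p, j)) (e.symm (q, j)) ↔ s.fst p q := by
  rw [link_fst]
  simp

theorem link_snd_symm (e : X ≃ Q × J) (s : FactorPair Q) (j : J) (p q : Q) :
    (link e s).snd (e.symm (p, j)) (e.symm (q, j)) ↔ s.snd p q := by
  rw [link_snd]
  simp

theorem link_injective [Nonempty J] (e : X ≃ Q × J) : Function.Injective (link e) := by
  intro s t h
  obtain ⟨j⟩ := ‹Nonempty J›
  refine FactorPair.ext ?_ ?_
  · ext p q
    rw [← link_fst_symm e s j, h, link_fst_symm]
  · ext p q
    rw [← link_snd_symm e s j, h, link_snd_symm]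

/-- Every factor pair orthogonal to `ofEquiv e` comes from a factor pair of the set of first
coordinates, namely its restriction to a class of the second component. -/
theorem exists_eq_link [Nonempty J] (e : X ≃ Q × J) {v : FactorPair X} (h : Orth (ofEquiv e) v) :
    ∃ s, v = link e s := by
  obtain ⟨j⟩ := ‹Nonempty J›
  obtain ⟨h₁, h₂, h₃⟩ := h
  have hsnd : ∀ x, v.snd x (e.symm ((e x).1, j)) := fun x => h₁ (by
    rw [ofEquiv_fst]; simp)
  have hmove : ∀ x y i k, (e x).2 = i → (e y).2 = i → v.fst x y →
      v.fst (e.symm ((e x).1, k)) (e.symm ((e y).1, k)) := by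
    intro x y i k hx hy hxy
    obtain ⟨w, hw₁, hw₂⟩ := h₃.exists_rel (x := e.symm ((e x).1, k)) (y := x) (z := y)
      (by rw [ofEquiv_fst]; simp) hxy
    have hw : w = e.symm ((e y).1, k) := by
      apply e.injective
      have e1 := h₂ hw₁
      rw [ofEquiv_snd] at e1
      rw [ofEquiv_fst] at hw₂
      simp only [Equiv.apply_symm_apply] at e1 ⊢
      exact Prod.ext hw₂ e1.symm
    rwa [hw] at hw₁
  refine ⟨⟨Setoid.comap (fun q => e.symm (q, j)) v.fst,
    Setoid.comap (fun q => e.symm (q, j)) v.snd, bij_of_rel _ _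
    (fun p q hp hq => ?_) (fun p q => ?_)⟩, FactorPair.ext ?_ ?_⟩
  · have := v.eq_of_rel hp hq
    simpa using this
  · obtain ⟨z, hz₁, hz₂⟩ := v.exists_rel (e.symm (p, j)) (e.symm (q, j))
    have e1 := h₂ hz₁
    rw [ofEquiv_snd] at e1
    simp only [Equiv.apply_symm_apply] at e1
    have hz : z = e.symm ((e z).1, j) := by
      apply e.injective
      rw [Equiv.apply_symm_apply]
      exact Prod.ext rfl e1
    rw [hz] at hz₁ hz₂
    exact ⟨(e z).1, hz₁, hz₂⟩
  · ext x y
    rw [link_fst]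
    change _ ↔ _ ∧ v.fst (e.symm _) (e.symm _)
    constructor
    · intro hxy
      have hj : (e x).2 = (e y).2 := h₂ hxy
      exact ⟨hj, hmove x y _ j rfl hj.symm hxy⟩
    · rintro ⟨hj, hxy⟩
      have := hmove _ _ j (e x).2 (by simp) (by simp) hxy
      simp only [Equiv.apply_symm_apply, Prod.mk.eta, Equiv.symm_apply_apply] at this
      rw [hj] at this
      simpa using this
  · ext x y
    rw [link_snd]
    change _ ↔ v.snd (e.symm _) (e.symm _)
    exact ⟨fun h => v.snd.trans (v.snd.symm (hsnd x)) (v.snd.trans h (hsnd y)),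
      fun h => v.snd.trans (hsnd x) (v.snd.trans h (v.snd.symm (hsnd y)))⟩

theorem ncard_class_link (e : X ≃ Q × J) (s : FactorPair Q) (q : Q) (j : J) :
    {z | (link e s).fst z (e.symm (q, j))}.ncard = {p | s.fst p q}.ncard := by
  have hinj : Function.Injective fun p : Q => e.symm (p, j) := fun p p' h => by
    simpa using h
  rw [← Set.ncard_image_of_injective _ hinj]
  congr 1
  ext z
  rw [Set.mem_image]
  constructor
  · intro h
    obtain ⟨h₁, h₂⟩ := (link_fst _ _ _ _).mp h
    simp only [Equiv.apply_symm_apply] at h₁ h₂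
    refine ⟨(e z).1, h₂, ?_⟩
    rw [← h₁]
    simp
  · rintro ⟨p, hp, rfl⟩
    exact (link_fst_symm e s j p q).mpr hp

theorem classCard_link_iff [Nonempty J] (e : X ≃ Q × J) (s : FactorPair Q) (n : ℕ) :
    ClassCard (link e s).fst n ↔ ClassCard s.fst n := by
  constructor
  · intro h q
    obtain ⟨j⟩ := ‹Nonempty J›
    rw [← ncard_class_link e s q j, h]
  · intro h x
    have := ncard_class_link e s (e x).1 (e x).2
    rw [Prod.mk.eta, Equiv.symm_apply_apply] at this
    rw [this, h]

/-- Relabel the second coordinate by permutations that depend on the first coordinate. -/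
def twistSnd (e : X ≃ Q × J) (g : Q → Equiv.Perm J) : X ≃ Q × J :=
  e.trans (Equiv.prodShear (Equiv.refl Q) g)

theorem twistSnd_apply (e : X ≃ Q × J) (g : Q → Equiv.Perm J) (x : X) :
    twistSnd e g x = ((e x).1, g (e x).1 (e x).2) := rfl

theorem twistSnd_mul (e : X ≃ Q × J) (g h : Q → Equiv.Perm J) :
    twistSnd e (g * h) = twistSnd (twistSnd e h) g := rfl

/-- Relabel the first coordinate by permutations that depend on the second coordinate. -/
def twistFst (e : X ≃ Q × J) (g : J → Equiv.Perm Q) : X ≃ Q × J :=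
  (twistSnd (e.trans (Equiv.prodComm Q J)) g).trans (Equiv.prodComm J Q)

theorem twistFst_apply (e : X ≃ Q × J) (g : J → Equiv.Perm Q) (x : X) :
    twistFst e g x = (g (e x).2 (e x).1, (e x).2) := rfl

theorem twistFst_mul (e : X ≃ Q × J) (g h : J → Equiv.Perm Q) :
    twistFst e (g * h) = twistFst (twistFst e h) g := rfl

/-- Factor pairs with the same first component differ by a relabelling of its classes. -/
theorem exists_eq_twistSnd [Finite J] [Nonempty J] {e e' : X ≃ Q × J}
    (h : (ofEquiv e).fst = (ofEquiv e').fst) :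
    ∃ g : Q → Equiv.Perm J, ofEquiv e' = ofEquiv (twistSnd e g) := by
  have hfst : ∀ x y, (e x).1 = (e y).1 ↔ (e' x).1 = (e' y).1 := fun x y => by
    rw [← ofEquiv_fst, h, ofEquiv_fst]
  have hinj : ∀ q, Function.Injective fun j => (e' (e.symm (q, j))).2 := by
    intro q j j' hj
    have : e' (e.symm (q, j)) = e' (e.symm (q, j')) :=
      Prod.ext ((hfst _ _).mp (by simp)) hj
    simpa using this
  refine ⟨fun q => Equiv.ofBijective _ (Finite.injective_iff_bijective.mp (hinj q)),
    FactorPair.ext h.symm ?_⟩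
  ext x y
  rw [ofEquiv_snd, ofEquiv_snd]
  simp [twistSnd_apply]

theorem exists_eq_twistFst [Finite Q] [Nonempty Q] {e e' : X ≃ Q × J}
    (h : (ofEquiv e).snd = (ofEquiv e').snd) :
    ∃ g : J → Equiv.Perm Q, ofEquiv e' = ofEquiv (twistFst e g) := by
  obtain ⟨g, hg⟩ := exists_eq_twistSnd (e := e.trans (Equiv.prodComm Q J))
    (e' := e'.trans (Equiv.prodComm Q J)) h
  exact ⟨g, congrArg (fun t : FactorPair X => tᶜ) hg⟩

end FactorPair

/-! ### Factor pairs of a nine-element set -/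

theorem ClassCard.exists_equiv_of_not_rel {Q : Type*} (hQ : Nat.card Q = 9) {r : Setoid Q}
    (hr : ClassCard r 3) {y y' : Q} (h : ¬ r y y') :
    ∃ e : Q ≃ Fin 3 × Fin 3, (∀ p q, r p q ↔ (e p).1 = (e q).1) ∧ e y = (0, 0) ∧
      e y' = (1, 0) := by
  have : Finite Q := Nat.finite_of_card_ne_zero (by omega)
  obtain ⟨e, he⟩ := hr.exists_equiv 3 (by norm_num) (by omega)
  rw [he] at h
  have hπ : ∀ i k : Fin 3, i ≠ k → ∃ π : Equiv.Perm (Fin 3), π i = 0 ∧ π k = 1 := by decide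
  obtain ⟨π, h0, h1⟩ := hπ _ _ h
  refine ⟨e.trans (Equiv.prodShear π fun i =>
    if i = (e y).1 then Equiv.swap (e y).2 0 else Equiv.swap (e y').2 0),
    fun p q => ?_, ?_, ?_⟩
  · rw [he]
    exact π.injective.eq_iff.symm
  · simp [h0]
  · simp [h1, Ne.symm h]

namespace FactorPair

/-- A factor pair `s` of a nine-element set with all `s.fst`-classes of size `3` is determined by
`s.fst` and by the two bijections from one `s.fst`-class to the other two that follow the
`s.snd`-classes. If `s.snd` contains a fixed pair `y ≠ y'`, one of these
bijections has a prescribed value, so `2 * 6` choices remain; if `s.fst` is determined by its class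
of `z`, there are at most `Nat.choose 8 2` choices for `s.fst`. -/
theorem ncard_le_of_forall_snd {Q : Type*} (hQ : Nat.card Q = 9) (S : Set (FactorPair Q))
    (hS : ∀ s ∈ S, ClassCard s.fst 3) {y y' : Q} (hne : y ≠ y') (hy : ∀ s ∈ S, s.snd y y') (z : Q)
    (hz : ∀ s ∈ S, ∀ s' ∈ S, {w | s.fst w z} = {w | s'.fst w z} → s.fst = s'.fst) :
    S.ncard ≤ 336 := by
  classical
  have : Finite Q := Nat.finite_of_card_ne_zero (by omega)
  have := Fintype.ofFinite Q
  have hyn : ∀ s ∈ S, ¬ s.fst y y' := fun s hs h => hne (s.eq_of_rel h (hy s hs))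
  have hlab : ∀ r : Setoid Q, ∃ e : Q ≃ Fin 3 × Fin 3, ClassCard r 3 → ¬ r y y' →
      (∀ p q, r p q ↔ (e p).1 = (e q).1) ∧ e y = (0, 0) ∧ e y' = (1, 0) := by
    intro r
    by_cases h : ClassCard r 3 ∧ ¬ r y y'
    · obtain ⟨e, he⟩ := h.1.exists_equiv_of_not_rel hQ h.2
      exact ⟨e, fun _ _ => he⟩
    · exact ⟨(Finite.equivFinOfCardEq hQ).trans (finProdFinEquiv (m := 3) (n := 3)).symm,
        fun h1 h2 => absurd ⟨h1, h2⟩ h⟩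
  choose e he using hlab
  have hφ : ∀ s : FactorPair Q, ∃ φ : Fin 3 → Fin 3 → Fin 3, s ∈ S →
      ∀ i j, s.snd ((e s.fst).symm (0, j)) ((e s.fst).symm (i, φ i j)) := by
    intro s
    by_cases hs : s ∈ S
    · obtain ⟨h1, -, -⟩ := he s.fst (hS s hs) (hyn s hs)
      have : ∀ i j, ∃ k, s.snd ((e s.fst).symm (0, j)) ((e s.fst).symm (i, k)) := by
        intro i j
        obtain ⟨w, hw₁, hw₂⟩ := s.exists_rel ((e s.fst).symm (i, 0)) ((e s.fst).symm (0, j))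
        rw [h1, Equiv.apply_symm_apply] at hw₁
        change _ = i at hw₁
        refine ⟨(e s.fst w).2, ?_⟩
        rw [← hw₁, Prod.mk.eta, Equiv.symm_apply_apply]
        exact s.snd.symm hw₂
      choose φ hφ using this
      exact ⟨φ, fun _ => hφ⟩
    · exact ⟨fun _ j => j, fun h => absurd h hs⟩
  choose φ hφ using hφ
  have hrow : ∀ s ∈ S, ∀ i j k, s.snd ((e s.fst).symm (i, j)) ((e s.fst).symm (i, k)) → j = k := by
    intro s hs i j k h
    obtain ⟨h1, -, -⟩ := he s.fst (hS s hs) (hyn s hs)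
    have := s.eq_of_rel ((h1 _ _).mpr (by simp)) h
    simpa using this
  have hφ_inj : ∀ s ∈ S, ∀ i, Function.Injective (φ s i) := by
    intro s hs i j k hjk
    refine hrow s hs 0 j k (s.snd.trans (hφ s hs i j) ?_)
    rw [hjk]
    exact s.snd.symm (hφ s hs i k)
  have hφ_zero : ∀ s ∈ S, φ s 1 0 = 0 := by
    intro s hs
    obtain ⟨-, h2, h3⟩ := he s.fst (hS s hs) (hyn s hs)
    refine hrow s hs 1 _ _ (s.snd.trans (s.snd.symm (hφ s hs 1 0)) ?_)
    rw [← h2, ← h3, Equiv.symm_apply_apply, Equiv.symm_apply_apply]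
    exact hy s hs
  let A : Finset (Finset Q) := (Finset.univ.erase z).powersetCard 2
  let B : Finset (Fin 3 → Fin 3) := {f | Function.Injective f ∧ f 0 = 0}
  let C : Finset (Fin 3 → Fin 3) := {f | Function.Injective f}
  have hcard : (A ×ˢ (B ×ˢ C)).card = 336 := by
    have hA : A.card = 28 := by
      rw [Finset.card_powersetCard, Finset.card_erase_of_mem (Finset.mem_univ z),
        Finset.card_univ, ← Nat.card_eq_fintype_card, hQ]
      rfl
    have hB : B.card = 2 := by decide
    have hC : C.card = 6 := by decide
    rw [Finset.card_product, Finset.card_product, hA, hB, hC]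
  rw [← hcard, ← Set.ncard_coe_finset]
  refine Set.ncard_le_ncard_of_injOn
    (fun s => (({w | s.fst w z} : Finset Q).erase z, φ s 1, φ s 2)) ?_ ?_
  · intro s hs
    have hz0 : z ∈ ({w | s.fst w z} : Finset Q) := by
      simp
    have h3 : ({w | s.fst w z} : Finset Q).card = 3 := by
      rw [← hS s hs z, ← Set.ncard_coe_finset]
      simp
    rw [Finset.mem_coe, Finset.mem_product, Finset.mem_product]
    refine ⟨?_, ?_, ?_⟩
    · rw [Finset.mem_powersetCard]
      refine ⟨Finset.erase_subset_erase _ (Finset.subset_univ _), ?_⟩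
      rw [Finset.card_erase_of_mem hz0, h3]
    · exact Finset.mem_filter.mpr ⟨Finset.mem_univ _, hφ_inj s hs 1, hφ_zero s hs⟩
    · exact Finset.mem_filter.mpr ⟨Finset.mem_univ _, hφ_inj s hs 2⟩
  · intro s hs s' hs' h
    simp only [Prod.mk.injEq] at h
    obtain ⟨hc, h1, h2⟩ := h
    have hfst : s.fst = s'.fst := by
      refine hz s hs s' hs' (Set.ext fun w => ?_)
      by_cases hw : w = z
      · subst hw
        exact ⟨fun _ => s'.fst.refl _, fun _ => s.fst.refl _⟩
      · have := Finset.ext_iff.mp hc w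
        simpa [hw] using this
    have h0 : ∀ u ∈ S, ∀ j, φ u 0 j = j := fun u hu j =>
      (hrow u hu 0 _ _ (hφ u hu 0 j)).symm
    have hall : ∀ i, φ s i = φ s' i := by
      intro i
      fin_cases i
      · funext j
        exact (h0 s hs j).trans (h0 s' hs' j).symm
      · exact h1
      · exact h2
    have hle : ∀ u ∈ S, ∀ u' ∈ S, u.fst = u'.fst → (∀ i, φ u i = φ u' i) → u.snd ≤ u'.snd := by
      intro u hu u' hu' huu hφu p q hpq
      have hp : ∀ p : Q, ∃ j, u.snd ((e u.fst).symm (0, j)) p ∧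
          u'.snd ((e u.fst).symm (0, j)) p := by
        intro p
        obtain ⟨j, hj⟩ := (Finite.injective_iff_surjective.mp (hφ_inj u hu (e u.fst p).1))
          (e u.fst p).2
        have a1 := hφ u hu (e u.fst p).1 j
        have a2 := hφ u' hu' (e u.fst p).1 j
        rw [← huu, ← hφu] at a2
        rw [hj, Prod.mk.eta, Equiv.symm_apply_apply] at a1 a2
        exact ⟨j, a1, a2⟩
      obtain ⟨j, hj, hj'⟩ := hp p
      obtain ⟨k, hk, hk'⟩ := hp q
      have hjk := hrow u hu 0 j k (u.snd.trans hj (u.snd.trans hpq (u.snd.symm hk)))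
      subst hjk
      exact u'.snd.trans (u'.snd.symm hj') hk'
    exact FactorPair.ext hfst (le_antisymm (hle s hs s' hs' hfst hall)
      (hle s' hs' s hs hfst.symm fun i => (hall i).symm))

/-- The factor pairs of a nine-element set whose first component has a given triple `T` as a class
are the images of one of them under the permutations that fix `T` pointwise; the stabilizer
of a factor pair has at most two elements, the nontrivial one exchanging the other two classes. -/
theorem le_ncard_fst_class {Q : Type*} (hQ : Nat.card Q = 9) {T : Set Q} (hT : T.ncard = 3) :
    360 ≤ {s : FactorPair Q | ClassCard s.fst 3 ∧
      ∀ p q, s.fst p q → (p ∈ T ↔ q ∈ T)}.ncard := by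
  classical
  have : Finite Q := Nat.finite_of_card_ne_zero (by omega)
  have := Fintype.ofFinite Q
  obtain ⟨E, hE, hE3⟩ := Set.exists_subset_card_eq (s := Tᶜ) (n := 3)
    (by rw [Set.ncard_compl, hT, hQ]; norm_num)
  obtain ⟨r, hr, hrel⟩ := exists_classCard_of_disjoint hQ hT hE3
    (Set.disjoint_left.mpr fun _ h1 h2 => hE h2 h1)
  obtain ⟨t, ht⟩ := Set.nonempty_of_ncard_ne_zero (s := T) (by omega)
  obtain ⟨q₀, hq₀⟩ := Set.nonempty_of_ncard_ne_zero (s := E) (by omega)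
  obtain ⟨e, he, het, heq⟩ := hr.exists_equiv_of_not_rel hQ (y := t) (y' := q₀) (fun h =>
    hE hq₀ (((hrel _ _).mp h).1.mp ht))
  have hTe : ∀ q, q ∈ T ↔ (e q).1 = 0 := by
    intro q
    have h1 := he q t
    rw [het, hrel] at h1
    have h2 : t ∉ E := fun h => hE h ht
    have h3 : q ∈ T → q ∉ E := fun h h' => hE h' h
    rw [← h1]
    tauto
  let s₀ : FactorPair Q := ofEquiv e
  have hs₀ : ClassCard s₀.snd 3 := by
    have := classCard_ker_snd e
    rwa [Nat.card_fin] at this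
  let F : Equiv.Perm {q // q ∉ T} → FactorPair Q := fun g => perm (Equiv.Perm.ofSubtype g) s₀
  -- A permutation that fixes `T` and `q₀` and stabilizes `s₀` is the identity.
  have hstab : ∀ k : Equiv.Perm Q, perm k s₀ = s₀ → (∀ q ∈ T, k q = q) → k q₀ = q₀ → k = 1 := by
    intro k hk hkT hk₀
    have hf : ∀ u v, (e u).1 = (e v).1 → (e (k u)).1 = (e (k v)).1 := by
      intro u v huv
      have : (perm k s₀).fst (k u) (k v) := by
        change (e (k.symm (k u))).1 = (e (k.symm (k v))).1
        simpa using huv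
      rwa [hk] at this
    have hs : ∀ u v, (e u).2 = (e v).2 → (e (k u)).2 = (e (k v)).2 := by
      intro u v huv
      have : (perm k s₀).snd (k u) (k v) := by
        change (e (k.symm (k u))).2 = (e (k.symm (k v))).2
        simpa using huv
      rwa [hk] at this
    have hcol : ∀ q, (e (k q)).2 = (e q).2 := by
      intro q
      have h1 := hs q (e.symm (0, (e q).2)) (by simp)
      rwa [hkT (e.symm (0, (e q).2)) ((hTe _).mpr (by simp)), Equiv.apply_symm_apply] at h1
    have hrow1 : ∀ q, (e q).1 = 1 → k q = q := by
      intro q hq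
      have h1 := hf q q₀ (by rw [hq, heq])
      rw [hk₀, heq] at h1
      exact e.injective (Prod.ext (h1.trans hq.symm) (hcol q))
    have hrow : ∀ q i, (∀ q', (e q').1 = i → k q' = q') → (e (k q)).1 = i → (e q).1 = i := by
      intro q i hi hq
      rw [← k.injective (hi (k q) hq)]
      exact hq
    ext q
    have h3 : (e q).1 = 0 ∨ (e q).1 = 1 ∨ (e q).1 = 2 := by
      generalize (e q).1 = i
      revert i
      decide
    rcases h3 with h | h | h
    · exact hkT q ((hTe q).mpr h)
    · exact hrow1 q h
    · have h0 : (e (k q)).1 ≠ 0 := fun h' => by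
        have := hrow q 0 (fun q' hq' => hkT q' ((hTe q').mpr hq')) h'
        rw [h] at this
        exact absurd this (by decide)
      have h1 : (e (k q)).1 ≠ 1 := fun h' => by
        have := hrow q 1 hrow1 h'
        rw [h] at this
        exact absurd this (by decide)
      have h2 : (e (k q)).1 = 2 := by
        revert h0 h1
        generalize (e (k q)).1 = i
        revert i
        decide
      exact e.injective (Prod.ext (h2.trans h.symm) (hcol q))
  have hfix : ∀ (g : Equiv.Perm {q // q ∉ T}), ∀ q ∈ T, Equiv.Perm.ofSubtype g q = q :=
    fun g q hq => Equiv.Perm.ofSubtype_apply_of_not_mem g (by simpa using hq)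
  have hq₀T : q₀ ∉ T := hE hq₀
  have hfib : ∀ s ∈ Finset.image F Finset.univ,
      (Finset.univ.filter fun g => F g = s).card ≤ 2 := by
    intro s hs
    obtain ⟨g₀, -, rfl⟩ := Finset.mem_image.mp hs
    have hc : (({w | (F g₀).snd w t} : Finset Q).erase t).card = 2 := by
      have h3 : ({w | (F g₀).snd w t} : Finset Q).card = 3 := by
        have : ClassCard (F g₀).snd 3 := hs₀.permEquiv _
        rw [← this t, ← Set.ncard_coe_finset]
        simp
      rw [Finset.card_erase_of_mem (by simp), h3]
    rw [← hc]
    refine Finset.card_le_card_of_injOn (fun g => Equiv.Perm.ofSubtype g q₀) ?_ ?_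
    · intro g hg
      have hg : F g = F g₀ := by simpa using hg
      rw [Finset.mem_coe, Finset.mem_erase, Finset.mem_filter]
      refine ⟨fun h => ?_, Finset.mem_univ _, ?_⟩
      · refine hq₀T ?_
        rw [← hfix g t ht] at h
        rwa [(Equiv.Perm.ofSubtype g).injective h]
      · rw [← hg]
        change (e ((Equiv.Perm.ofSubtype g).symm _)).2 = (e ((Equiv.Perm.ofSubtype g).symm _)).2
        rw [Equiv.symm_apply_apply, Equiv.symm_apply_eq _ |>.mpr (hfix g t ht).symm, het, heq]
    · intro g hg g' hg' h
      have hg : F g = F g₀ := by simpa using hg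
      have hg' : F g' = F g₀ := by simpa using hg'
      have hgg : perm (Equiv.Perm.ofSubtype g') s₀ = perm (Equiv.Perm.ofSubtype g) s₀ :=
        hg'.trans hg.symm
      have h1 := hstab ((Equiv.Perm.ofSubtype g)⁻¹ * Equiv.Perm.ofSubtype g')
        (by rw [perm_mul, hgg, ← perm_mul, inv_mul_cancel, perm_one])
        (fun q hq => by
          rw [Equiv.Perm.mul_apply, hfix g' q hq, Equiv.Perm.inv_eq_iff_eq, hfix g q hq])
        (by rw [Equiv.Perm.mul_apply, Equiv.Perm.inv_eq_iff_eq]; exact h.symm)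
      exact Equiv.Perm.ofSubtype_injective (inv_mul_eq_one.mp h1)
  have hle := Finset.card_le_mul_card_image Finset.univ 2 hfib
  have h720 : (Finset.univ : Finset (Equiv.Perm {q // q ∉ T})).card = 720 := by
    rw [Finset.card_univ, Fintype.card_perm, ← Nat.card_eq_fintype_card]
    have : Nat.card {q // q ∉ T} = 6 := by
      have := Set.ncard_compl T
      rw [hT, hQ, ← Nat.card_coe_set_eq] at this
      exact this
    rw [this]
    rfl
  rw [h720] at hle
  have hsub : (Finset.image F Finset.univ : Set (FactorPair Q)) ⊆
      {s : FactorPair Q | ClassCard s.fst 3 ∧ ∀ p q, s.fst p q → (p ∈ T ↔ q ∈ T)} := by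
    intro s hs
    obtain ⟨g, -, rfl⟩ := Finset.mem_image.mp hs
    refine ⟨(classCard_fst_ofEquiv e).permEquiv _, fun p q hpq => ?_⟩
    change (e ((Equiv.Perm.ofSubtype g).symm p)).1 = (e ((Equiv.Perm.ofSubtype g).symm q)).1 at hpq
    have hmem : ∀ p, p ∈ T ↔ (Equiv.Perm.ofSubtype g).symm p ∈ T := by
      intro p
      constructor
      · intro hp
        rwa [Equiv.symm_apply_eq _ |>.mpr (hfix g p hp).symm]
      · intro hp
        have := hfix g _ hp
        rw [Equiv.apply_symm_apply] at this
        rwa [this]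
    rw [hmem p, hmem q, hTe, hTe, hpq]
  have := Set.ncard_le_ncard hsub
  rw [Set.ncard_coe_finset] at this
  omega

end FactorPair

/-! ### Counting common orthogonal atoms -/

namespace FactorPair

variable {X : Type*}

/-- The atoms that are orthogonal to both `t` and `u`. -/
def common (t u : FactorPair X) : Set (FactorPair X) :=
  {v | ClassCard v.fst 3 ∧ Orth t v ∧ Orth u v}

theorem common_ofEquiv {Q J : Type*} [Nonempty J] (e : X ≃ Q × J) (u : FactorPair X) :
    common (ofEquiv e) u = link e '' {s | ClassCard s.fst 3 ∧ Orth u (link e s)} := by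
  ext v
  constructor
  · rintro ⟨h₁, h₂, h₃⟩
    obtain ⟨s, rfl⟩ := exists_eq_link e h₂
    exact ⟨s, ⟨(classCard_link_iff e s 3).mp h₁, h₃⟩, rfl⟩
  · rintro ⟨s, ⟨h₁, h₂⟩, rfl⟩
    exact ⟨(classCard_link_iff e s 3).mpr h₁, orth_link e s, h₂⟩

/-- Partitions of a nine-element set into triples that refine a fixed nontrivial
equivalence relation `d` share a class, since one of the classes of `d` has three elements. -/
theorem exists_determining_point_of_le {Q : Type*} (hQ : Nat.card Q = 9) {d : Setoid Q} {p q : Q}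
    (hpq : ¬ d p q) : ∃ z, ∀ r s : Setoid Q, ClassCard r 3 → ClassCard s 3 → r ≤ d → s ≤ d →
      {w | r w z} = {w | s w z} → r = s := by
  have : Finite Q := Nat.finite_of_card_ne_zero (by omega)
  by_cases hex : ∃ r₀ : Setoid Q, ClassCard r₀ 3 ∧ r₀ ≤ d
  swap
  · exact ⟨p, fun r _ hr _ hrd => absurd ⟨r, hr, hrd⟩ hex⟩
  obtain ⟨r₀, hr₀, hd₀⟩ := hex
  have key : ∃ a b, ¬ d a b ∧ ∀ w, d w a → r₀ w a := by
    by_cases hp : ∀ w, d w p → r₀ w p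
    · exact ⟨p, q, hpq, hp⟩
    push Not at hp
    obtain ⟨w, hwd, hwr⟩ := hp
    refine ⟨q, p, fun h => hpq (d.symm h), fun v hv => ?_⟩
    by_contra hvq
    have hvp : ¬ r₀ v p := fun h => hpq (d.trans (d.symm (hd₀ h)) hv)
    have hvw : ¬ r₀ v w := fun h => hpq (d.trans (d.symm (d.trans (hd₀ h) hwd)) hv)
    have hqp : ¬ r₀ q p := fun h => hpq (d.symm (hd₀ h))
    have hqw : ¬ r₀ q w := fun h => hpq (d.symm (d.trans (hd₀ h) hwd))
    -- Four distinct classes of size three do not fit into nine points.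
    have h1 : ({x | r₀ x w} ∪ {x | r₀ x p}).ncard = 6 := by
      rw [Set.ncard_union_eq (class_disjoint_of_not_rel hwr), hr₀, hr₀]
    have h2 : ({x | r₀ x v} ∪ {x | r₀ x q}).ncard = 6 := by
      rw [Set.ncard_union_eq (class_disjoint_of_not_rel hvq), hr₀, hr₀]
    have h3 : Disjoint ({x | r₀ x w} ∪ {x | r₀ x p}) ({x | r₀ x v} ∪ {x | r₀ x q}) := by
      rw [Set.disjoint_union_left, Set.disjoint_union_right, Set.disjoint_union_right]
      exact ⟨⟨(class_disjoint_of_not_rel hvw).symm, (class_disjoint_of_not_rel hqw).symm⟩,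
        (class_disjoint_of_not_rel hvp).symm, (class_disjoint_of_not_rel hqp).symm⟩
    have h4 := Set.ncard_union_eq h3
    have h5 := Set.ncard_le_ncard (Set.subset_univ
      (({x | r₀ x w} ∪ {x | r₀ x p}) ∪ ({x | r₀ x v} ∪ {x | r₀ x q})))
    rw [Set.ncard_univ, hQ] at h5
    omega
  obtain ⟨a, z, haz, ha⟩ := key
  have hcls : ∀ r : Setoid Q, ClassCard r 3 → r ≤ d → {w | r w a} = {w | r₀ w a} := fun r hr hrd =>
    Set.eq_of_subset_of_ncard_le (fun w hw => ha w (hrd hw)) (by rw [hr, hr₀])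
  exact ⟨z, fun r s hr hs hrd hsd hz => hr.eq_of_two_classes hQ hs (fun h => haz (hrd h))
    ((hcls r hr hrd).trans (hcls s hs hsd).symm) hz⟩

/-- Two atoms with different first components have few common orthogonal atoms. -/
theorem ncard_common_le (hX : Nat.card X = 27) {t u : FactorPair X} (ht : ClassCard t.fst 3)
    (hu : ClassCard u.fst 3) (hne : t.fst ≠ u.fst) : (common t u).ncard ≤ 336 := by
  have : Finite X := Nat.finite_of_card_ne_zero (by omega)
  obtain ⟨x, y, hxy, hxy'⟩ := hu.exists_not_rel ht hne.symm
  have ht2 := t.classCard_snd (n := 9) (by rw [hX]) (by omega) ht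
  have hu2 := u.classCard_snd (n := 9) (by rw [hX]) (by omega) hu
  obtain ⟨e, rfl⟩ := exists_eq_ofEquiv_of_classCard hX ht
  rw [common_ofEquiv, Set.ncard_image_of_injective _ (link_injective e)]
  rw [ofEquiv_fst] at hxy'
  have hcomm : ∀ s : FactorPair (Fin 9), Orth u (link e s) → s.snd (e x).1 (e y).1 :=
    fun s hs => hs.1 hxy
  suffices hz : ∃ z, ∀ s ∈ {s | ClassCard s.fst 3 ∧ Orth u (link e s)},
      ∀ s' ∈ {s | ClassCard s.fst 3 ∧ Orth u (link e s)},
      {w | s.fst w z} = {w | s'.fst w z} → s.fst = s'.fst by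
    obtain ⟨z, hz⟩ := hz
    exact ncard_le_of_forall_snd (Nat.card_fin 9) _ (fun s hs => hs.1) hxy'
      (fun s hs => hcomm s hs.2) z hz
  by_cases hsnd : (ofEquiv e).snd = u.snd
  · -- Moving along `u.fst` from the `u.snd`-class of `x` to that of `y` permutes the first
    -- coordinates and preserves each `s.fst`, so the class of `(e x).1` determines a second one.
    have hf : ∀ q, ∃ w, u.fst w (e.symm (q, (e x).2)) ∧ u.snd w y := fun q => u.exists_rel _ _
    choose f hf₁ hf₂ using hf
    have hfj : ∀ q, (e (f q)).2 = (e y).2 := fun q => by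
      have := hf₂ q
      rwa [← hsnd, ofEquiv_snd] at this
    have hinj : Function.Injective fun q => (e (f q)).1 := by
      intro p q hpq
      have h1 : f p = f q := e.injective (Prod.ext hpq ((hfj p).trans (hfj q).symm))
      have h2 : u.fst (e.symm (p, (e x).2)) (e.symm (q, (e x).2)) :=
        u.fst.trans (u.fst.symm (hf₁ p)) (by rw [h1]; exact hf₁ q)
      have h3 : u.snd (e.symm (p, (e x).2)) (e.symm (q, (e x).2)) := by
        rw [← hsnd, ofEquiv_snd]
        simp
      simpa using u.eq_of_rel h2 h3
    have hfx : f (e x).1 = y := by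
      refine u.eq_of_rel (u.fst.trans (hf₁ _) ?_) (hf₂ _)
      rw [Prod.mk.eta, Equiv.symm_apply_apply]
      exact hxy
    have hpres : ∀ s : FactorPair (Fin 9), Orth u (link e s) → ∀ p q, s.fst p q →
        s.fst (e (f p)).1 (e (f q)).1 := by
      intro s hs p q hpq
      obtain ⟨m, hm₁, hm₂⟩ := hs.2.2.exists_rel (hf₁ p)
        ((link_fst_symm e s (e x).2 p q).mpr hpq)
      have : m = f q := u.eq_of_rel (u.fst.trans hm₂ (u.fst.symm (hf₁ q)))
        (u.snd.trans (u.snd.symm (hs.2.1 hm₁)) (u.snd.trans (hf₂ p) (u.snd.symm (hf₂ q))))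
      subst this
      exact hm₁.2
    have himg : ∀ s : FactorPair (Fin 9), ClassCard s.fst 3 → Orth u (link e s) →
        {w | s.fst w (e y).1} = (fun q => (e (f q)).1) '' {w | s.fst w (e x).1} := by
      intro s hs ho
      refine (Set.eq_of_subset_of_ncard_le ?_ ?_).symm
      · rintro _ ⟨w, hw, rfl⟩
        have := hpres s ho _ _ hw
        rwa [hfx] at this
      · rw [Set.ncard_image_of_injective _ hinj, hs, hs]
    refine ⟨(e x).1, fun s hs s' hs' h => ?_⟩
    refine hs.1.eq_of_two_classes (Nat.card_fin 9) hs'.1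
      (fun h' => hxy' (s.eq_of_rel h' (hcomm s hs.2))) h ?_
    rw [himg s hs.1 hs.2, himg s' hs'.1 hs'.2, h]
  · -- Each `s.fst` refines the relation that `u.snd` induces on the first coordinates of a class
    -- of `(ofEquiv e).snd`, and for some class this relation is not full.
    obtain ⟨a, b, hab, hab'⟩ := ht2.exists_not_rel hu2 hsnd
    rw [ofEquiv_snd] at hab
    let d : Setoid (Fin 9) := Setoid.comap (fun q => e.symm (q, (e a).2)) u.snd
    have hd : ¬ d (e a).1 (e b).1 := by
      change ¬ u.snd (e.symm ((e a).1, (e a).2)) (e.symm ((e b).1, (e a).2))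
      rw [hab]
      nth_rw 1 [← hab]
      simpa using hab'
    have hle : ∀ s : FactorPair (Fin 9), Orth u (link e s) → s.fst ≤ d := fun s hs p q hpq =>
      hs.2.1 ((link_fst_symm e s (e a).2 p q).mpr hpq)
    obtain ⟨z, hz⟩ := exists_determining_point_of_le (Nat.card_fin 9) hd
    exact ⟨z, fun s hs s' hs' h => hz _ _ hs.1 hs'.1 (hle s hs.2) (hle s' hs'.2) h⟩

/-- Two atoms with the same first component `a`, whose second components agree on a union of three
classes of `a` and on the complement, have many common orthogonal atoms. -/
theorem lt_ncard_common (hX : Nat.card X = 27) (e : X ≃ Fin 9 × Fin 3) {u : FactorPair X}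
    (hfst : u.fst = (ofEquiv e).fst) {T : Set (Fin 9)} (hT : T.ncard = 3)
    (h : ∀ x y, ((e x).1 ∈ T ↔ (e y).1 ∈ T) → (e x).2 = (e y).2 → u.snd x y) :
    336 < (common (ofEquiv e) u).ncard := by
  have : Finite X := Nat.finite_of_card_ne_zero (by omega)
  rw [common_ofEquiv, Set.ncard_image_of_injective _ (link_injective e)]
  have h1 := le_ncard_fst_class (Nat.card_fin 9) hT
  have h2 : {s : FactorPair (Fin 9) | ClassCard s.fst 3 ∧ ∀ p q, s.fst p q → (p ∈ T ↔ q ∈ T)} ⊆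
      {s | ClassCard s.fst 3 ∧ Orth u (link e s)} := by
    rintro s ⟨hs, hsT⟩
    refine ⟨hs, ?_, fun x y hxy => h x y (hsT _ _ hxy.2) hxy.1, ?_⟩
    · rw [hfst]
      exact (orth_link e s).1
    · rw [hfst]
      exact (orth_link e s).2.2
  have h3 := Set.ncard_le_ncard h2
  omega

end FactorPair

/-! ### Generators of groups of relabellings -/

theorem Equiv.Perm.forall_pi_mem_of_mulSingle_swap {I K : Type*} [Finite I] [DecidableEq I]
    [Finite K] [DecidableEq K] (H : Subgroup (I → Equiv.Perm K))
    (h : ∀ (i : I) (x y : K), x ≠ y →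
      (Pi.mulSingle i (Equiv.swap x y) : I → Equiv.Perm K) ∈ H) (g : I → Equiv.Perm K) : g ∈ H := by
  refine Subgroup.pi_mem_of_mulSingle_mem g fun i => ?_
  refine Equiv.Perm.swap_induction_on (g i) ?_ fun f x y hxy hf => ?_
  · rw [Pi.mulSingle_one]
    exact H.one_mem
  · rw [Pi.mulSingle_mul]
    exact H.mul_mem (h i x y hxy) hf

/-- An involution supported at one index is a product of three copies supported at triples of
indices: `{0} = {1, 2, 3} ∆ {1, 4, 0} ∆ {2, 3, 4}`. -/
theorem forall_pi_mem_of_triples {K : Type*} [Finite K] [DecidableEq K]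
    (H : Subgroup (Fin 9 → Equiv.Perm K))
    (h : ∀ g : Fin 9 → Equiv.Perm K, ∀ T : Set (Fin 9), T.ncard = 3 → ∀ π : Equiv.Perm K,
      (∀ q ∈ T, g q = π) → (∀ q ∉ T, g q = 1) → g ∈ H) (g : Fin 9 → Equiv.Perm K) : g ∈ H := by
  refine Equiv.Perm.forall_pi_mem_of_mulSingle_swap H (fun i x y _ => ?_) g
  have hmem : ∀ S : Finset (Fin 9), S.card = 3 →
      (fun q => if q - i ∈ S then Equiv.swap x y else 1) ∈ H := by
    intro S hS
    refine h _ {q | q - i ∈ S} ?_ (Equiv.swap x y) (fun q hq => if_pos hq) (fun q hq => if_neg hq)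
    rw [← hS, ← Set.ncard_coe_finset,
      ← Set.ncard_image_of_injective _ (Equiv.subRight i).injective]
    congr 1
    ext q
    rw [Set.mem_image]
    constructor
    · rintro ⟨p, hp, rfl⟩
      exact hp
    · intro hq
      exact ⟨q + i, by simpa using hq, by simp⟩
  have hprod : (Pi.mulSingle i (Equiv.swap x y) : Fin 9 → Equiv.Perm K) =
      (fun q => if q - i ∈ ({1, 2, 3} : Finset (Fin 9)) then Equiv.swap x y else 1) *
      (fun q => if q - i ∈ ({1, 4, 0} : Finset (Fin 9)) then Equiv.swap x y else 1) *
      (fun q => if q - i ∈ ({2, 3, 4} : Finset (Fin 9)) then Equiv.swap x y else 1) := by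
    funext q
    have hq : q = i ↔ q - i = 0 := sub_eq_zero.symm
    rw [Pi.mulSingle_apply, Pi.mul_apply, Pi.mul_apply]
    simp only [hq]
    generalize q - i = k
    fin_cases k <;> simp
  rw [hprod]
  exact H.mul_mem (H.mul_mem (hmem _ rfl) (hmem _ rfl)) (hmem _ rfl)

theorem exists_perm_apply_zero_one {x y : Fin 9} (h : x ≠ y) :
    ∃ σ : Equiv.Perm (Fin 9), σ 0 = x ∧ σ 1 = y := by
  refine ⟨Equiv.swap y (Equiv.swap 0 x 1) * Equiv.swap 0 x, ?_, ?_⟩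
  · rw [Equiv.Perm.mul_apply, Equiv.swap_apply_left, Equiv.swap_apply_of_ne_of_ne h]
    intro h'
    have := (Equiv.swap 0 x).injective ((Equiv.swap_apply_left 0 x).trans h')
    exact absurd this (by decide)
  · rw [Equiv.Perm.mul_apply, Equiv.swap_apply_right]

/-- The bijection `Fin 9 ≃ Fin 3 × Fin 3` that sends `0, …, 8` to the cells of a square with
rows `{0, 2, 4}`, `{1, 3, 5}`, `{6, 7, 8}` and columns `{0, 1, 6}`, `{2, 3, 7}`, `{4, 5, 8}`. -/
def squareEquiv : Fin 9 ≃ Fin 3 × Fin 3 where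
  toFun := ![(0, 0), (1, 0), (0, 1), (1, 1), (0, 2), (1, 2), (2, 0), (2, 1), (2, 2)]
  invFun p := ![![0, 2, 4], ![1, 3, 5], ![6, 7, 8]] p.1 p.2
  left_inv := by decide
  right_inv := by decide

namespace FactorPair

/-- Two rows of a square can be exchanged, so a product of three disjoint transpositions stabilizes
some factor pair with classes of size three; a transposition is a
product of three such permutations. -/
theorem forall_pi_mem_of_stabilizer {I : Type*} [Finite I] [DecidableEq I]
    (H : Subgroup (I → Equiv.Perm (Fin 9)))
    (h : ∀ (i : I) (π : Equiv.Perm (Fin 9)) (s : FactorPair (Fin 9)), ClassCard s.fst 3 →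
      perm π s = s → (Pi.mulSingle i π : I → Equiv.Perm (Fin 9)) ∈ H)
    (g : I → Equiv.Perm (Fin 9)) : g ∈ H := by
  refine Equiv.Perm.forall_pi_mem_of_mulSingle_swap H (fun i x y hxy => ?_) g
  obtain ⟨σ, rfl, rfl⟩ := exists_perm_apply_zero_one hxy
  let π₀ : Equiv.Perm (Fin 9) := Equiv.swap 0 1 * Equiv.swap 2 3 * Equiv.swap 4 5
  have hπ₀ : perm π₀ (ofEquiv squareEquiv) = ofEquiv squareEquiv := by
    refine FactorPair.ext (Setoid.ext fun p q => ?_) (Setoid.ext fun p q => ?_)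
    · change (squareEquiv (π₀.symm p)).1 = (squareEquiv (π₀.symm q)).1 ↔
        (squareEquiv p).1 = (squareEquiv q).1
      revert p q
      decide
    · change (squareEquiv (π₀.symm p)).2 = (squareEquiv (π₀.symm q)).2 ↔
        (squareEquiv p).2 = (squareEquiv q).2
      revert p q
      decide
  have hmem : ∀ τ : Equiv.Perm (Fin 9),
      (Pi.mulSingle i (τ * π₀ * τ⁻¹) : I → Equiv.Perm (Fin 9)) ∈ H := by
    intro τ
    refine h i _ (perm τ (ofEquiv squareEquiv)) ((classCard_fst_ofEquiv _).permEquiv τ) ?_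
    rw [← perm_mul, inv_mul_cancel_right, perm_mul, hπ₀]
  have hprod : Equiv.swap (0 : Fin 9) 1 =
      π₀ * (Equiv.swap 4 6 * Equiv.swap 5 7 * π₀ * (Equiv.swap 4 6 * Equiv.swap 5 7)⁻¹) *
      (Equiv.swap 2 6 * Equiv.swap 3 7 * π₀ * (Equiv.swap 2 6 * Equiv.swap 3 7)⁻¹) := by
    decide
  have hconj : Equiv.swap (σ 0) (σ 1) = (σ * π₀ * σ⁻¹) *
      ((σ * (Equiv.swap 4 6 * Equiv.swap 5 7)) * π₀ *
        (σ * (Equiv.swap 4 6 * Equiv.swap 5 7))⁻¹) *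
      ((σ * (Equiv.swap 2 6 * Equiv.swap 3 7)) * π₀ *
        (σ * (Equiv.swap 2 6 * Equiv.swap 3 7))⁻¹) := by
    rw [Equiv.swap_apply_apply, hprod]
    group
  rw [hconj, Pi.mulSingle_mul, Pi.mulSingle_mul]
  exact H.mul_mem (H.mul_mem (hmem _) (hmem _)) (hmem _)

end FactorPair

/-! ### Automorphisms act on the two components separately -/

namespace FactorPair

variable {X : Type*}

/-- The least factor pair, with components equality and the full relation. -/
def least (X : Type*) : FactorPair X where
  fst := ⊥
  snd := ⊤
  bij := bij_of_rel _ _ (fun _ _ h _ => h) (fun x _ => ⟨x, rfl, trivial⟩)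

theorem least_le (t : FactorPair X) : least X ≤ t :=
  ⟨bot_le (a := t.fst), le_top (a := t.snd), equivPermute_of_forall fun x y z h h' => by
    change x = y at h
    subst h
    exact ⟨z, h', rfl⟩⟩

theorem le_compl_least (t : FactorPair X) : t ≤ (least X)ᶜ := by
  refine ⟨le_top (a := t.fst), bot_le (a := t.snd), equivPermute_of_forall fun x y z h h' => ?_⟩
  change y = z at h'
  subst h'
  exact ⟨x, rfl, h⟩

theorem exists_classCard_lt (hX : Nat.card X = 27) {t u : FactorPair X} (h : t < u) :
    ∃ m n, ClassCard t.fst m ∧ ClassCard u.fst n ∧ m < n ∧ m ∣ 27 ∧ n ∣ 27 := by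
  have : Finite X := Nat.finite_of_card_ne_zero (by omega)
  have : Nonempty X := (Nat.card_pos_iff.mp (by omega)).1
  obtain ⟨m, hm⟩ := t.regular_fst.exists_classCard
  obtain ⟨n, hn⟩ := u.regular_fst.exists_classCard
  have hd : ∀ {r : Setoid X} {k}, ClassCard r k → k ∣ 27 := fun hk =>
    ⟨_, by rw [mul_comm, ← hk.card_quotient, hX]⟩
  refine ⟨m, n, hm, hn, lt_of_le_of_ne (hm.le_of_le hn h.le.1) ?_, hd hm, hd hn⟩
  rintro rfl
  obtain ⟨k, hk⟩ := hd hm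
  have h1 := t.classCard_snd (by rw [hX, hk]) (by omega) hm
  have h2 := u.classCard_snd (by rw [hX, hk]) (by omega) hn
  exact h.ne (FactorPair.ext (hm.eq_of_le hn h.le.1) (h2.eq_of_le h1 h.le.2.1).symm)

theorem exists_coatom (hX : Nat.card X = 27) {t : FactorPair X} (ht : ClassCard t.fst 3) :
    ∃ u, t < u ∧ ClassCard u.fst 9 := by
  have : Finite X := Nat.finite_of_card_ne_zero (by omega)
  have : Nonempty X := (Nat.card_pos_iff.mp (by omega)).1
  obtain ⟨e, rfl⟩ := exists_eq_ofEquiv_of_classCard hX ht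
  have h1 : ClassCard (link e (ofEquiv squareEquiv)).fst 3 :=
    (classCard_link_iff e _ 3).mpr (classCard_fst_ofEquiv _)
  have h2 : ClassCard (link e (ofEquiv squareEquiv))ᶜ.fst 9 :=
    classCard_snd _ (by rw [hX]) (by omega) h1
  refine ⟨(link e (ofEquiv squareEquiv))ᶜ, lt_of_le_of_ne (orth_link e _) fun h => ?_, h2⟩
  rw [← h] at h2
  have := ht.le_of_le h2 le_rfl
  have := h2.le_of_le ht le_rfl
  omega

/-- The factor pairs with first component small are those at height one in a chain of length
three. -/
theorem classCard_fst_iff (hX : Nat.card X = 27) (t : FactorPair X) :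
    ClassCard t.fst 3 ↔ ∃ b u w : FactorPair X, b < t ∧ t < u ∧ u < w := by
  have : Finite X := Nat.finite_of_card_ne_zero (by omega)
  have : Nonempty X := (Nat.card_pos_iff.mp (by omega)).1
  constructor
  · intro ht
    obtain ⟨u, hu, hu9⟩ := exists_coatom hX ht
    refine ⟨least X, u, (least X)ᶜ, lt_of_le_of_ne (least_le t) ?_, hu,
      lt_of_le_of_ne (le_compl_least u) ?_⟩
    · rintro rfl
      have := ht.le_of_le (classCard_bot X) le_rfl
      omega
    · rintro rfl
      have := (classCard_top X).le_of_le hu9 le_rfl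
      omega
  · rintro ⟨b, u, w, h1, h2, h3⟩
    obtain ⟨m, n, hm, hn, hmn, hm27, hn27⟩ := exists_classCard_lt hX h1
    obtain ⟨n', k, hn', hk, hnk, -, hk27⟩ := exists_classCard_lt hX h2
    obtain ⟨k', l, hk', hl, hkl, -, hl27⟩ := exists_classCard_lt hX h3
    have e1 : n' = n := le_antisymm (hn'.le_of_le hn le_rfl) (hn.le_of_le hn' le_rfl)
    have e2 : k' = k := le_antisymm (hk'.le_of_le hk le_rfl) (hk.le_of_le hk' le_rfl)
    subst e1 e2
    have hdiv : ∀ d, d ∣ 27 → d = 1 ∨ d = 3 ∨ d = 9 ∨ d = 27 := by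
      intro d hd
      obtain ⟨k, hk, rfl⟩ := (Nat.dvd_prime_pow Nat.prime_three (m := 3)).mp hd
      interval_cases k <;> simp
    have := hdiv m hm27
    have := hdiv n' hn27
    have := hdiv k' hk27
    have := hdiv l hl27
    have : n' = 3 := by omega
    subst this
    exact hn

variable {Φ : FactorPair X ≃o FactorPair X}

theorem classCard_fst_map_iff (hX : Nat.card X = 27) (Φ : FactorPair X ≃o FactorPair X)
    (t : FactorPair X) : ClassCard (Φ t).fst 3 ↔ ClassCard t.fst 3 := by
  rw [classCard_fst_iff hX, classCard_fst_iff hX]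
  constructor
  · rintro ⟨b, u, w, h1, h2, h3⟩
    refine ⟨Φ.symm b, Φ.symm u, Φ.symm w, ?_, ?_, Φ.symm.lt_iff_lt.mpr h3⟩
    · rwa [← Φ.lt_iff_lt, Φ.apply_symm_apply]
    · rwa [← Φ.lt_iff_lt, Φ.apply_symm_apply]
  · rintro ⟨b, u, w, h1, h2, h3⟩
    exact ⟨Φ b, Φ u, Φ w, Φ.lt_iff_lt.mpr h1, Φ.lt_iff_lt.mpr h2, Φ.lt_iff_lt.mpr h3⟩

theorem orth_map_iff (hΦ : ∀ t, Φ tᶜ = (Φ t)ᶜ) (t u : FactorPair X) :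
    Orth (Φ t) (Φ u) ↔ Orth t u := by
  rw [orth_iff_le_compl, orth_iff_le_compl, ← hΦ, Φ.le_iff_le]

theorem ncard_common_map (hX : Nat.card X = 27) (hΦ : ∀ t, Φ tᶜ = (Φ t)ᶜ) (t u : FactorPair X) :
    (common (Φ t) (Φ u)).ncard = (common t u).ncard := by
  rw [← Set.ncard_image_of_injective (common t u) Φ.injective]
  congr 1
  ext v
  constructor
  · rintro ⟨h1, h2, h3⟩
    obtain ⟨w, rfl⟩ := Φ.surjective v
    exact ⟨w, ⟨(classCard_fst_map_iff hX Φ w).mp h1, (orth_map_iff hΦ _ _).mp h2,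
      (orth_map_iff hΦ _ _).mp h3⟩, rfl⟩
  · rintro ⟨w, ⟨h1, h2, h3⟩, rfl⟩
    exact ⟨(classCard_fst_map_iff hX Φ w).mpr h1, (orth_map_iff hΦ _ _).mpr h2,
      (orth_map_iff hΦ _ _).mpr h3⟩

/-- Relabelling three classes of the first component by one permutation leaves too many common
orthogonal atoms for the images to have different first components, and such relabellings
generate all others. -/
theorem fst_map_twistSnd (hX : Nat.card X = 27) (hΦ : ∀ t, Φ tᶜ = (Φ t)ᶜ)
    (e : X ≃ Fin 9 × Fin 3) (g : Fin 9 → Equiv.Perm (Fin 3)) :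
    (Φ (ofEquiv (twistSnd e g))).fst = (Φ (ofEquiv e)).fst := by
  let H : Subgroup (Fin 9 → Equiv.Perm (Fin 3)) :=
    { carrier := {g | ∀ e : X ≃ Fin 9 × Fin 3,
        (Φ (ofEquiv (twistSnd e g))).fst = (Φ (ofEquiv e)).fst}
      mul_mem' := fun {g h} hg hh e => by rw [twistSnd_mul, hg, hh]
      one_mem' := fun e => rfl
      inv_mem' := fun {g} hg e => by
        rw [← hg (twistSnd e g⁻¹), ← twistSnd_mul, mul_inv_cancel]
        rfl }
  refine forall_pi_mem_of_triples H (fun g T hT π h1 h2 e => ?_) g e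
  by_contra hne
  have hlt := lt_ncard_common hX e (u := ofEquiv (twistSnd e g)) rfl hT fun x y hxy hj => by
    rw [ofEquiv_snd, twistSnd_apply, twistSnd_apply, hj]
    by_cases hx : (e x).1 ∈ T
    · rw [h1 _ hx, h1 _ (hxy.mp hx)]
    · rw [h2 _ hx, h2 _ (fun h => hx (hxy.mpr h))]
  have hle := ncard_common_le hX ((classCard_fst_map_iff hX Φ _).mpr (classCard_fst_ofEquiv e))
    ((classCard_fst_map_iff hX Φ _).mpr (classCard_fst_ofEquiv (twistSnd e g))) (Ne.symm hne)
  rw [ncard_common_map hX hΦ] at hle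
  omega

/-- The first component of the image of an atom depends only on the first component of the atom. -/
theorem fst_map_eq (hX : Nat.card X = 27) (hΦ : ∀ t, Φ tᶜ = (Φ t)ᶜ) {t u : FactorPair X}
    (ht : ClassCard t.fst 3) (h : t.fst = u.fst) : (Φ t).fst = (Φ u).fst := by
  obtain ⟨e, rfl⟩ := exists_eq_ofEquiv_of_classCard hX ht
  obtain ⟨e', rfl⟩ := exists_eq_ofEquiv_of_classCard hX (h ▸ ht)
  obtain ⟨g, hg⟩ := exists_eq_twistSnd h
  rw [hg, fst_map_twistSnd hX hΦ]

/-- A relation with classes of size nine is the product of any two relations below it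
with classes of size three that meet trivially. -/
theorem _root_.ClassCard.exists_rel_rel_of_le [Finite X] {c d r : Setoid X} (hc : ClassCard c 3)
    (hd : ClassCard d 3) (hr : ClassCard r 9) (hcd : ∀ x y, c x y → d x y → x = y) (hcr : c ≤ r)
    (hdr : d ≤ r) {x y : X} (hxy : r x y) : ∃ z, c x z ∧ d z y := by
  classical
  have := Fintype.ofFinite X
  have hcard : ((({z | c z x} : Finset X).biUnion fun z => ({w | d w z} : Finset X))).card = 9 := by
    have h3 : ∀ {s : Setoid X}, ClassCard s 3 → ∀ z, ({w | s w z} : Finset X).card = 3 := by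
      intro s hs z
      rw [← hs z, ← Set.ncard_coe_finset]
      simp
    rw [Finset.card_biUnion, Finset.sum_congr rfl fun z _ => h3 hd z, Finset.sum_const, h3 hc]
    · rfl
    · intro z hz z' hz' hne
      refine Finset.disjoint_left.mpr fun w hw hw' => hne ?_
      simp only [Finset.mem_coe, Finset.mem_filter, Finset.mem_univ, true_and] at hz hz' hw hw'
      exact hcd _ _ (c.trans hz (c.symm hz')) (d.trans (d.symm hw) hw')
  have hsub : (((({z | c z x} : Finset X).biUnion fun z => ({w | d w z} : Finset X)) :
      Finset X) : Set X) ⊆ {w | r w x} := by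
    intro w hw
    simp only [Finset.coe_biUnion, Set.mem_iUnion, Finset.mem_coe, Finset.mem_filter,
      Finset.mem_univ, true_and] at hw
    obtain ⟨z, hz, hw⟩ := hw
    exact r.trans (hdr hw) (hcr hz)
  have heq := Set.eq_of_subset_of_ncard_le hsub (by rw [hr, Set.ncard_coe_finset, hcard])
  have hy : y ∈ {w | r w x} := r.symm hxy
  rw [← heq] at hy
  simp only [Finset.coe_biUnion, Set.mem_iUnion, Finset.mem_coe, Finset.mem_filter,
    Finset.mem_univ, true_and] at hy
  obtain ⟨z, hz, hy⟩ := hy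
  exact ⟨z, c.symm hz, d.symm hy⟩

/-- If the relabelling stabilizes the square `s`, the two atoms share the two small relations below
their second component that `s` and `sᶜ` define. The images of these two relations generate
the second components of both images. -/
theorem snd_map_eq_of_stabilizer (hX : Nat.card X = 27) (hΦ : ∀ t, Φ tᶜ = (Φ t)ᶜ)
    (e : X ≃ Fin 9 × Fin 3) (g : Fin 3 → Equiv.Perm (Fin 9)) {s : FactorPair (Fin 9)}
    (hs : ClassCard s.fst 3) (hg : ∀ i, perm (g i) s = s) :
    (Φ (ofEquiv (twistFst e g))).snd = (Φ (ofEquiv e)).snd := by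
  have : Finite X := Nat.finite_of_card_ne_zero (by omega)
  have hs' : ClassCard sᶜ.fst 3 := s.classCard_snd (by simp) (by simp) hs
  -- The relabelling does not change the first components of the two atoms given by `s` and `sᶜ`.
  have hlink : ∀ s : FactorPair (Fin 9), (∀ i, perm (g i) s = s) →
      (link (twistFst e g) s).fst = (link e s).fst := by
    intro s hg
    ext x y
    rw [link_fst, link_fst, twistFst_apply, twistFst_apply]
    refine and_congr_right fun hj => ?_
    change (e x).2 = (e y).2 at hj
    simp only [hj]
    have h1 : (perm (g (e y).2) s).fst (g (e y).2 (e x).1) (g (e y).2 (e y).1) ↔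
        s.fst (e x).1 (e y).1 := by
      change s.fst ((g (e y).2).symm _) ((g (e y).2).symm _) ↔ _
      rw [Equiv.symm_apply_apply, Equiv.symm_apply_apply]
    rwa [hg] at h1
  have hg' : ∀ i, perm (g i) sᶜ = sᶜ := fun i => congrArg (fun t : FactorPair (Fin 9) => tᶜ) (hg i)
  have hsmall : ∀ (e : X ≃ Fin 9 × Fin 3) (s : FactorPair (Fin 9)), ClassCard s.fst 3 →
      ClassCard (link e s).fst 3 := fun e s hs => (classCard_link_iff e s 3).mpr hs
  have hlarge : ∀ e : X ≃ Fin 9 × Fin 3, ClassCard (Φ (ofEquiv e)).snd 9 := fun e =>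
    classCard_snd _ (by rw [hX]) (by omega)
      ((classCard_fst_map_iff hX Φ _).mpr (classCard_fst_ofEquiv e))
  have hle : ∀ (e : X ≃ Fin 9 × Fin 3) (s : FactorPair (Fin 9)),
      (Φ (link e s)).fst ≤ (Φ (ofEquiv e)).snd := fun e s =>
    ((orth_map_iff hΦ _ _).mpr (orth_link e s)).2.1
  have h1 := fst_map_eq hX hΦ (hsmall (twistFst e g) s hs) (hlink s hg)
  have h2 := fst_map_eq hX hΦ (hsmall (twistFst e g) sᶜ hs') (hlink sᶜ hg')
  refine ((hlarge e).eq_of_le (hlarge _) fun {x y} hxy => ?_).symm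
  have horth := (orth_map_iff hΦ _ _).mpr (orth_link_compl e s)
  obtain ⟨z, hz₁, hz₂⟩ := ((classCard_fst_map_iff hX Φ _).mpr (hsmall e s hs)).exists_rel_rel_of_le
    ((classCard_fst_map_iff hX Φ _).mpr (hsmall e sᶜ hs')) (hlarge e)
    (fun x y hc hd => (Φ (link e s)).eq_of_rel hc (horth.2.1 hd)) (hle e s) (hle e sᶜ) hxy
  rw [← h1] at hz₁
  rw [← h2] at hz₂
  exact Setoid.trans' _ (hle (twistFst e g) s hz₁) (hle (twistFst e g) sᶜ hz₂)

/-- The second component of the image of an atom depends only on the second component of the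
atom. -/
theorem snd_map_eq (hX : Nat.card X = 27) (hΦ : ∀ t, Φ tᶜ = (Φ t)ᶜ) {t u : FactorPair X}
    (ht : ClassCard t.fst 3) (h : t.snd = u.snd) : (Φ t).snd = (Φ u).snd := by
  have : Finite X := Nat.finite_of_card_ne_zero (by omega)
  have hu : ClassCard u.fst 3 := u.classCard_fst (n := 9) (by rw [hX]) (by omega)
    (h ▸ t.classCard_snd (by rw [hX]) (by omega) ht)
  obtain ⟨e, rfl⟩ := exists_eq_ofEquiv_of_classCard hX ht
  obtain ⟨e', rfl⟩ := exists_eq_ofEquiv_of_classCard hX hu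
  obtain ⟨g, hg⟩ := exists_eq_twistFst h
  rw [hg]
  let H : Subgroup (Fin 3 → Equiv.Perm (Fin 9)) :=
    { carrier := {g | ∀ e : X ≃ Fin 9 × Fin 3,
        (Φ (ofEquiv (twistFst e g))).snd = (Φ (ofEquiv e)).snd}
      mul_mem' := fun {g h} hg hh e => by rw [twistFst_mul, hg, hh]
      one_mem' := fun e => rfl
      inv_mem' := fun {g} hg e => by
        rw [← hg (twistFst e g⁻¹), ← twistFst_mul, mul_inv_cancel]
        rfl }
  refine (forall_pi_mem_of_stabilizer H (fun i π s hs hπ e => ?_) g e).symm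
  refine snd_map_eq_of_stabilizer hX hΦ e _ hs fun k => ?_
  rw [Pi.mulSingle_apply]
  split_ifs
  · exact hπ
  · exact perm_one s

/-- Containment between a small and a large relation in terms of orthogonality of atoms. -/
theorem exists_orth_of_le (hX : Nat.card X = 27) {a r : Setoid X} (ha : ClassCard a 3)
    (hr : ClassCard r 9) (h : a ≤ r) : ∃ t u : FactorPair X, ClassCard t.fst 3 ∧
      ClassCard u.fst 3 ∧ Orth t u ∧ t.fst = a ∧ u.snd = r := by
  have : Finite X := Nat.finite_of_card_ne_zero (by omega)
  obtain ⟨e, he⟩ := ha.exists_equiv 9 (by norm_num) (by omega)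
  have hea : (ofEquiv e).fst = a := Setoid.ext fun x y => (he x y).symm
  let q : Setoid (Fin 9) := Setoid.comap (fun p => e.symm (p, 0)) r
  have hq : ∀ x y, q (e x).1 (e y).1 ↔ r x y := by
    have key : ∀ x, r x (e.symm ((e x).1, 0)) := fun x => h ((he _ _).mpr (by simp))
    intro x y
    exact ⟨fun h' => r.trans (key x) (r.trans h' (r.symm (key y))),
      fun h' => r.trans (r.symm (key x)) (r.trans h' (key y))⟩
  have hq3 : ClassCard q 3 := by
    intro p
    have h9 := hr (e.symm (p, 0))
    have : {z | r z (e.symm (p, 0))} = e.symm '' ({p' | q p' p} ×ˢ (Set.univ : Set (Fin 3))) := by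
      ext z
      rw [Equiv.image_symm_eq_preimage, Set.mem_preimage, Set.mem_prod]
      have := hq z (e.symm (p, 0))
      rw [Equiv.apply_symm_apply] at this
      exact this.symm.trans ⟨fun h => ⟨h, trivial⟩, fun h => h.1⟩
    rw [this, Set.ncard_image_of_injective _ e.symm.injective, Set.ncard_prod, Set.ncard_univ,
      Nat.card_fin] at h9
    omega
  obtain ⟨f, hf⟩ := hq3.exists_equiv 3 (by norm_num) (by simp)
  have hs : ClassCard (ofEquiv (f.trans (Equiv.prodComm _ _))).fst 3 := classCard_fst_ofEquiv _
  refine ⟨ofEquiv e, link e (ofEquiv (f.trans (Equiv.prodComm _ _))), classCard_fst_ofEquiv e,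
    (classCard_link_iff e _ 3).mpr hs, orth_link e _, hea, ?_⟩
  ext x y
  rw [link_snd, ← hq, hf]
  rfl

end FactorPair

/-! ### Small relations and the large relations above them -/

/-- The equivalence relations all of whose classes have three elements. -/
abbrev SmallRel (X : Type*) : Type _ := {r : Setoid X // ClassCard r 3}

/-- The equivalence relations all of whose classes have nine elements. -/
abbrev LargeRel (X : Type*) : Type _ := {r : Setoid X // ClassCard r 9}

section

variable {X : Type*}

/-- The large relations that contain `a` and identify `x` and `y`. -/
def merging (a : SmallRel X) (x y : X) : Set (LargeRel X) :=
  {A | a.1 ≤ A.1 ∧ A.1 x y}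

/-- The large relations that contain both `a` and `b`. -/
def above (a b : SmallRel X) : Set (LargeRel X) :=
  {A | a.1 ≤ A.1 ∧ b.1 ≤ A.1}

/-- `x, y` and `u, v` represent the same unordered pair of classes of `a`. -/
def SamePair (a : SmallRel X) (x y u v : X) : Prop :=
  (a.1 x u ∧ a.1 y v) ∨ (a.1 x v ∧ a.1 y u)

theorem above_comm (a b : SmallRel X) : above a b = above b a :=
  Set.ext fun _ => and_comm

theorem SamePair.merging_eq {a : SmallRel X} {x y u v : X} (h : SamePair a x y u v) :
    merging a x y = merging a u v := by
  ext A
  refine and_congr_right fun hA => ?_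
  rcases h with ⟨h1, h2⟩ | ⟨h1, h2⟩
  · exact ⟨fun h => A.1.trans (A.1.symm (hA h1)) (A.1.trans h (hA h2)),
      fun h => A.1.trans (hA h1) (A.1.trans h (A.1.symm (hA h2)))⟩
  · exact ⟨fun h => A.1.trans (A.1.symm (hA h2)) (A.1.trans (A.1.symm h) (hA h1)),
      fun h => A.1.trans (hA h1) (A.1.trans (A.1.symm h) (A.1.symm (hA h2)))⟩

/-- A labelling of the classes of `a` by `Fin 9`; partitions of the labels into triples are large
relations above `a`. -/
theorem SmallRel.exists_label (hX : Nat.card X = 27) (a : SmallRel X) :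
    ∃ p : X → Fin 9, Function.Surjective p ∧ (∀ x y, a.1 x y ↔ p x = p y) ∧
      ∀ r : Setoid (Fin 9), ClassCard r 3 → ∃ A : LargeRel X, ∀ x y, A.1 x y ↔ r (p x) (p y) := by
  have : Finite X := Nat.finite_of_card_ne_zero (by omega)
  obtain ⟨e, he⟩ := a.2.exists_equiv 9 (by norm_num) (by omega)
  refine ⟨fun x => (e x).1, fun i => ⟨e.symm (i, 0), by simp⟩, he, fun r hr => ?_⟩
  refine ⟨⟨Setoid.comap (fun x => (e x).1) r, fun x => ?_⟩, fun x y => Iff.rfl⟩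
  have h : {z | Setoid.comap (fun x => (e x).1) r z x} =
      e.symm '' ({q | r q (e x).1} ×ˢ (Set.univ : Set (Fin 3))) := by
    ext z
    rw [Equiv.image_symm_eq_preimage, Set.mem_preimage, Set.mem_prod]
    exact ⟨fun h => ⟨h, trivial⟩, fun h => h.1⟩
  rw [h, Set.ncard_image_of_injective _ e.symm.injective, Set.ncard_prod, hr, Set.ncard_univ,
    Nat.card_fin]

/-- A large relation above `a` with two prescribed classes, each a union of three classes of
`a`. -/
theorem SmallRel.exists_label_of_disjoint (hX : Nat.card X = 27) (a : SmallRel X) :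
    ∃ p : X → Fin 9, Function.Surjective p ∧ (∀ x y, a.1 x y ↔ p x = p y) ∧
      ∀ D E : Finset (Fin 9), D.card = 3 → E.card = 3 → Disjoint D E →
        ∃ A : LargeRel X, a.1 ≤ A.1 ∧
          ∀ x y, A.1 x y ↔ ((p x ∈ D ↔ p y ∈ D) ∧ (p x ∈ E ↔ p y ∈ E)) := by
  obtain ⟨p, hp, ha, hr⟩ := a.exists_label hX
  refine ⟨p, hp, ha, fun D E hD hE hDE => ?_⟩
  obtain ⟨r, hr3, hr'⟩ := exists_classCard_of_disjoint (Q := Fin 9) (by simp)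
    (D := (D : Set (Fin 9))) (E := (E : Set (Fin 9))) (by simpa using hD) (by simpa using hE)
    (by simpa using hDE)
  obtain ⟨A, hA⟩ := hr r hr3
  refine ⟨A, fun {x y} hxy => ?_, fun x y => ?_⟩
  · rw [hA, (ha x y).mp hxy]
  · rw [hA, hr']
    simp

theorem exists_notMem_of_card_le {S : Finset (Fin 9)} (h : S.card ≤ 8) : ∃ w, w ∉ S := by
  by_contra! hc
  rw [Finset.eq_univ_of_forall hc] at h
  simp at h

theorem exists_not_rel_of_card_le (hX : Nat.card X = 27) (a : SmallRel X) {S : Finset X}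
    (h : S.card ≤ 8) : ∃ s, ∀ x ∈ S, ¬ a.1 x s := by
  classical
  obtain ⟨p, hp, ha, -⟩ := a.exists_label hX
  obtain ⟨w, hw⟩ := exists_notMem_of_card_le (S := S.image p) (Finset.card_image_le.trans h)
  obtain ⟨s, rfl⟩ := hp w
  exact ⟨s, fun x hx hxs => hw (Finset.mem_image.mpr ⟨x, hx, (ha x s).mp hxs⟩)⟩

theorem exists_disjoint_of_card {D : Finset (Fin 9)} (hD : D.card = 3) :
    ∃ E : Finset (Fin 9), E.card = 3 ∧ Disjoint D E := by
  obtain ⟨E, hE, hE3⟩ := Finset.exists_subset_card_eq (s := Dᶜ) (n := 3)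
    (by rw [Finset.card_compl, hD, Fintype.card_fin]; norm_num)
  exact ⟨E, hE3, Finset.disjoint_right.mpr fun i hi => Finset.mem_compl.mp (hE hi)⟩

/-- Distinct pairs of classes of `a` are told apart by the large relations above `a`. -/
theorem samePair_of_merging_subset (hX : Nat.card X = 27) {a : SmallRel X} {x y u v : X}
    (hxy : ¬ a.1 x y) (huv : ¬ a.1 u v) (h : merging a x y ⊆ merging a u v) :
    SamePair a x y u v := by
  obtain ⟨p, hp, ha, hA⟩ := a.exists_label_of_disjoint hX
  have key : ∀ T V, T ≠ V → V ≠ p x → V ≠ p y → ∃ D : Finset (Fin 9), D.card = 3 ∧ p x ∈ D ∧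
      p y ∈ D ∧ T ∈ D ∧ V ∉ D := by
    intro T V hTV hVx hVy
    rw [ha] at hxy
    by_cases hT : T = p x ∨ T = p y
    · obtain ⟨w, hw⟩ := exists_notMem_of_card_le (S := {p x, p y, V})
        (Finset.card_le_three.trans (by norm_num))
      simp only [Finset.mem_insert, Finset.mem_singleton, not_or] at hw
      refine ⟨{p x, p y, w}, Finset.card_eq_three.mpr ⟨_, _, _, hxy, Ne.symm hw.1, Ne.symm hw.2.1,
        rfl⟩, by simp, by simp, by simp; tauto, by simp; tauto⟩
    · rw [not_or] at hT
      exact ⟨{p x, p y, T}, Finset.card_eq_three.mpr ⟨_, _, _, hxy, Ne.symm hT.1, Ne.symm hT.2,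
        rfl⟩, by simp, by simp, by simp, by simp [hVx, hVy, Ne.symm hTV]⟩
  have sep : ∀ D : Finset (Fin 9), D.card = 3 → p x ∈ D → p y ∈ D → (p u ∈ D ↔ p v ∈ D) := by
    intro D hD hx hy
    obtain ⟨E, hE, hDE⟩ := exists_disjoint_of_card hD
    obtain ⟨A, haA, hA⟩ := hA D E hD hE hDE
    have hxE := Finset.disjoint_left.mp hDE hx
    have hyE := Finset.disjoint_left.mp hDE hy
    have : A ∈ merging a x y := ⟨haA, (hA x y).mpr (by simp [hx, hy, hxE, hyE])⟩
    exact ((hA u v).mp (h this).2).1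
  rw [ha] at huv
  unfold SamePair
  simp only [ha]
  by_contra hc
  by_cases hv : p v = p x ∨ p v = p y
  · obtain ⟨D, hD, h1, h2, h3, h4⟩ := key (p v) (p u) (Ne.symm huv) (by grind) (by grind)
    exact h4 ((sep D hD h1 h2).mpr h3)
  · rw [not_or] at hv
    obtain ⟨D, hD, h1, h2, h3, h4⟩ := key (p u) (p v) huv hv.1 hv.2
    exact h4 ((sep D hD h1 h2).mp h3)

/-- Merging two disjoint pairs of classes forces no third pair to be merged. -/
theorem samePair_of_merging_inter_subset (hX : Nat.card X = 27) {a : SmallRel X}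
    {x y z w s t : X} (hxy : ¬ a.1 x y) (hzw : ¬ a.1 z w) (hxz : ¬ a.1 x z) (hxw : ¬ a.1 x w)
    (hyz : ¬ a.1 y z) (hyw : ¬ a.1 y w) (hst : ¬ a.1 s t)
    (h : merging a x y ∩ merging a z w ⊆ merging a s t) :
    SamePair a x y s t ∨ SamePair a z w s t := by
  obtain ⟨p, hp, ha, hA⟩ := a.exists_label_of_disjoint hX
  have key : ∀ P Q R S T V : Fin 9, P ≠ Q → R ≠ S → P ≠ R → P ≠ S → Q ≠ R → Q ≠ S → T ≠ V →
      V ≠ P → V ≠ Q → T ≠ R → T ≠ S → ∃ D E : Finset (Fin 9), D.card = 3 ∧ E.card = 3 ∧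
      Disjoint D E ∧ P ∈ D ∧ Q ∈ D ∧ R ∈ E ∧ S ∈ E ∧ T ∈ D ∧ V ∉ D := by
    intro P Q R S T V hPQ hRS hPR hPS hQR hQS hTV hVP hVQ hTR hTS
    have hw : ∃ w, w ≠ P ∧ w ≠ Q ∧ w ≠ R ∧ w ≠ S ∧ w ≠ V ∧ T ∈ ({P, Q, w} : Finset (Fin 9)) := by
      by_cases hT : T = P ∨ T = Q
      · obtain ⟨w, hw⟩ := exists_notMem_of_card_le (S := {P, Q, R, S, V})
          (Finset.card_le_five.trans (by norm_num))
        simp only [Finset.mem_insert, Finset.mem_singleton, not_or] at hw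
        exact ⟨w, hw.1, hw.2.1, hw.2.2.1, hw.2.2.2.1, hw.2.2.2.2, by simp; tauto⟩
      · rw [not_or] at hT
        exact ⟨T, hT.1, hT.2, hTR, hTS, hTV, by simp⟩
    obtain ⟨w, hwP, hwQ, hwR, hwS, hwV, hTw⟩ := hw
    obtain ⟨w', hw'⟩ := exists_notMem_of_card_le (S := {P, Q, R, S, w})
      (Finset.card_le_five.trans (by norm_num))
    simp only [Finset.mem_insert, Finset.mem_singleton, not_or] at hw'
    obtain ⟨h1, h2, h3, h4, h5⟩ := hw'
    refine ⟨{P, Q, w}, {R, S, w'}, Finset.card_eq_three.mpr ⟨_, _, _, hPQ, hwP.symm, hwQ.symm,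
      rfl⟩, Finset.card_eq_three.mpr ⟨_, _, _, hRS, Ne.symm h3, Ne.symm h4, rfl⟩, ?_, by simp,
      by simp, by simp, by simp, hTw, by simp [hVP, hVQ, hwV.symm]⟩
    rw [Finset.disjoint_left]
    intro i hi hi'
    simp only [Finset.mem_insert, Finset.mem_singleton] at hi hi'
    grind
  have sep : ∀ D E : Finset (Fin 9), D.card = 3 → E.card = 3 → Disjoint D E →
      (p x ∈ D ↔ p y ∈ D) → (p x ∈ E ↔ p y ∈ E) → (p z ∈ D ↔ p w ∈ D) → (p z ∈ E ↔ p w ∈ E) →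
      (p s ∈ D ↔ p t ∈ D) := by
    intro D E hD hE hDE h1 h2 h3 h4
    obtain ⟨A, haA, hA⟩ := hA D E hD hE hDE
    exact ((hA s t).mp (h ⟨⟨haA, (hA x y).mpr ⟨h1, h2⟩⟩, ⟨haA, (hA z w).mpr ⟨h3, h4⟩⟩⟩).2).1
  have sep1 : ∀ D E : Finset (Fin 9), D.card = 3 → E.card = 3 → Disjoint D E → p x ∈ D →
      p y ∈ D → p z ∈ E → p w ∈ E → (p s ∈ D ↔ p t ∈ D) := by
    intro D E hD hE hDE h1 h2 h3 h4
    have hd : ∀ i ∈ D, i ∉ E := fun i hi => Finset.disjoint_left.mp hDE hi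
    exact sep D E hD hE hDE (by grind) (by grind) (by grind) (by grind)
  have sep2 : ∀ D E : Finset (Fin 9), D.card = 3 → E.card = 3 → Disjoint D E → p z ∈ D →
      p w ∈ D → p x ∈ E → p y ∈ E → (p s ∈ D ↔ p t ∈ D) := by
    intro D E hD hE hDE h1 h2 h3 h4
    have hd : ∀ i ∈ D, i ∉ E := fun i hi => Finset.disjoint_left.mp hDE hi
    exact sep D E hD hE hDE (by grind) (by grind) (by grind) (by grind)
  rw [ha] at hxy hzw hxz hxw hyz hyw hst
  unfold SamePair
  simp only [ha]
  by_contra hc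
  have k1 : p t ≠ p x → p t ≠ p y → p s ≠ p z → p s ≠ p w → False := fun h1 h2 h3 h4 => by
    obtain ⟨D, E, hD, hE, hDE, m1, m2, m3, m4, m5, m6⟩ :=
      key _ _ _ _ _ _ hxy hzw hxz hxw hyz hyw hst h1 h2 h3 h4
    exact m6 ((sep1 D E hD hE hDE m1 m2 m3 m4).mp m5)
  have k2 : p s ≠ p x → p s ≠ p y → p t ≠ p z → p t ≠ p w → False := fun h1 h2 h3 h4 => by
    obtain ⟨D, E, hD, hE, hDE, m1, m2, m3, m4, m5, m6⟩ :=
      key _ _ _ _ _ _ hxy hzw hxz hxw hyz hyw (Ne.symm hst) h1 h2 h3 h4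
    exact m6 ((sep1 D E hD hE hDE m1 m2 m3 m4).mpr m5)
  have k3 : p t ≠ p z → p t ≠ p w → p s ≠ p x → p s ≠ p y → False := fun h1 h2 h3 h4 => by
    obtain ⟨D, E, hD, hE, hDE, m1, m2, m3, m4, m5, m6⟩ :=
      key _ _ _ _ _ _ hzw hxy (Ne.symm hxz) (Ne.symm hyz) (Ne.symm hxw) (Ne.symm hyw) hst
        h1 h2 h3 h4
    exact m6 ((sep2 D E hD hE hDE m1 m2 m3 m4).mp m5)
  have k4 : p s ≠ p z → p s ≠ p w → p t ≠ p x → p t ≠ p y → False := fun h1 h2 h3 h4 => by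
    obtain ⟨D, E, hD, hE, hDE, m1, m2, m3, m4, m5, m6⟩ :=
      key _ _ _ _ _ _ hzw hxy (Ne.symm hxz) (Ne.symm hyz) (Ne.symm hxw) (Ne.symm hyw)
        (Ne.symm hst) h1 h2 h3 h4
    exact m6 ((sep2 D E hD hE hDE m1 m2 m3 m4).mpr m5)
  grind

/-- Merging two pairs of classes that share a class forces only the third pair to be merged. -/
theorem samePair_of_merging_inter_subset_of_shared (hX : Nat.card X = 27) {a : SmallRel X}
    {x y z s t : X} (hxy : ¬ a.1 x y) (hxz : ¬ a.1 x z) (hyz : ¬ a.1 y z) (hst : ¬ a.1 s t)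
    (h : merging a x y ∩ merging a x z ⊆ merging a s t) :
    SamePair a x y s t ∨ SamePair a x z s t ∨ SamePair a y z s t := by
  obtain ⟨p, hp, ha, hA⟩ := a.exists_label_of_disjoint hX
  rw [ha] at hxy hxz hyz hst
  have hD : ({p x, p y, p z} : Finset (Fin 9)).card = 3 :=
    Finset.card_eq_three.mpr ⟨_, _, _, hxy, hxz, hyz, rfl⟩
  have sep : ∀ E : Finset (Fin 9), E.card = 3 → Disjoint {p x, p y, p z} E →
      (p s ∈ ({p x, p y, p z} : Finset (Fin 9)) ↔ p t ∈ ({p x, p y, p z} : Finset (Fin 9))) ∧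
      (p s ∈ E ↔ p t ∈ E) := by
    intro E hE hDE
    obtain ⟨A, haA, hA⟩ := hA _ E hD hE hDE
    have h1 := Finset.disjoint_left.mp hDE (show p x ∈ _ by simp)
    have h2 := Finset.disjoint_left.mp hDE (show p y ∈ _ by simp)
    have h3 := Finset.disjoint_left.mp hDE (show p z ∈ _ by simp)
    exact (hA s t).mp (h ⟨⟨haA, (hA x y).mpr (by simp [h1, h2])⟩,
      ⟨haA, (hA x z).mpr (by simp [h1, h3])⟩⟩).2
  unfold SamePair
  simp only [ha]
  obtain ⟨E₀, hE₀, hDE₀⟩ := exists_disjoint_of_card hD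
  have h1 := (sep E₀ hE₀ hDE₀).1
  by_cases hs : p s ∈ ({p x, p y, p z} : Finset (Fin 9))
  · have ht := h1.mp hs
    simp only [Finset.mem_insert, Finset.mem_singleton] at hs ht
    grind
  · exfalso
    have ht := fun h => hs (h1.mpr h)
    obtain ⟨E, hE, hEs⟩ : ∃ E : Finset (Fin 9), E ⊆ ({p x, p y, p z, p t} : Finset (Fin 9))ᶜ ∧
        p s ∈ E ∧ E.card = 3 := by
      have hs' : p s ∈ ({p x, p y, p z, p t} : Finset (Fin 9))ᶜ := by
        simp only [Finset.mem_insert, Finset.mem_singleton, Finset.mem_compl] at hs ⊢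
        grind
      obtain ⟨E, h1, h2, h3⟩ := Finset.exists_subsuperset_card_eq
        (Finset.singleton_subset_iff.mpr hs') (n := 3) (by simp) (by
          rw [Finset.card_compl, Fintype.card_fin]
          have : ({p x, p y, p z, p t} : Finset (Fin 9)).card ≤ 4 := Finset.card_le_four
          omega)
      exact ⟨E, h2, Finset.singleton_subset_iff.mp h1, h3⟩
    have hdisj : Disjoint {p x, p y, p z} E := by
      rw [Finset.disjoint_left]
      intro i hi hiE
      have := hE hiE
      simp only [Finset.mem_insert, Finset.mem_singleton, Finset.mem_compl] at hi this
      grind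
    have h2 := (sep E hEs.2 hdisj).2.mp hEs.1
    have := hE h2
    simp at this

end

/-! ### Incidence automorphisms and classes of small relations -/

/-- A pair of permutations, of the small and of the large relations, that preserves containment of
small relations in large ones. -/
structure IncidenceAut (X : Type*) where
  small : Equiv.Perm (SmallRel X)
  large : Equiv.Perm (LargeRel X)
  le_iff : ∀ a A, (small a).1 ≤ (large A).1 ↔ a.1 ≤ A.1

/-- The image of a small relation under a permutation of the points. -/
def SmallRel.perm {X : Type*} (σ : Equiv.Perm X) (a : SmallRel X) : SmallRel X :=
  ⟨permEquiv σ a.1, a.2.permEquiv σ⟩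

theorem SmallRel.perm_mul {X : Type*} (σ τ : Equiv.Perm X) (a : SmallRel X) :
    a.perm (σ * τ) = (a.perm τ).perm σ := rfl

theorem SmallRel.perm_swap_apply {X : Type*} [DecidableEq X] (a : SmallRel X) (u v x y : X) :
    (a.perm (Equiv.swap u v)).1 x y ↔ a.1 (Equiv.swap u v x) (Equiv.swap u v y) := Iff.rfl

theorem SmallRel.perm_swap_perm_swap {X : Type*} [DecidableEq X] (a : SmallRel X) (u v : X) :
    (a.perm (Equiv.swap u v)).perm (Equiv.swap u v) = a := by
  rw [← SmallRel.perm_mul, Equiv.swap_mul_self]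
  rfl

theorem SmallRel.eq_of_le {X : Type*} [Finite X] {a b : SmallRel X} (h : a.1 ≤ b.1) : a = b :=
  Subtype.ext (a.2.eq_of_le b.2 h)

theorem SmallRel.perm_swap_of_rel {X : Type*} [Finite X] [DecidableEq X] {a : SmallRel X} {u v : X}
    (h : a.1 u v) : a.perm (Equiv.swap u v) = a := by
  refine (SmallRel.eq_of_le fun {x y} hxy => ?_).symm
  rw [SmallRel.perm_swap_apply]
  have key : ∀ x, a.1 x (Equiv.swap u v x) := by
    intro x
    by_cases hu : x = u
    · rw [hu, Equiv.swap_apply_left]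
      exact h
    · by_cases hv : x = v
      · rw [hv, Equiv.swap_apply_right]
        exact a.1.symm h
      · rw [Equiv.swap_apply_of_ne_of_ne hu hv]
  exact a.1.trans (a.1.symm (key x)) (a.1.trans hxy (key y))

section

variable {X : Type*}

theorem ne_of_not_rel {r : Setoid X} {x y : X} (h : ¬ r x y) : x ≠ y := by
  rintro rfl
  exact h (r.refl x)

/-- Exchanging two points of different classes yields a small relation `b ≠ a` for which the large
relations above `a` and `b` are those above `a` that merge the two classes. -/
theorem above_perm_swap (hX : Nat.card X = 27) [DecidableEq X] {a : SmallRel X} {x y : X}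
    (h : ¬ a.1 x y) : above a (a.perm (Equiv.swap x y)) = merging a x y := by
  have : Finite X := Nat.finite_of_card_ne_zero (by omega)
  ext A
  constructor
  · rintro ⟨h1, h2⟩
    refine ⟨h1, ?_⟩
    obtain ⟨z, hz, hzx⟩ := a.2.exists_ne_rel (by norm_num) x
    have hzy : z ≠ y := by
      rintro rfl
      exact h (a.1.symm hzx)
    have : (a.perm (Equiv.swap x y)).1 z y := by
      rw [SmallRel.perm_swap_apply, Equiv.swap_apply_right, Equiv.swap_apply_of_ne_of_ne hz hzy]
      exact hzx
    exact A.1.trans (A.1.symm (h1 hzx)) (h2 this)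
  · rintro ⟨h1, h2⟩
    refine ⟨h1, fun {u v} huv => ?_⟩
    have key : ∀ u, A.1 u (Equiv.swap x y u) := by
      intro u
      by_cases hu : u = x
      · rw [hu, Equiv.swap_apply_left]
        exact h2
      · by_cases hv : u = y
        · rw [hv, Equiv.swap_apply_right]
          exact A.1.symm h2
        · rw [Equiv.swap_apply_of_ne_of_ne hu hv]
    exact A.1.trans (key u) (A.1.trans (h1 huv) (A.1.symm (key v)))

theorem perm_swap_ne (hX : Nat.card X = 27) [DecidableEq X] {a : SmallRel X} {x y : X}
    (h : ¬ a.1 x y) : a.perm (Equiv.swap x y) ≠ a := by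
  have : Finite X := Nat.finite_of_card_ne_zero (by omega)
  intro he
  obtain ⟨z, hz, hzx⟩ := a.2.exists_ne_rel (by norm_num) x
  have hzy : z ≠ y := by
    rintro rfl
    exact h (a.1.symm hzx)
  have : (a.perm (Equiv.swap x y)).1 z y := by
    rw [SmallRel.perm_swap_apply, Equiv.swap_apply_right, Equiv.swap_apply_of_ne_of_ne hz hzy]
    exact hzx
  rw [he] at this
  exact h (a.1.trans (a.1.symm hzx) this)

theorem exists_above_subset_merging [Finite X] {a b : SmallRel X} (h : a ≠ b) :
    ∃ x y, ¬ a.1 x y ∧ b.1 x y ∧ above a b ⊆ merging a x y := by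
  obtain ⟨x, y, hxy, hxy'⟩ := b.2.exists_not_rel a.2 (fun h' => h (Subtype.ext h'.symm))
  exact ⟨x, y, hxy', hxy, fun A hA => ⟨hA.1, hA.2 hxy⟩⟩

namespace IncidenceAut

/-- The inverse incidence automorphism. -/
def symm (φ : IncidenceAut X) : IncidenceAut X where
  small := φ.small.symm
  large := φ.large.symm
  le_iff a A := by rw [← φ.le_iff, Equiv.apply_symm_apply, Equiv.apply_symm_apply]

theorem image_above (φ : IncidenceAut X) (a b : SmallRel X) :
    φ.large '' above a b = above (φ.small a) (φ.small b) := by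
  ext A
  obtain ⟨A, rfl⟩ := φ.large.surjective A
  rw [φ.large.injective.mem_set_image]
  exact and_congr (φ.le_iff a A).symm (φ.le_iff b A).symm

/-- The sets `merging a x y` are the maximal sets of the form `above a b` with `b ≠ a`,
so they are preserved. -/
theorem exists_image_merging (hX : Nat.card X = 27) (φ : IncidenceAut X) {a : SmallRel X} {x y : X}
    (h : ¬ a.1 x y) : ∃ u v, ¬ (φ.small a).1 u v ∧
      φ.large '' merging a x y = merging (φ.small a) u v := by
  classical
  have : Finite X := Nat.finite_of_card_ne_zero (by omega)
  obtain ⟨u, v, huv, -, hsub⟩ := exists_above_subset_merging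
    (fun h' : φ.small a = φ.small (a.perm (Equiv.swap x y)) =>
      perm_swap_ne hX h (φ.small.injective h').symm)
  refine ⟨u, v, huv, ?_⟩
  rw [← image_above, above_perm_swap hX h] at hsub
  refine hsub.antisymm ?_
  obtain ⟨b, hb⟩ := φ.small.surjective ((φ.small a).perm (Equiv.swap u v))
  have hab : a ≠ b := by
    rintro rfl
    exact perm_swap_ne hX huv hb.symm
  obtain ⟨s, t, hst, -, hsub'⟩ := exists_above_subset_merging hab
  have him : merging (φ.small a) u v = φ.large '' above a b := by
    rw [image_above, hb, above_perm_swap hX huv]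
  rw [him] at hsub ⊢
  have h1 : merging a x y ⊆ merging a s t :=
    ((Set.image_subset_image_iff φ.large.injective).mp hsub).trans hsub'
  rw [(samePair_of_merging_subset hX h hst h1).merging_eq]
  exact Set.image_mono hsub'

/-- Three classes of `a` correspond to three classes of the image, through the three pairs that they
form. -/
theorem exists_image_triangle (hX : Nat.card X = 27) (φ : IncidenceAut X) {a : SmallRel X}
    {p q r : X} (hpq : ¬ a.1 p q) (hpr : ¬ a.1 p r) (hqr : ¬ a.1 q r) :
    ∃ x y z, ¬ (φ.small a).1 x y ∧ ¬ (φ.small a).1 x z ∧ ¬ (φ.small a).1 y z ∧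
      φ.large '' merging a p q = merging (φ.small a) x y ∧
      φ.large '' merging a p r = merging (φ.small a) x z ∧
      φ.large '' merging a q r = merging (φ.small a) y z := by
  obtain ⟨x, y, hxy, e1⟩ := φ.exists_image_merging hX hpq
  obtain ⟨z, w, hzw, e2⟩ := φ.exists_image_merging hX hpr
  obtain ⟨s, t, hst, e3⟩ := φ.exists_image_merging hX hqr
  have hsame : ∀ {p q r s : X}, ¬ a.1 p q → ¬ a.1 r s → ∀ {x y z w : X},
      φ.large '' merging a p q = merging (φ.small a) x y →
      φ.large '' merging a r s = merging (φ.small a) z w →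
      SamePair (φ.small a) x y z w → SamePair a p q r s := by
    intro p q r s hpq hrs x y z w h1 h2 h3
    refine samePair_of_merging_subset hX hpq hrs ?_
    rw [← Set.image_subset_image_iff φ.large.injective, h1, h2, h3.merging_eq]
  have hsub : merging (φ.small a) x y ∩ merging (φ.small a) z w ⊆ merging (φ.small a) s t := by
    rw [← e1, ← e2, ← e3, ← Set.image_inter φ.large.injective]
    refine Set.image_mono fun A hA => ⟨hA.1.1, A.1.trans (A.1.symm hA.1.2) hA.2.2⟩
  have n1 : ¬ SamePair (φ.small a) x y z w := fun h => by
    rcases hsame hpq hpr e1 e2 h with h | h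
    · exact hqr h.2
    · exact hpr h.1
  have n2 : ¬ SamePair (φ.small a) x y s t := fun h => by
    rcases hsame hpq hqr e1 e3 h with h | h
    · exact hpq h.1
    · exact hpr h.1
  have n3 : ¬ SamePair (φ.small a) z w s t := fun h => by
    rcases hsame hpr hqr e2 e3 h with h | h
    · exact hpq h.1
    · exact hpr h.1
  -- Once the first two image pairs are written with a common class, the third is forced.
  have done : ∀ x y z w, merging (φ.small a) x y ∩ merging (φ.small a) z w ⊆
      merging (φ.small a) s t → ¬ SamePair (φ.small a) x y z w → ¬ SamePair (φ.small a) x y s t →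
      ¬ SamePair (φ.small a) z w s t → ¬ (φ.small a).1 x y → ¬ (φ.small a).1 z w →
      φ.large '' merging a p q = merging (φ.small a) x y →
      φ.large '' merging a p r = merging (φ.small a) z w → (φ.small a).1 x z →
      ∃ x y z, ¬ (φ.small a).1 x y ∧ ¬ (φ.small a).1 x z ∧ ¬ (φ.small a).1 y z ∧
        φ.large '' merging a p q = merging (φ.small a) x y ∧
        φ.large '' merging a p r = merging (φ.small a) x z ∧
        φ.large '' merging a q r = merging (φ.small a) y z := by
    intro x y z w hsub n1 n2 n3 hxy hzw e1 e2 hxz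
    have hzx : SamePair (φ.small a) z w x w := Or.inl ⟨(φ.small a).1.symm hxz, Setoid.refl' _ w⟩
    rw [hzx.merging_eq] at hsub e2
    have hxw : ¬ (φ.small a).1 x w := fun h => hzw ((φ.small a).1.trans
      ((φ.small a).1.symm hxz) h)
    have hyw : ¬ (φ.small a).1 y w := fun h => n1 (Or.inl ⟨hxz, h⟩)
    refine ⟨x, y, w, hxy, hxw, hyw, e1, e2, ?_⟩
    rcases samePair_of_merging_inter_subset_of_shared hX hxy hxw hyw hst hsub with h | h | h
    · exact absurd h n2
    · refine absurd ?_ n3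
      rcases h with h | h
      · exact Or.inl ⟨(φ.small a).1.trans ((φ.small a).1.symm hxz) h.1, h.2⟩
      · exact Or.inr ⟨(φ.small a).1.trans ((φ.small a).1.symm hxz) h.1, h.2⟩
    · rw [e3, h.merging_eq]
  have flip : ∀ x y, merging (φ.small a) x y = merging (φ.small a) y x := fun x y =>
    SamePair.merging_eq (Or.inr ⟨Setoid.refl' _ x, Setoid.refl' _ y⟩)
  have sflip : ∀ {x y z w}, SamePair (φ.small a) x y z w → SamePair (φ.small a) y x z w :=
    fun h => h.elim (fun h => Or.inr ⟨h.2, h.1⟩) (fun h => Or.inl ⟨h.2, h.1⟩)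
  have sflip' : ∀ {x y z w}, SamePair (φ.small a) x y z w → SamePair (φ.small a) x y w z :=
    fun h => h.elim Or.inr Or.inl
  have hyx := fun h => hxy ((φ.small a).1.symm h)
  have hwz := fun h => hzw ((φ.small a).1.symm h)
  by_cases c1 : (φ.small a).1 x z
  · exact done x y z w hsub n1 n2 n3 hxy hzw e1 e2 c1
  by_cases c2 : (φ.small a).1 x w
  · exact done x y w z (by rwa [flip w z]) (fun h => n1 (sflip' h)) n2 (fun h => n3 (sflip h)) hxy
      hwz e1 (by rwa [flip w z]) c2
  by_cases c3 : (φ.small a).1 y z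
  · exact done y x z w (by rwa [flip y x]) (fun h => n1 (sflip h)) (fun h => n2 (sflip h)) n3 hyx
      hzw (by rwa [flip y x]) e2 c3
  by_cases c4 : (φ.small a).1 y w
  · exact done y x w z (by rwa [flip y x, flip w z]) (fun h => n1 (sflip (sflip' h)))
      (fun h => n2 (sflip h)) (fun h => n3 (sflip h)) hyx hwz (by rwa [flip y x])
      (by rwa [flip w z]) c4
  rcases samePair_of_merging_inter_subset hX hxy hzw c1 c2 c3 c4 hst hsub with h | h
  · exact absurd h n2
  · exact absurd h n3

theorem samePair_of_image_eq (hX : Nat.card X = 27) (φ : IncidenceAut X) {a : SmallRel X}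
    {p q r s x y z w : X} (hpq : ¬ a.1 p q) (hrs : ¬ a.1 r s)
    (h1 : φ.large '' merging a p q = merging (φ.small a) x y)
    (h2 : φ.large '' merging a r s = merging (φ.small a) z w)
    (h3 : merging (φ.small a) x y = merging (φ.small a) z w) : SamePair a p q r s := by
  refine samePair_of_merging_subset hX hpq hrs ?_
  rw [← Set.image_subset_image_iff φ.large.injective, h1, h2, h3]

/-- The class of `x` in the image of `a` corresponds to the class of `p` in `a`: every pair that
contains the class of `p` is sent to a pair that contains the class of `x`. -/
def Corresponds (φ : IncidenceAut X) (a : SmallRel X) (p x : X) : Prop :=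
  ∀ q, ¬ a.1 p q → ∃ y, ¬ (φ.small a).1 x y ∧
    φ.large '' merging a p q = merging (φ.small a) x y

theorem exists_not_rel_pair (hX : Nat.card X = 27) (a : SmallRel X) (p : X) :
    ∃ q r, ¬ a.1 p q ∧ ¬ a.1 p r ∧ ¬ a.1 q r := by
  classical
  obtain ⟨q, hq⟩ := exists_not_rel_of_card_le hX a (S := {p}) (by simp)
  obtain ⟨r, hr⟩ := exists_not_rel_of_card_le hX a (S := {p, q})
    (Finset.card_le_two.trans (by norm_num))
  exact ⟨q, r, hq p (by simp), hr p (by simp), hr q (by simp)⟩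

theorem exists_corresponds (hX : Nat.card X = 27) (φ : IncidenceAut X) (a : SmallRel X) (p : X) :
    ∃ x, φ.Corresponds a p x := by
  obtain ⟨q, r, hpq, hpr, hqr⟩ := exists_not_rel_pair hX a p
  obtain ⟨x, y, z, hxy, hxz, hyz, e1, e2, e3⟩ := φ.exists_image_triangle hX hpq hpr hqr
  refine ⟨x, fun s hps => ?_⟩
  by_cases hqs : a.1 q s
  · refine ⟨y, hxy, ?_⟩
    rw [← e1]
    congr 1
    exact SamePair.merging_eq (Or.inl ⟨Setoid.refl' _ p, a.1.symm hqs⟩)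
  by_cases hrs : a.1 r s
  · refine ⟨z, hxz, ?_⟩
    rw [← e2]
    congr 1
    exact SamePair.merging_eq (Or.inl ⟨Setoid.refl' _ p, a.1.symm hrs⟩)
  obtain ⟨x₁, y₁, s₁, hxy₁, hxs₁, hys₁, f1, f2, -⟩ := φ.exists_image_triangle hX hpq hps hqs
  obtain ⟨x₂, z₂, s₂, hxz₂, hxs₂, hzs₂, g1, g2, -⟩ := φ.exists_image_triangle hX hpr hps hrs
  have h1 : SamePair (φ.small a) x y x₁ y₁ :=
    samePair_of_merging_subset hX hxy hxy₁ (by rw [← e1, f1])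
  have h2 : SamePair (φ.small a) x z x₂ z₂ :=
    samePair_of_merging_subset hX hxz hxz₂ (by rw [← e2, g1])
  have h3 : SamePair (φ.small a) x₁ s₁ x₂ s₂ :=
    samePair_of_merging_subset hX hxs₁ hxs₂ (by rw [← f2, g2])
  rcases h1 with h1 | h1
  · have : SamePair (φ.small a) x₁ s₁ x s₁ :=
      Or.inl ⟨(φ.small a).1.symm h1.1, Setoid.refl' _ _⟩
    exact ⟨s₁, fun h => hxs₁ ((φ.small a).1.trans ((φ.small a).1.symm h1.1) h),
      by rw [f2, this.merging_eq]⟩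
  rcases h2 with h2 | h2
  · have : SamePair (φ.small a) x₂ s₂ x s₂ :=
      Or.inl ⟨(φ.small a).1.symm h2.1, Setoid.refl' _ _⟩
    exact ⟨s₂, fun h => hxs₂ ((φ.small a).1.trans ((φ.small a).1.symm h2.1) h),
      by rw [g2, this.merging_eq]⟩
  -- Otherwise the pair of `p` and `s` is sent where the pair of `q` and `r` is sent.
  exfalso
  have h4 : SamePair (φ.small a) x₁ s₁ y z := by
    rcases h3 with h3 | h3
    · exact absurd ((φ.small a).1.trans h1.2 ((φ.small a).1.trans h3.1
        ((φ.small a).1.symm h2.2))) hyz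
    · exact Or.inl ⟨(φ.small a).1.symm h1.2, (φ.small a).1.trans h3.2 ((φ.small a).1.symm h2.2)⟩
  rcases φ.samePair_of_image_eq hX hps hqr f2 e3 h4.merging_eq with h | h
  · exact hpq h.1
  · exact hpr h.1

/-- Disjoint pairs of classes are sent to disjoint pairs of classes. -/
theorem not_rel_of_image (hX : Nat.card X = 27) (φ : IncidenceAut X) {a : SmallRel X}
    {p s u v x y z w : X} (hps : ¬ a.1 p s) (huv : ¬ a.1 u v) (hpu : ¬ a.1 p u) (hpv : ¬ a.1 p v)
    (hsu : ¬ a.1 s u) (hsv : ¬ a.1 s v) (hxy : ¬ (φ.small a).1 x y) (hzw : ¬ (φ.small a).1 z w)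
    (e1 : φ.large '' merging a p s = merging (φ.small a) x y)
    (e2 : φ.large '' merging a u v = merging (φ.small a) z w) :
    ¬ (φ.small a).1 x z ∧ ¬ (φ.small a).1 x w ∧ ¬ (φ.small a).1 y z ∧ ¬ (φ.small a).1 y w := by
  have key : ∀ x y z w, ¬ (φ.small a).1 x y → ¬ (φ.small a).1 z w →
      φ.large '' merging a p s = merging (φ.small a) x y →
      φ.large '' merging a u v = merging (φ.small a) z w → ¬ (φ.small a).1 x z := by
    intro x y z w hxy hzw e1 e2 hxz
    have hzx : SamePair (φ.small a) z w x w := Or.inl ⟨(φ.small a).1.symm hxz, Setoid.refl' _ w⟩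
    have hxw : ¬ (φ.small a).1 x w := fun h =>
      hzw ((φ.small a).1.trans ((φ.small a).1.symm hxz) h)
    rw [hzx.merging_eq] at e2
    have hyw : ¬ (φ.small a).1 y w := fun h => by
      have h3 : SamePair (φ.small a) x y x w := Or.inl ⟨Setoid.refl' _ x, h⟩
      rcases φ.samePair_of_image_eq hX hps huv e1 e2 h3.merging_eq with h | h
      · exact hpu h.1
      · exact hpv h.1
    obtain ⟨c, d, f, hcd, hcf, -, g1, g2, -⟩ := φ.symm.exists_image_triangle hX hxy hxw hyw
    have hinv : ∀ S : Set (LargeRel X), φ.symm.large '' (φ.large '' S) = S := fun S =>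
      φ.large.symm_image_image S
    have hsm : φ.symm.small (φ.small a) = a := φ.small.symm_apply_apply a
    rw [← e1, hinv, hsm] at g1
    rw [← e2, hinv, hsm] at g2
    rw [hsm] at hcd hcf
    rcases samePair_of_merging_subset hX hps hcd g1.le with h1 | h1 <;>
      rcases samePair_of_merging_subset hX huv hcf g2.le with h2 | h2
    · exact hpu (a.1.trans h1.1 (a.1.symm h2.1))
    · exact hpv (a.1.trans h1.1 (a.1.symm h2.2))
    · exact hsu (a.1.trans h1.2 (a.1.symm h2.1))
    · exact hsv (a.1.trans h1.2 (a.1.symm h2.2))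
  have flip : ∀ x y, merging (φ.small a) x y = merging (φ.small a) y x := fun x y =>
    SamePair.merging_eq (Or.inr ⟨Setoid.refl' _ x, Setoid.refl' _ y⟩)
  have hyx := fun h => hxy ((φ.small a).1.symm h)
  have hwz := fun h => hzw ((φ.small a).1.symm h)
  exact ⟨key x y z w hxy hzw e1 e2, key x y w z hxy hwz e1 (by rwa [flip w z]),
    key y x z w hyx hzw (by rwa [flip y x]) e2,
    key y x w z hyx hwz (by rwa [flip y x]) (by rwa [flip w z])⟩

/-- If the large relations above `a` and `b` are those above `a` that merge two
classes, then every other class of `a` is a class of `b`. -/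
theorem _root_.class_eq_of_above_eq (hX : Nat.card X = 27) {a b : SmallRel X} {u v x : X}
    (huv : ¬ a.1 u v) (h : above a b = merging a u v) (hxu : ¬ a.1 x u) (hxv : ¬ a.1 x v) :
    {w | a.1 w x} = {w | b.1 w x} := by
  have : Finite X := Nat.finite_of_card_ne_zero (by omega)
  refine (Set.eq_of_subset_of_ncard_le (fun w hw => ?_) (by rw [a.2, b.2])).symm
  by_contra hwx
  have hsub : merging a u v ⊆ merging a w x := fun A hA => by
    rw [← h] at hA
    exact ⟨hA.1, hA.2 hw⟩
  rcases samePair_of_merging_subset hX huv hwx hsub with h | h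
  · exact hxv (a.1.symm h.2)
  · exact hxu (a.1.symm h.1)

/-- A class that is not moved by an exchange of two points corresponds to the same class in the
images of both relations. -/
theorem Corresponds.class_eq (hX : Nat.card X = 27) [DecidableEq X] {φ : IncidenceAut X}
    {a : SmallRel X} {p u v x x' : X} (huv : ¬ a.1 u v) (hpu : ¬ a.1 p u) (hpv : ¬ a.1 p v)
    (h : φ.Corresponds a p x) (h' : φ.Corresponds (a.perm (Equiv.swap u v)) p x') :
    {w | (φ.small a).1 w x} = {w | (φ.small (a.perm (Equiv.swap u v))).1 w x'} := by
  set b := a.perm (Equiv.swap u v) with hb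
  have hab : ∀ s t, ¬ a.1 s u → ¬ a.1 s v → ¬ a.1 t u → ¬ a.1 t v → (b.1 s t ↔ a.1 s t) := by
    intro s t h1 h2 h3 h4
    rw [hb, SmallRel.perm_swap_apply,
      Equiv.swap_apply_of_ne_of_ne (ne_of_not_rel h1) (ne_of_not_rel h2),
      Equiv.swap_apply_of_ne_of_ne (ne_of_not_rel h3) (ne_of_not_rel h4)]
  have huv' : ¬ b.1 u v := by
    rw [hb, SmallRel.perm_swap_apply, Equiv.swap_apply_left, Equiv.swap_apply_right]
    exact fun h => huv (a.1.symm h)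
  have habove : above a b = merging a u v := above_perm_swap hX huv
  have habove' : above b a = merging b u v := by
    have := above_perm_swap hX huv'
    rwa [hb, SmallRel.perm_swap_perm_swap] at this
  have hmerge : merging a u v = merging b u v := by rw [← habove, ← habove', above_comm]
  obtain ⟨u₁, v₁, huv₁, e₁⟩ := φ.exists_image_merging hX huv
  obtain ⟨u₂, v₂, huv₂, e₂⟩ := φ.exists_image_merging hX huv'
  have habove₂ : above (φ.small b) (φ.small a) = merging (φ.small b) u₂ v₂ := by
    rw [← image_above, habove', e₂]
  have hu₁₂ : merging (φ.small a) u₁ v₁ = merging (φ.small b) u₂ v₂ := by rw [← e₁, ← e₂, hmerge]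
  have hnot : ∀ s, ¬ a.1 s u → ¬ a.1 s v → ¬ b.1 s u ∧ ¬ b.1 s v := by
    intro s h1 h2
    rw [hb, SmallRel.perm_swap_apply, SmallRel.perm_swap_apply, Equiv.swap_apply_left,
      Equiv.swap_apply_right, Equiv.swap_apply_of_ne_of_ne (ne_of_not_rel h1) (ne_of_not_rel h2)]
    exact ⟨h2, h1⟩
  -- Pairs that contain the class of `p` and avoid the exchanged points have the same image.
  have main : ∀ s, ¬ a.1 p s → ¬ a.1 s u → ¬ a.1 s v → ∃ y, ¬ (φ.small a).1 x y ∧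
      φ.large '' merging a p s = merging (φ.small a) x y ∧
      {w | (φ.small b).1 w x'} = {w | (φ.small a).1 w x'} ∧
      ((φ.small a).1 x x' ∨ (φ.small a).1 y x') := by
    intro s hps hsu hsv
    have hps' : ¬ b.1 p s := fun h => hps ((hab p s hpu hpv hsu hsv).mp h)
    obtain ⟨y, hxy, f₁⟩ := h s hps
    obtain ⟨y', hxy', f₂⟩ := h' s hps'
    obtain ⟨d1, d2, d3, d4⟩ := φ.not_rel_of_image hX hps huv hpu hpv hsu hsv hxy huv₁ f₁ e₁
    obtain ⟨d5, d6, d7, d8⟩ := φ.not_rel_of_image hX hps' huv' (hnot p hpu hpv).1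
      (hnot p hpu hpv).2 (hnot s hsu hsv).1 (hnot s hsu hsv).2 hxy' huv₂ f₂ e₂
    have c1 := class_eq_of_above_eq hX huv₂ habove₂ d5 d6
    have c2 := class_eq_of_above_eq hX huv₂ habove₂ d7 d8
    have hxy'' : ¬ (φ.small a).1 x' y' := fun h => hxy' (c2.ge h)
    refine ⟨y, hxy, f₁, c1, ?_⟩
    have hpre : merging a u v ∩ merging a p s = merging b u v ∩ merging b p s := by
      ext A
      constructor
      · rintro ⟨h1, h2⟩
        have h3 := hmerge ▸ h1
        exact ⟨h3, h3.1, h2.2⟩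
      · rintro ⟨h1, h2⟩
        have h3 := hmerge.symm ▸ h1
        exact ⟨h3, h3.1, h2.2⟩
    have himg : merging (φ.small a) u₁ v₁ ∩ merging (φ.small a) x y ⊆
        merging (φ.small a) x' y' := by
      rw [← e₁, ← f₁, ← Set.image_inter φ.large.injective, hpre,
        Set.image_inter φ.large.injective, e₂, f₂, ← hu₁₂]
      exact fun A hA => ⟨hA.1.1, hA.2.2⟩
    have himg' : merging (φ.small a) u₁ v₁ ∩ merging (φ.small a) x' y' ⊆
        merging (φ.small a) x y := by
      have h1 : merging (φ.small a) u₁ v₁ ∩ merging (φ.small a) x' y' ⊆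
          merging (φ.small b) u₂ v₂ ∩ merging (φ.small b) x' y' := by
        rw [hu₁₂]
        exact fun A hA => ⟨hA.1, hA.1.1, hA.2.2⟩
      refine h1.trans ?_
      rw [← e₂, ← f₂, ← Set.image_inter φ.large.injective, ← hpre,
        Set.image_inter φ.large.injective, f₁]
      exact Set.inter_subset_right
    rcases samePair_of_merging_inter_subset hX huv₁ hxy (fun h => d1 ((φ.small a).1.symm h))
      (fun h => d3 ((φ.small a).1.symm h)) (fun h => d2 ((φ.small a).1.symm h))
      (fun h => d4 ((φ.small a).1.symm h)) hxy'' himg with k | k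
    · exfalso
      rw [← k.merging_eq, Set.inter_self] at himg'
      rcases samePair_of_merging_subset hX huv₁ hxy himg' with k' | k'
      · exact d1 ((φ.small a).1.symm k'.1)
      · exact d2 ((φ.small a).1.symm k'.2)
    · rcases k with k | k
      · exact Or.inl k.1
      · exact Or.inr k.2
  obtain ⟨s, hs⟩ := exists_not_rel_of_card_le hX a (S := {p, u, v})
    (Finset.card_le_three.trans (by norm_num))
  obtain ⟨t, ht⟩ := exists_not_rel_of_card_le hX a (S := {p, u, v, s})
    (Finset.card_le_four.trans (by norm_num))
  have hst : ¬ a.1 s t := ht s (by simp)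
  have hpt : ¬ a.1 p t := ht p (by simp)
  have hps : ¬ a.1 p s := hs p (by simp)
  obtain ⟨y, hxy, f₁, hcls, k₁⟩ := main s hps (fun h => hs u (by simp) (a.1.symm h))
    (fun h => hs v (by simp) (a.1.symm h))
  obtain ⟨z, hxz, f₂, -, k₂⟩ := main t hpt (fun h => ht u (by simp) (a.1.symm h))
    (fun h => ht v (by simp) (a.1.symm h))
  have hxx' : (φ.small a).1 x x' := by
    rcases k₁ with k₁ | k₁
    · exact k₁
    rcases k₂ with k₂ | k₂
    · exact k₂
    exfalso
    have h3 : SamePair (φ.small a) x y x z :=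
      Or.inl ⟨Setoid.refl' _ x, (φ.small a).1.trans k₁ ((φ.small a).1.symm k₂)⟩
    rcases φ.samePair_of_image_eq hX hps hpt f₁ f₂ h3.merging_eq with h | h
    · exact hst h.2
    · exact hpt h.1
  rw [hcls]
  exact class_eq_of_rel hxx'

end IncidenceAut

end

/-! ### Small blocks and special permutations -/

/-- Two maps to the same set with fibres of equal sizes differ by a bijection of their domains. -/
theorem exists_equiv_of_card_fiber {X Z I : Type*} [Finite X] [Finite Z] (k : X → I) (l : Z → I)
    (h : ∀ i, Nat.card {x // k x = i} = Nat.card {z // l z = i}) :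
    ∃ e : X ≃ Z, ∀ x, l (e x) = k x := by
  have h' : ∀ i, Nonempty ({x // k x = i} ≃ {z // l z = i}) := fun i => Finite.card_eq.mp (h i)
  let f := fun i => (h' i).some
  refine ⟨(Equiv.sigmaFiberEquiv k).symm.trans ((Equiv.sigmaCongrRight f).trans
    (Equiv.sigmaFiberEquiv l)), fun x => ?_⟩
  exact (f (k x) ⟨x, rfl⟩).2

section

variable {X : Type*}

theorem mem_classes_iff {r : Setoid X} {c : Set X} {x : X} (hx : x ∈ c) :
    c ∈ r.classes ↔ c = {z | r z x} := by
  constructor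
  · rintro ⟨y, rfl⟩
    exact class_eq_of_rel (r.symm hx)
  · intro h
    rw [h]
    exact Setoid.mem_classes r x

theorem SmallBlock.nonempty (α : SmallBlock X) : α.1.Nonempty :=
  Set.nonempty_of_ncard_ne_zero (by rw [α.2]; norm_num)

theorem disjoint_of_mem_classes {r : Setoid X} {c d : Set X} (hc : c ∈ r.classes)
    (hd : d ∈ r.classes) (h : c ≠ d) : Disjoint c d := by
  obtain ⟨x, rfl⟩ := hc
  obtain ⟨y, rfl⟩ := hd
  exact class_disjoint_of_not_rel fun h' => h (class_eq_of_rel h')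

theorem exists_small_of_disjoint (hX : Nat.card X = 27) {α β : SmallBlock X}
    (h : Disjoint α.1 β.1) : ∃ a : SmallRel X, α.1 ∈ a.1.classes ∧ β.1 ∈ a.1.classes := by
  classical
  have : Finite X := Nat.finite_of_card_ne_zero (by omega)
  let k : X → Fin 3 := fun x => if x ∈ α.1 then 0 else if x ∈ β.1 then 1 else 2
  let l : Fin 9 × Fin 3 → Fin 3 := fun z => if z.1 = 0 then 0 else if z.1 = 1 then 1 else 2
  have hk0 : ∀ x, k x = 0 ↔ x ∈ α.1 := by
    intro x
    simp only [k]
    split_ifs <;> simp_all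
  have hk1 : ∀ x, k x = 1 ↔ x ∈ β.1 := by
    intro x
    have hd : x ∈ α.1 → x ∉ β.1 := fun h1 h2 => Set.disjoint_left.mp h h1 h2
    simp only [k]
    split_ifs <;> simp_all
  have hk2 : ∀ x, k x = 2 ↔ x ∈ (α.1 ∪ β.1)ᶜ := by
    intro x
    rw [Set.mem_compl_iff, Set.mem_union]
    simp only [k]
    split_ifs <;> simp_all
  have hcard : ∀ i, Nat.card {x // k x = i} = Nat.card {z // l z = i} := by
    intro i
    rw [Nat.card_eq_fintype_card (α := {z // l z = i})]
    fin_cases i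
    · have : Nat.card {x // k x = 0} = 3 := by
        rw [Nat.card_congr (Equiv.subtypeEquivRight hk0), Nat.card_coe_set_eq, α.2]
      exact this
    · have : Nat.card {x // k x = 1} = 3 := by
        rw [Nat.card_congr (Equiv.subtypeEquivRight hk1), Nat.card_coe_set_eq, β.2]
      exact this
    · have : Nat.card {x // k x = 2} = 21 := by
        rw [Nat.card_congr (Equiv.subtypeEquivRight hk2), Nat.card_coe_set_eq, Set.ncard_compl,
          Set.ncard_union_eq h, α.2, β.2, hX]
      exact this
  obtain ⟨e, he⟩ := exists_equiv_of_card_fiber k l hcard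
  refine ⟨⟨Setoid.ker fun x => (e x).1, ?_⟩, ⟨e.symm (0, 0), ?_⟩, ⟨e.symm (1, 0), ?_⟩⟩
  · have := classCard_ker_fst e
    rwa [Nat.card_fin] at this
  · ext x
    rw [← hk0, ← he]
    change l (e x) = 0 ↔ (e x).1 = (e (e.symm (0, 0))).1
    rw [Equiv.apply_symm_apply]
    generalize (e x) = z
    revert z
    decide
  · ext x
    rw [← hk1, ← he]
    change l (e x) = 1 ↔ (e x).1 = (e (e.symm (1, 0))).1
    rw [Equiv.apply_symm_apply]
    generalize (e x) = z
    revert z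
    decide

theorem exists_block_disjoint (hX : Nat.card X = 27) (α : SmallBlock X) :
    ∃ β : SmallBlock X, Disjoint α.1 β.1 := by
  have : Finite X := Nat.finite_of_card_ne_zero (by omega)
  obtain ⟨β, hβ, hβ3⟩ := Set.exists_subset_card_eq (s := α.1ᶜ) (n := 3)
    (by rw [Set.ncard_compl, α.2, hX]; norm_num)
  exact ⟨⟨β, hβ3⟩, Set.disjoint_right.mpr fun x hx => hβ hx⟩

theorem exists_small_of_block (hX : Nat.card X = 27) (α : SmallBlock X) :
    ∃ a : SmallRel X, α.1 ∈ a.1.classes := by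
  obtain ⟨β, h⟩ := exists_block_disjoint hX α
  obtain ⟨a, ha, -⟩ := exists_small_of_disjoint hX h
  exact ⟨a, ha⟩

theorem ClassCard.restrict_compl {a : SmallRel X} {α : Set X} (h : α ∈ a.1.classes) :
    ClassCard (Setoid.comap (Subtype.val : {x // x ∉ α} → X) a.1) 3 := by
  intro x
  rw [← Set.ncard_image_of_injective _ Subtype.val_injective]
  refine Eq.trans ?_ (a.2 x.1)
  congr 1
  ext z
  constructor
  · rintro ⟨w, hw, rfl⟩
    exact hw
  · intro hz
    refine ⟨⟨z, fun hzα => x.2 ?_⟩, hz, rfl⟩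
    rw [mem_classes_iff hzα] at h
    exact h.ge (a.1.symm hz)

/-- The permutations of the complement of `α` act transitively on the small relations with class
`α`. -/
theorem exists_perm_compl_eq (hX : Nat.card X = 27) [DecidableEq X] (α : SmallBlock X)
    [DecidablePred fun x => x ∉ α.1] {a b : SmallRel X} (ha : α.1 ∈ a.1.classes)
    (hb : α.1 ∈ b.1.classes) :
    ∃ τ : Equiv.Perm {x // x ∉ α.1}, b = a.perm (Equiv.Perm.ofSubtype τ) := by
  have : Finite X := Nat.finite_of_card_ne_zero (by omega)
  have hY : Nat.card {x // x ∉ α.1} = 8 * 3 := by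
    have := Set.ncard_compl α.1
    rw [α.2, hX, ← Nat.card_coe_set_eq] at this
    exact this
  obtain ⟨e, he⟩ := (ClassCard.restrict_compl ha).exists_equiv 8 (by norm_num) hY
  obtain ⟨f, hf⟩ := (ClassCard.restrict_compl hb).exists_equiv 8 (by norm_num) hY
  refine ⟨e.trans f.symm, (SmallRel.eq_of_le fun {x y} hxy => ?_).symm⟩
  set τ : Equiv.Perm {x // x ∉ α.1} := e.trans f.symm with hτ
  have key : ∀ x y, a.1 x y → b.1 (Equiv.Perm.ofSubtype τ x) (Equiv.Perm.ofSubtype τ y) := by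
    intro x y hxy
    by_cases hx : x ∈ α.1
    · rw [mem_classes_iff hx] at ha hb
      have hy : y ∈ α.1 := by
        rw [ha]
        exact a.1.symm hxy
      rw [Equiv.Perm.ofSubtype_apply_of_not_mem τ (by simpa using hx),
        Equiv.Perm.ofSubtype_apply_of_not_mem τ (by simpa using hy)]
      rw [hb] at hy
      exact b.1.symm hy
    · have hy : y ∉ α.1 := fun hy => hx (by
        rw [mem_classes_iff hy] at ha
        rw [ha]
        exact hxy)
      rw [Equiv.Perm.ofSubtype_apply_of_mem τ hx, Equiv.Perm.ofSubtype_apply_of_mem τ hy]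
      refine (hf _ _).mpr ?_
      rw [hτ, Equiv.trans_apply, Equiv.trans_apply, Equiv.apply_symm_apply, Equiv.apply_symm_apply]
      exact (he ⟨x, hx⟩ ⟨y, hy⟩).mp hxy
  have := key _ _ hxy
  rwa [Equiv.apply_symm_apply, Equiv.apply_symm_apply] at this

/-- A small relation with class `α` keeps this class under permutations that fix `α` pointwise. -/
theorem mem_classes_perm {a : SmallRel X} {α : Set X} (h : α ∈ a.1.classes) {σ : Equiv.Perm X}
    (hσ : ∀ x ∈ α, σ x = x) (hne : α.Nonempty) : α ∈ (a.perm σ).1.classes := by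
  obtain ⟨p, hp⟩ := hne
  rw [mem_classes_iff hp] at h ⊢
  have hmem : ∀ w, w ∈ α ↔ σ.symm w ∈ α := by
    intro w
    constructor
    · intro hw
      rwa [Equiv.symm_apply_eq _ |>.mpr (hσ w hw).symm]
    · intro hw
      have := hσ _ hw
      rw [Equiv.apply_symm_apply] at this
      rwa [this]
  ext w
  rw [hmem]
  change _ ↔ a.1 (σ.symm w) (σ.symm p)
  rw [Equiv.symm_apply_eq _ |>.mpr (hσ p hp).symm]
  exact ⟨fun hw => h.le hw, fun hw => h.ge hw⟩

theorem block_eq_of_forall_mem_classes (hX : Nat.card X = 27) {α β : SmallBlock X}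
    (h : ∀ a : SmallRel X, α.1 ∈ a.1.classes → β.1 ∈ a.1.classes) : α = β := by
  classical
  have : Finite X := Nat.finite_of_card_ne_zero (by omega)
  by_contra hne
  obtain ⟨a, ha⟩ := exists_small_of_block hX α
  have hβ := h a ha
  have hd : Disjoint α.1 β.1 := disjoint_of_mem_classes ha hβ fun h => hne (Subtype.ext h)
  obtain ⟨u, hu⟩ := β.nonempty
  obtain ⟨w, hw, hwu⟩ := Set.exists_ne_of_one_lt_ncard (by rw [β.2]; norm_num : 1 < β.1.ncard) u
  obtain ⟨v, hv⟩ : ((α.1 ∪ β.1)ᶜ).Nonempty := Set.nonempty_of_ncard_ne_zero (by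
    rw [Set.ncard_compl, Set.ncard_union_eq hd, α.2, β.2, hX]
    norm_num)
  rw [Set.mem_compl_iff, Set.mem_union, not_or] at hv
  have hb := h _ (mem_classes_perm (σ := Equiv.swap u v) ha (fun x hx =>
    Equiv.swap_apply_of_ne_of_ne
      (fun h => Set.disjoint_left.mp hd hx (h ▸ hu)) (fun h => hv.1 (h ▸ hx))) α.nonempty)
  rw [mem_classes_iff hu] at hb hβ
  have h1 : (a.perm (Equiv.swap u v)).1 w u := hb.le hw
  have hwv : w ≠ v := fun h => hv.2 (h ▸ hw)
  rw [SmallRel.perm_swap_apply, Equiv.swap_apply_left,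
    Equiv.swap_apply_of_ne_of_ne hwu hwv] at h1
  have h2 : a.1 w u := hβ.le hw
  exact hv.2 (hβ.ge (a.1.trans (a.1.symm h1) h2))

namespace IncidenceAut

/-- The images of the small relations with class `α` share a class. -/
theorem exists_block_image (hX : Nat.card X = 27) (φ : IncidenceAut X) (α : SmallBlock X) :
    ∃ β : SmallBlock X, ∀ a : SmallRel X, α.1 ∈ a.1.classes →
      β.1 ∈ (φ.small a).1.classes := by
  classical
  have : Finite X := Nat.finite_of_card_ne_zero (by omega)
  obtain ⟨a₀, ha₀⟩ := exists_small_of_block hX α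
  obtain ⟨p, hp⟩ := α.nonempty
  obtain ⟨x₀, hx₀⟩ := φ.exists_corresponds hX a₀ p
  refine ⟨⟨{w | (φ.small a₀).1 w x₀}, (φ.small a₀).2 x₀⟩, fun b hb => ?_⟩
  obtain ⟨τ, rfl⟩ := exists_perm_compl_eq hX α ha₀ hb
  have hfix : ∀ (τ : Equiv.Perm {x // x ∉ α.1}), ∀ x ∈ α.1, Equiv.Perm.ofSubtype τ x = x :=
    fun τ x hx => Equiv.Perm.ofSubtype_apply_of_not_mem τ (by simpa using hx)
  have key : ∃ x, φ.Corresponds (a₀.perm (Equiv.Perm.ofSubtype τ)) p x ∧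
      {w | (φ.small a₀).1 w x₀} =
        {w | (φ.small (a₀.perm (Equiv.Perm.ofSubtype τ))).1 w x} := by
    refine Equiv.Perm.swap_induction_on τ ⟨x₀, ?_, ?_⟩ fun τ u v huv ih => ?_
    · rw [map_one]
      exact hx₀
    · rw [map_one]
      rfl
    · obtain ⟨x, hx, hcls⟩ := ih
      have hmem := mem_classes_perm ha₀ (hfix τ) α.nonempty
      rw [map_mul, SmallRel.perm_mul, Equiv.Perm.ofSubtype_swap_eq]
      generalize a₀.perm (Equiv.Perm.ofSubtype τ) = a at *
      by_cases hrel : a.1 u v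
      · rw [SmallRel.perm_swap_of_rel hrel]
        exact ⟨x, hx, hcls⟩
      · obtain ⟨x', hx'⟩ := φ.exists_corresponds hX (a.perm (Equiv.swap u.1 v.1)) p
        refine ⟨x', hx', hcls.trans (hx.class_eq hX hrel ?_ ?_ hx')⟩
        · exact fun h => u.2 (((mem_classes_iff hp).mp hmem).ge (a.1.symm h))
        · exact fun h => v.2 (((mem_classes_iff hp).mp hmem).ge (a.1.symm h))
  obtain ⟨x, -, hcls⟩ := key
  change {w | (φ.small a₀).1 w x₀} ∈ _
  rw [hcls]
  exact Setoid.mem_classes _ x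

/-- An incidence automorphism permutes the three-element subsets compatibly with its action on the
small relations of which they are classes. -/
theorem exists_blockPerm (hX : Nat.card X = 27) (φ : IncidenceAut X) :
    ∃ ρ : Equiv.Perm (SmallBlock X), ∀ (a : SmallRel X) (α : SmallBlock X),
      (ρ α).1 ∈ (φ.small a).1.classes ↔ α.1 ∈ a.1.classes := by
  choose f hf using φ.exists_block_image hX
  choose g hg using φ.symm.exists_block_image hX
  have hgf : ∀ α, g (f α) = α := fun α => (block_eq_of_forall_mem_classes hX fun a ha => by
    have := hg _ _ (hf α a ha)
    rwa [show φ.symm.small (φ.small a) = a from φ.small.symm_apply_apply a] at this).symm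
  have hfg : ∀ α, f (g α) = α := fun α => (block_eq_of_forall_mem_classes hX fun a ha => by
    have := hf _ _ (hg α a ha)
    rwa [show φ.small (φ.symm.small a) = a from φ.small.apply_symm_apply a] at this).symm
  refine ⟨⟨f, g, hgf, hfg⟩, fun a α => ⟨fun h => ?_, hf α a⟩⟩
  have := hg _ _ h
  change (g (f α)).1 ∈ _ at this
  rwa [hgf, show φ.symm.small (φ.small a) = a from φ.small.symm_apply_apply a] at this

end IncidenceAut

theorem SmallBlock.subset_union_iff (hX : Nat.card X = 27) (α β γ : SmallBlock X) :
    γ.1 ⊆ α.1 ∪ β.1 ↔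
      ∀ δ : SmallBlock X, Disjoint δ.1 α.1 → Disjoint δ.1 β.1 → Disjoint δ.1 γ.1 := by
  have : Finite X := Nat.finite_of_card_ne_zero (by omega)
  constructor
  · intro h δ h1 h2
    exact (Set.disjoint_union_right.mpr ⟨h1, h2⟩).mono_right h
  · intro h x hx
    by_contra hxn
    obtain ⟨δ, h1, h2, h3⟩ := Set.exists_subsuperset_card_eq (n := 3)
      (Set.singleton_subset_iff.mpr (Set.mem_compl hxn)) (by simp) (by
        have := Set.ncard_union_le α.1 β.1
        rw [Set.ncard_compl, hX]
        rw [α.2, β.2] at this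
        omega)
    have hd : Disjoint δ (α.1 ∪ β.1) := Set.disjoint_left.mpr fun y hy => h2 hy
    rw [Set.disjoint_union_right] at hd
    exact Set.disjoint_left.mp (h ⟨δ, h3⟩ hd.1 hd.2) (Set.singleton_subset_iff.mp h1) hx

theorem SmallBlock.ncard_subset [Finite X] (S : Set X) :
    {γ : SmallBlock X | γ.1 ⊆ S}.ncard = S.ncard.choose 3 := by
  classical
  have := Fintype.ofFinite X
  rw [Set.ncard_eq_toFinset_card' S, ← Finset.card_powersetCard, ← Set.ncard_coe_finset]
  refine Set.ncard_congr (fun γ _ => γ.1.toFinset) ?_ ?_ ?_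
  · intro γ hγ
    rw [Finset.mem_coe, Finset.mem_powersetCard, ← Set.ncard_eq_toFinset_card']
    exact ⟨Set.toFinset_subset_toFinset.mpr hγ, γ.2⟩
  · intro γ δ _ _ h
    exact Subtype.ext (Set.toFinset_inj.mp h)
  · intro F hF
    rw [Finset.mem_coe, Finset.mem_powersetCard] at hF
    refine ⟨⟨F, by rw [Set.ncard_coe_finset, hF.2]⟩, fun x hx => ?_, by simp⟩
    exact Set.mem_toFinset.mp (hF.1 hx)

/-- A permutation of the small blocks that preserves disjointness is special. -/
theorem mem_specialPerm_of_disjoint_iff (hX : Nat.card X = 27) {ρ : Equiv.Perm (SmallBlock X)}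
    (h : ∀ α β, Disjoint (ρ α).1 (ρ β).1 ↔ Disjoint α.1 β.1) : ρ ∈ specialPerm X := by
  have : Finite X := Nat.finite_of_card_ne_zero (by omega)
  have hsub : ∀ α β γ : SmallBlock X, γ.1 ⊆ α.1 ∪ β.1 ↔ (ρ γ).1 ⊆ (ρ α).1 ∪ (ρ β).1 := by
    intro α β γ
    rw [SmallBlock.subset_union_iff hX, SmallBlock.subset_union_iff hX]
    refine ⟨fun H δ => ?_, fun H δ => ?_⟩
    · obtain ⟨δ, rfl⟩ := ρ.surjective δ
      rw [h, h, h]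
      exact H δ
    · have := H (ρ δ)
      rwa [h, h, h] at this
  refine ⟨fun α β => ?_, hsub⟩
  have hcard : {γ : SmallBlock X | γ.1 ⊆ α.1 ∪ β.1}.ncard =
      {γ : SmallBlock X | γ.1 ⊆ (ρ α).1 ∪ (ρ β).1}.ncard := by
    rw [← Set.ncard_image_of_injective _ ρ.injective]
    congr 1
    ext γ
    obtain ⟨γ, rfl⟩ := ρ.surjective γ
    rw [ρ.injective.mem_set_image]
    exact hsub α β γ
  rw [SmallBlock.ncard_subset, SmallBlock.ncard_subset] at hcard
  have h1 := Set.ncard_union_add_ncard_inter α.1 β.1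
  have h2 := Set.ncard_union_add_ncard_inter (ρ α).1 (ρ β).1
  have h3 := Set.ncard_le_ncard (Set.inter_subset_left (s := α.1) (t := β.1))
  have h4 := Set.ncard_le_ncard (Set.inter_subset_left (s := (ρ α).1) (t := (ρ β).1))
  rw [α.2, β.2] at h1
  rw [(ρ α).2, (ρ β).2] at h2
  rw [α.2] at h3
  rw [(ρ α).2] at h4
  have e1 : (α.1 ∪ β.1).ncard = 6 - (α.1 ∩ β.1).ncard := by omega
  have e2 : ((ρ α).1 ∪ (ρ β).1).ncard = 6 - ((ρ α).1 ∩ (ρ β).1).ncard := by omega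
  rw [e1, e2] at hcard
  have hinj : ∀ m < 4, ∀ n < 4, (6 - m).choose 3 = (6 - n).choose 3 → m = n := by decide
  exact hinj _ (by omega) _ (by omega) hcard

/-- If `α` and `β` meet in the single point `p`, the blocks that contain `p` can be told from
the sizes of intersections and the inclusions in `α ∪ β`. A block in `α ∪ β` contains `p` iff its
intersections with `α` and `β` overlap; a block not contained in `α ∪ β` contains `p` iff it meets
`α`, `β` and all four blocks `{p, a, b}` with `a ∈ α` and `b ∈ β`. -/
theorem SmallBlock.mem_iff_of_inter_eq [Finite X] {α β : SmallBlock X} {p : X}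
    (h : α.1 ∩ β.1 = {p}) (γ : SmallBlock X) : p ∈ γ.1 ↔
      (γ.1 ⊆ α.1 ∪ β.1 ∧ (γ.1 ∩ α.1).ncard + (γ.1 ∩ β.1).ncard = 4) ∨
      (¬ γ.1 ⊆ α.1 ∪ β.1 ∧ (γ.1 ∩ α.1).ncard ≠ 0 ∧ (γ.1 ∩ β.1).ncard ≠ 0 ∧
        ∀ δ : SmallBlock X, δ.1 ⊆ α.1 ∪ β.1 → (δ.1 ∩ α.1).ncard = 2 → (δ.1 ∩ β.1).ncard = 2 →
          (γ.1 ∩ δ.1).ncard ≠ 0) := by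
  have hpα : p ∈ α.1 := (h.ge (Set.mem_singleton p)).1
  have hpβ : p ∈ β.1 := (h.ge (Set.mem_singleton p)).2
  have hab : ∀ x, x ∈ α.1 → x ∈ β.1 → x = p := fun x h1 h2 => h.le ⟨h1, h2⟩
  have hsum : ∀ δ : SmallBlock X, δ.1 ⊆ α.1 ∪ β.1 →
      (δ.1 ∩ α.1).ncard + (δ.1 ∩ β.1).ncard = 3 + (δ.1 ∩ {p}).ncard := by
    intro δ hδ
    rw [← Set.ncard_union_add_ncard_inter, ← Set.inter_union_distrib_left,
      Set.inter_eq_left.mpr hδ, δ.2, ← Set.inter_inter_distrib_left, h]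
  have hmem : ∀ δ : SmallBlock X, δ.1 ⊆ α.1 ∪ β.1 →
      (p ∈ δ.1 ↔ (δ.1 ∩ α.1).ncard + (δ.1 ∩ β.1).ncard = 4) := by
    intro δ hδ
    rw [hsum δ hδ]
    by_cases hp : p ∈ δ.1
    · rw [Set.inter_eq_right.mpr (Set.singleton_subset_iff.mpr hp), Set.ncard_singleton]
      simp [hp]
    · rw [Set.inter_singleton_eq_empty.mpr hp, Set.ncard_empty]
      simp [hp]
  by_cases hγ : γ.1 ⊆ α.1 ∪ β.1
  · rw [hmem γ hγ]
    simp [hγ]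
  · simp only [hγ, false_and, not_false_eq_true, true_and, false_or]
    have hne0 : ∀ S : Set X, S.ncard ≠ 0 ↔ S.Nonempty := fun S => by
      rw [← Nat.pos_iff_ne_zero, Set.ncard_pos]
    simp only [hne0]
    constructor
    · intro hp
      refine ⟨⟨p, hp, hpα⟩, ⟨p, hp, hpβ⟩, fun δ hδ h1 h2 => ⟨p, hp, ?_⟩⟩
      exact (hmem δ hδ).mpr (by omega)
    · rintro ⟨⟨a, haγ, haα⟩, ⟨b, hbγ, hbβ⟩, hall⟩
      by_contra hp
      obtain ⟨c, hcγ, hc⟩ := Set.not_subset.mp hγ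
      rw [Set.mem_union, not_or] at hc
      have hap : a ≠ p := fun h => hp (h ▸ haγ)
      have hbp : b ≠ p := fun h => hp (h ▸ hbγ)
      have hne : a ≠ b := fun h => hap (hab a haα (h ▸ hbβ))
      have hac : a ≠ c := fun h => hc.1 (h ▸ haα)
      have hbc : b ≠ c := fun h => hc.2 (h ▸ hbβ)
      have hγeq : γ.1 = {a, b, c} := by
        refine (Set.eq_of_subset_of_ncard_le ?_ ?_).symm
        · rintro x (rfl | rfl | rfl) <;> assumption
        · rw [γ.2, Set.ncard_eq_three.mpr ⟨a, b, c, hne, hac, hbc, rfl⟩]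
      have hother : ∀ (ε : SmallBlock X) (x : X), ∃ y ∈ ε.1, y ≠ p ∧ y ≠ x := by
        intro ε x
        by_contra! hcon
        have : ε.1 ⊆ {p, x} := fun y hy => by
          by_cases hyp : y = p
          · exact Or.inl hyp
          · exact Or.inr (hcon y hy hyp)
        have := (Set.ncard_le_ncard this).trans (Set.ncard_insert_le _ _)
        rw [ε.2, Set.ncard_singleton] at this
        omega
      obtain ⟨a', ha', hap', haa'⟩ := hother α a
      obtain ⟨b', hb', hbp', hbb'⟩ := hother β b
      have hb'α : b' ∉ α.1 := fun h => hbp' (hab _ h hb')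
      have ha'β : a' ∉ β.1 := fun h => hap' (hab _ ha' h)
      have hne' : a' ≠ b' := fun h => hb'α (h ▸ ha')
      obtain ⟨x, hxγ, hxδ⟩ := hall ⟨{p, a', b'},
        Set.ncard_eq_three.mpr ⟨_, _, _, hap'.symm, hbp'.symm, hne', rfl⟩⟩ (by
          rintro x (rfl | rfl | rfl)
          · exact Or.inl hpα
          · exact Or.inl ha'
          · exact Or.inr hb') (by
          rw [Set.ncard_eq_two]
          refine ⟨p, a', hap'.symm, Set.ext fun x => ⟨?_, ?_⟩⟩
          · rintro ⟨rfl | rfl | rfl, hx⟩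
            · exact Or.inl rfl
            · exact Or.inr rfl
            · exact absurd hx hb'α
          · rintro (rfl | rfl)
            · exact ⟨Or.inl rfl, hpα⟩
            · exact ⟨Or.inr (Or.inl rfl), ha'⟩) (by
          rw [Set.ncard_eq_two]
          refine ⟨p, b', hbp'.symm, Set.ext fun x => ⟨?_, ?_⟩⟩
          · rintro ⟨rfl | rfl | rfl, hx⟩
            · exact Or.inl rfl
            · exact absurd hx ha'β
            · exact Or.inr rfl
          · rintro (rfl | rfl)
            · exact ⟨Or.inl rfl, hpβ⟩
            · exact ⟨Or.inr (Or.inr rfl), hb'⟩)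
      rw [hγeq] at hxγ
      rcases hxγ with rfl | rfl | rfl <;> rcases hxδ with h' | h' | h'
      · exact hap h'
      · exact haa' h'.symm
      · exact hap (hab _ haα (h' ▸ hb'))
      · exact hbp h'
      · exact hbp (hab _ (h' ▸ ha') hbβ)
      · exact hbb' h'.symm
      · exact hc.1 (h' ▸ hpα)
      · exact hc.1 (h' ▸ ha')
      · exact hc.2 (h' ▸ hb')

theorem exists_blocks_inter_eq (hX : Nat.card X = 27) (p : X) :
    ∃ α β : SmallBlock X, α.1 ∩ β.1 = {p} := by
  have : Finite X := Nat.finite_of_card_ne_zero (by omega)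
  obtain ⟨α, hα, -, hα3⟩ := Set.exists_subsuperset_card_eq (n := 3)
    (Set.subset_univ {p}) (by simp) (by rw [Set.ncard_univ, hX]; norm_num)
  have hp : p ∈ α := hα (Set.mem_singleton p)
  obtain ⟨β, hβ, hβα, hβ3⟩ := Set.exists_subsuperset_card_eq (s := {p}) (t := insert p αᶜ) (n := 3)
    (Set.singleton_subset_iff.mpr (Set.mem_insert p _)) (by simp) (by
      have h1 := Set.ncard_compl α
      have h2 := Set.ncard_le_ncard (Set.subset_insert p αᶜ)
      omega)
  refine ⟨⟨α, hα3⟩, ⟨β, hβ3⟩, Set.ext fun x => ⟨?_, ?_⟩⟩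
  · rintro ⟨h1, h2⟩
    exact (hβα h2).resolve_right fun h => h h1
  · rintro rfl
    exact ⟨hp, hβ (Set.mem_singleton _)⟩

theorem SmallBlock.eq_of_forall_mem_iff (hX : Nat.card X = 27) {x y : X}
    (h : ∀ γ : SmallBlock X, x ∈ γ.1 ↔ y ∈ γ.1) : x = y := by
  obtain ⟨α, β, hαβ⟩ := exists_blocks_inter_eq hX x
  have hx := hαβ.ge (Set.mem_singleton x)
  exact (hαβ.le ⟨(h α).mp hx.1, (h β).mp hx.2⟩).symm

/-- A special permutation of the blocks is induced by a permutation of the points. -/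
theorem exists_perm_of_mem_specialPerm (hX : Nat.card X = 27) {ρ : Equiv.Perm (SmallBlock X)}
    (hρ : ρ ∈ specialPerm X) :
    ∃ σ : Equiv.Perm X, ∀ (p : X) (γ : SmallBlock X), σ p ∈ (ρ γ).1 ↔ p ∈ γ.1 := by
  have : Finite X := Nat.finite_of_card_ne_zero (by omega)
  have key : ∀ ρ ∈ specialPerm X, ∀ p, ∃ x, ∀ γ : SmallBlock X, x ∈ (ρ γ).1 ↔ p ∈ γ.1 := by
    intro ρ hρ p
    obtain ⟨α, β, hαβ⟩ := exists_blocks_inter_eq hX p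
    obtain ⟨x, hx⟩ : ∃ x, (ρ α).1 ∩ (ρ β).1 = {x} := by
      rw [← Set.ncard_eq_one, ← hρ.1, hαβ, Set.ncard_singleton]
    refine ⟨x, fun γ => ?_⟩
    rw [SmallBlock.mem_iff_of_inter_eq hx, SmallBlock.mem_iff_of_inter_eq hαβ]
    rw [← hρ.2, ← hρ.1, ← hρ.1, ← ρ.forall_congr_right]
    refine or_congr_right (and_congr_right fun _ => and_congr_right fun _ =>
      and_congr_right fun _ => forall_congr' fun δ => ?_)
    rw [← hρ.2, ← hρ.1, ← hρ.1, ← hρ.1]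
  choose f hf using key ρ hρ
  choose g hg using key ρ⁻¹ (inv_mem hρ)
  refine ⟨⟨f, g, fun p => SmallBlock.eq_of_forall_mem_iff hX fun γ => ?_,
    fun p => SmallBlock.eq_of_forall_mem_iff hX fun γ => ?_⟩, hf⟩
  · have := hg (f p) (ρ γ)
    rw [show ρ⁻¹ (ρ γ) = γ from ρ.symm_apply_apply γ] at this
    rw [this, hf]
  · have := hf (g p) (ρ⁻¹ γ)
    rw [show ρ (ρ⁻¹ γ) = γ from ρ.apply_symm_apply γ] at this
    rw [this, hg]

theorem LargeRel.exists_small_le (hX : Nat.card X = 27) (A : LargeRel X) :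
    ∃ a : SmallRel X, a.1 ≤ A.1 := by
  have : Finite X := Nat.finite_of_card_ne_zero (by omega)
  obtain ⟨e, he⟩ := A.2.exists_equiv 3 (by norm_num) (by omega)
  let e' : X ≃ (Fin 3 × Fin 3) × Fin 3 := e.trans (((Equiv.refl _).prodCongr
    squareEquiv).trans (Equiv.prodAssoc _ _ _).symm)
  have h3 := classCard_ker_fst e'
  rw [Nat.card_fin] at h3
  exact ⟨⟨_, h3⟩, fun {u v} (huv : (e' u).1 = (e' v).1) =>
    (he u v).mpr (congrArg (fun z : Fin 3 × Fin 3 => z.1) huv)⟩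

namespace IncidenceAut

/-- Every incidence automorphism is induced by a permutation of the points. -/
theorem exists_perm (hX : Nat.card X = 27) (φ : IncidenceAut X) :
    ∃ σ : Equiv.Perm X, (∀ a, (φ.small a).1 = permEquiv σ a.1) ∧
      ∀ A, (φ.large A).1 = permEquiv σ A.1 := by
  classical
  have : Finite X := Nat.finite_of_card_ne_zero (by omega)
  obtain ⟨ρ, hρ⟩ := φ.exists_blockPerm hX
  have hdisj : ∀ (φ : IncidenceAut X) (ρ : Equiv.Perm (SmallBlock X)),
      (∀ (a : SmallRel X) (α : SmallBlock X),
        (ρ α).1 ∈ (φ.small a).1.classes ↔ α.1 ∈ a.1.classes) →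
      ∀ α β, Disjoint α.1 β.1 → Disjoint (ρ α).1 (ρ β).1 := by
    intro φ ρ hρ α β h
    obtain ⟨a, h1, h2⟩ := exists_small_of_disjoint hX h
    refine disjoint_of_mem_classes ((hρ a α).mpr h1) ((hρ a β).mpr h2) fun h' => ?_
    have : α = β := ρ.injective (Subtype.ext h')
    subst this
    obtain ⟨p, hp⟩ := α.nonempty
    exact Set.disjoint_left.mp h hp hp
  have hspec : ρ ∈ specialPerm X := by
    refine mem_specialPerm_of_disjoint_iff hX fun α β => ⟨fun h => ?_, hdisj φ ρ hρ α β⟩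
    have := hdisj φ.symm ρ.symm (fun a α => by
      have := hρ (φ.symm.small a) (ρ.symm α)
      rw [Equiv.apply_symm_apply, show φ.small (φ.symm.small a) = a from
        φ.small.apply_symm_apply a] at this
      exact this.symm) _ _ h
    rwa [Equiv.symm_apply_apply, Equiv.symm_apply_apply] at this
  obtain ⟨σ, hσ⟩ := exists_perm_of_mem_specialPerm hX hspec
  have hsmall : ∀ a, (φ.small a).1 = permEquiv σ a.1 := by
    intro a
    refine ((a.2.permEquiv σ).eq_of_le (φ.small a).2 fun {x y} hxy => ?_).symm
    have hα := (hρ a ⟨{w | a.1 w (σ.symm y)}, a.2 _⟩).mpr (Setoid.mem_classes _ _)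
    have hy := (hσ (σ.symm y) ⟨{w | a.1 w (σ.symm y)}, a.2 _⟩).mpr (a.1.refl _)
    have hx := (hσ (σ.symm x) ⟨{w | a.1 w (σ.symm y)}, a.2 _⟩).mpr hxy
    rw [Equiv.apply_symm_apply] at hx hy
    rw [mem_classes_iff hy] at hα
    exact hα.le hx
  refine ⟨σ, hsmall, fun A => ((A.2.permEquiv σ).eq_of_le (φ.large A).2 fun {x y} hxy => ?_).symm⟩
  -- Points related by `A` are related by a small relation below `A`.
  have hex : ∀ x y, A.1 x y → ∃ a : SmallRel X, a.1 ≤ A.1 ∧ a.1 x y := by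
    intro x y hxy
    obtain ⟨a, ha⟩ := A.exists_small_le hX
    by_cases haxy : a.1 x y
    · exact ⟨a, ha, haxy⟩
    obtain ⟨z, hz, hzx⟩ := a.2.exists_ne_rel (by norm_num) x
    have hzy : ¬ a.1 z y := fun h => haxy (a.1.trans (a.1.symm hzx) h)
    have habove := above_perm_swap hX hzy
    have hA : A ∈ merging a z y := ⟨ha, A.1.trans (ha hzx) hxy⟩
    rw [← habove] at hA
    refine ⟨_, hA.2, ?_⟩
    rw [SmallRel.perm_swap_apply, Equiv.swap_apply_right,
      Equiv.swap_apply_of_ne_of_ne hz.symm (ne_of_not_rel haxy)]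
    exact a.1.symm hzx
  obtain ⟨a, haA, haxy⟩ := hex _ _ hxy
  have := (φ.le_iff a A).mpr haA
  refine this ?_
  rw [hsmall]
  exact haxy

end IncidenceAut

end

/-! ### Automorphisms of the poset of factor pairs -/

section

variable {X : Type*}

theorem SmallRel.exists_factorPair (hX : Nat.card X = 27) (a : SmallRel X) :
    ∃ t : FactorPair X, t.fst = a.1 := by
  have : Finite X := Nat.finite_of_card_ne_zero (by omega)
  obtain ⟨e, he⟩ := a.2.exists_equiv 9 (by norm_num) (by omega)
  exact ⟨FactorPair.ofEquiv e, Setoid.ext fun x y => (he x y).symm⟩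

theorem LargeRel.exists_factorPair (hX : Nat.card X = 27) (A : LargeRel X) :
    ∃ t : FactorPair X, t.snd = A.1 := by
  have : Finite X := Nat.finite_of_card_ne_zero (by omega)
  obtain ⟨e, he⟩ := A.2.exists_equiv 3 (by norm_num) (by omega)
  exact ⟨(FactorPair.ofEquiv e)ᶜ, Setoid.ext fun x y => (he x y).symm⟩

namespace FactorPair

variable {Φ : FactorPair X ≃o FactorPair X}

/-- An automorphism of the poset of factor pairs acts on the small and on the large relations
through the two components of atoms, and this action preserves containment. -/
theorem exists_incidenceAut (hX : Nat.card X = 27) (hΦ : ∀ t, Φ tᶜ = (Φ t)ᶜ) :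
    ∃ φ : IncidenceAut X, ∀ (t : FactorPair X) (h₁ : ClassCard t.fst 3) (h₂ : ClassCard t.snd 9),
      (φ.small ⟨t.fst, h₁⟩).1 = (Φ t).fst ∧ (φ.large ⟨t.snd, h₂⟩).1 = (Φ t).snd := by
  have : Finite X := Nat.finite_of_card_ne_zero (by omega)
  have hΦ' : ∀ t, Φ.symm tᶜ = (Φ.symm t)ᶜ := fun t => by
    apply Φ.injective
    rw [hΦ, Φ.apply_symm_apply, Φ.apply_symm_apply]
  have hlarge : ∀ t : FactorPair X, ClassCard t.fst 3 → ClassCard t.snd 9 := fun t =>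
    t.classCard_snd (by rw [hX]) (by omega)
  have hsmall : ∀ t : FactorPair X, ClassCard t.snd 9 → ClassCard t.fst 3 := fun t =>
    t.classCard_fst (by rw [hX]) (by omega)
  choose s hs using SmallRel.exists_factorPair hX
  choose l hl using LargeRel.exists_factorPair hX
  have hs3 : ∀ a, ClassCard (s a).fst 3 := fun a => (hs a).symm ▸ a.2
  have hl3 : ∀ A, ClassCard (l A).fst 3 := fun A => hsmall _ ((hl A).symm ▸ A.2)
  have hpres : ∀ Φ : FactorPair X ≃o FactorPair X, ∀ t, ClassCard t.fst 3 →
      ClassCard (Φ t).fst 3 := fun Φ t => (classCard_fst_map_iff hX Φ t).mpr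
  let f : (FactorPair X ≃o FactorPair X) → SmallRel X → SmallRel X := fun Φ a =>
    ⟨(Φ (s a)).fst, hpres Φ _ (hs3 a)⟩
  let g : (FactorPair X ≃o FactorPair X) → LargeRel X → LargeRel X := fun Φ A =>
    ⟨(Φ (l A)).snd, hlarge _ (hpres Φ _ (hl3 A))⟩
  have hf : ∀ Φ : FactorPair X ≃o FactorPair X, (∀ t, Φ tᶜ = (Φ t)ᶜ) → ∀ a t, t.fst = a.1 →
      (f Φ a).1 = (Φ t).fst := fun Φ hΦ a t h => fst_map_eq hX hΦ (hs3 a) ((hs a).trans h.symm)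
  have hg : ∀ Φ : FactorPair X ≃o FactorPair X, (∀ t, Φ tᶜ = (Φ t)ᶜ) → ∀ A t, t.snd = A.1 →
      (g Φ A).1 = (Φ t).snd := fun Φ hΦ A t h => snd_map_eq hX hΦ (hl3 A) ((hl A).trans h.symm)
  have hle : ∀ Φ : FactorPair X ≃o FactorPair X, (∀ t, Φ tᶜ = (Φ t)ᶜ) → ∀ a A, a.1 ≤ A.1 →
      (f Φ a).1 ≤ (g Φ A).1 := by
    intro Φ hΦ a A h
    obtain ⟨t, u, -, -, h₃, h₄, h₅⟩ := exists_orth_of_le hX a.2 A.2 h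
    rw [hf Φ hΦ a t h₄, hg Φ hΦ A u h₅]
    exact ((orth_map_iff hΦ t u).mpr h₃).1
  have h1 : ∀ a, f Φ.symm (f Φ a) = a := fun a => Subtype.ext (by
    rw [hf Φ.symm hΦ' (f Φ a) (Φ (s a)) rfl, Φ.symm_apply_apply, hs])
  have h2 : ∀ a, f Φ (f Φ.symm a) = a := fun a => Subtype.ext (by
    rw [hf Φ hΦ (f Φ.symm a) (Φ.symm (s a)) rfl, Φ.apply_symm_apply, hs])
  have h3 : ∀ A, g Φ.symm (g Φ A) = A := fun A => Subtype.ext (by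
    rw [hg Φ.symm hΦ' (g Φ A) (Φ (l A)) rfl, Φ.symm_apply_apply, hl])
  have h4 : ∀ A, g Φ (g Φ.symm A) = A := fun A => Subtype.ext (by
    rw [hg Φ hΦ (g Φ.symm A) (Φ.symm (l A)) rfl, Φ.apply_symm_apply, hl])
  refine ⟨⟨⟨f Φ, f Φ.symm, h1, h2⟩, ⟨g Φ, g Φ.symm, h3, h4⟩, fun a A => ⟨fun h => ?_,
    hle Φ hΦ a A⟩⟩, fun t h₁ h₂ => ⟨hf Φ hΦ ⟨t.fst, h₁⟩ t rfl, hg Φ hΦ ⟨t.snd, h₂⟩ t rfl⟩⟩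
  have := hle Φ.symm hΦ' _ _ h
  change (f Φ.symm (f Φ a)).1 ≤ (g Φ.symm (g Φ A)).1 at this
  rwa [h1, h3] at this

theorem eq_least_of_fst_eq_bot (hX : Nat.card X = 27) {t : FactorPair X} (h : t.fst = ⊥) :
    t = least X := by
  have : Finite X := Nat.finite_of_card_ne_zero (by omega)
  have h1 : ClassCard t.snd (Nat.card X) :=
    t.classCard_snd (one_mul _).symm (by omega) (h ▸ classCard_bot X)
  exact FactorPair.ext h h1.eq_top

theorem map_least (Φ : FactorPair X ≃o FactorPair X) : Φ (least X) = least X := by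
  refine le_antisymm ?_ (least_le _)
  rw [← Φ.le_symm_apply]
  exact least_le _

theorem aut_ext (hX : Nat.card X = 27) {Φ Ψ : aut X}
    (h : ∀ t : FactorPair X, ClassCard t.fst 3 → Φ.1 t = Ψ.1 t) : Φ = Ψ := by
  refine Subtype.ext (OrderIso.ext (funext fun t => ?_))
  have hc : ∀ t : FactorPair X, Φ.1 tᶜ = Ψ.1 tᶜ → Φ.1 t = Ψ.1 t := by
    intro t ht
    rw [Φ.2, Ψ.2] at ht
    exact congrArg (fun u : FactorPair X => uᶜ) ht
  have : Finite X := Nat.finite_of_card_ne_zero (by omega)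
  rcases t.regular_fst.cases hX with h0 | h0 | h0 | h0
  · rw [eq_least_of_fst_eq_bot hX h0]
    exact (map_least Φ.1).trans (map_least Ψ.1).symm
  · exact h t h0
  · exact hc t (h _ (t.classCard_snd (by rw [hX]) (by omega) h0))
  · refine hc t ?_
    have h1 : ClassCard t.snd 1 := t.classCard_snd (mul_one _).symm (by omega)
      (h0 ▸ classCard_top X)
    rw [eq_least_of_fst_eq_bot hX (t := tᶜ) h1.eq_bot]
    exact (map_least Φ.1).trans (map_least Ψ.1).symm

theorem gamma_surjective (hX : Nat.card X = 27) : Function.Surjective (gamma X) := by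
  have : Finite X := Nat.finite_of_card_ne_zero (by omega)
  intro Φ
  obtain ⟨φ, hφ⟩ := exists_incidenceAut hX Φ.2
  obtain ⟨σ, hσ₁, hσ₂⟩ := φ.exists_perm hX
  refine ⟨σ, aut_ext hX fun t ht => ?_⟩
  obtain ⟨h₁, h₂⟩ := hφ t ht (t.classCard_snd (by rw [hX]) (by omega) ht)
  rw [hσ₁] at h₁
  rw [hσ₂] at h₂
  exact FactorPair.ext h₁ h₂

end FactorPair

/-! ### Automorphisms of the poset of regular equivalence relations -/

theorem permEquiv_le_iff (σ : Equiv.Perm X) {r s : Setoid X} :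
    permEquiv σ r ≤ permEquiv σ s ↔ r ≤ s := by
  constructor
  · intro h x y hxy
    have : permEquiv σ r (σ x) (σ y) := by
      rw [permEquiv_apply, Equiv.symm_apply_apply, Equiv.symm_apply_apply]
      exact hxy
    have := h this
    rwa [permEquiv_apply, Equiv.symm_apply_apply, Equiv.symm_apply_apply] at this
  · intro h x y hxy
    exact h hxy

theorem IsRegularEquiv.permEquiv {r : Setoid X} (hr : IsRegularEquiv r) (σ : Equiv.Perm X) :
    IsRegularEquiv (permEquiv σ r) := by
  have h : ∀ x, Cardinal.mk {z | _root_.permEquiv σ r z x} = Cardinal.mk {z | r z (σ.symm x)} :=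
    fun x => Cardinal.mk_congr (σ.symm.subtypeEquiv fun z => Iff.rfl)
  intro x y
  rw [h, h, hr]

/-- The action of the permutations of `X` on the regular equivalence relations. -/
def permReq (X : Type*) : Equiv.Perm X →* (Req X ≃o Req X) where
  toFun σ :=
    { toFun := fun r => ⟨permEquiv σ r.1, r.2.permEquiv σ⟩
      invFun := fun r => ⟨permEquiv σ⁻¹ r.1, r.2.permEquiv σ⁻¹⟩
      left_inv := fun r => Subtype.ext (Setoid.ext fun x y => by
        change r.1 (σ.symm (σ x)) (σ.symm (σ y)) ↔ _
        rw [Equiv.symm_apply_apply, Equiv.symm_apply_apply])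
      right_inv := fun r => Subtype.ext (Setoid.ext fun x y => by
        change r.1 (σ (σ.symm x)) (σ (σ.symm y)) ↔ _
        rw [Equiv.apply_symm_apply, Equiv.apply_symm_apply])
      map_rel_iff' := permEquiv_le_iff σ }
  map_one' := rfl
  map_mul' _ _ := rfl

/-- A small relation, as a regular equivalence relation. -/
def SmallRel.toReq [Finite X] (a : SmallRel X) : Req X := ⟨a.1, a.2.isRegularEquiv⟩

/-- A large relation, as a regular equivalence relation. -/
def LargeRel.toReq [Finite X] (A : LargeRel X) : Req X := ⟨A.1, A.2.isRegularEquiv⟩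

theorem SmallRel.exists_le_large (hX : Nat.card X = 27) (a : SmallRel X) :
    ∃ A : LargeRel X, a.1 ≤ A.1 := by
  obtain ⟨p, -, -, hp⟩ := a.exists_label_of_disjoint hX
  obtain ⟨A, hA, -⟩ := hp {0, 1, 2} {3, 4, 5} rfl rfl (by decide)
  exact ⟨A, hA⟩

theorem Req.exists_classCard_lt (hX : Nat.card X = 27) {r s : Req X} (h : r < s) :
    ∃ m n, ClassCard r.1 m ∧ ClassCard s.1 n ∧ m < n ∧
      (m = 1 ∨ m = 3 ∨ m = 9 ∨ m = 27) ∧ (n = 1 ∨ n = 3 ∨ n = 9 ∨ n = 27) := by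
  have : Finite X := Nat.finite_of_card_ne_zero (by omega)
  have : Nonempty X := (Nat.card_pos_iff.mp (by omega)).1
  have hcases : ∀ r : Req X, ∃ m, ClassCard r.1 m ∧ (m = 1 ∨ m = 3 ∨ m = 9 ∨ m = 27) := by
    intro r
    rcases r.2.cases hX with h | h | h | h
    · exact ⟨1, h ▸ classCard_bot X, by simp⟩
    · exact ⟨3, h, by simp⟩
    · exact ⟨9, h, by simp⟩
    · exact ⟨27, by rw [h, ← hX]; exact classCard_top X, by simp⟩
  obtain ⟨m, hm, hm'⟩ := hcases r
  obtain ⟨n, hn, hn'⟩ := hcases s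
  refine ⟨m, n, hm, hn, lt_of_le_of_ne (hm.le_of_le hn h.le) ?_, hm', hn'⟩
  rintro rfl
  exact h.ne (Subtype.ext (hm.eq_of_le hn h.le))

theorem Req.classCard_of_chain (hX : Nat.card X = 27) {b r s w : Req X} (h1 : b < r) (h2 : r < s)
    (h3 : s < w) : ClassCard r.1 3 ∧ ClassCard s.1 9 := by
  have : Finite X := Nat.finite_of_card_ne_zero (by omega)
  have : Nonempty X := (Nat.card_pos_iff.mp (by omega)).1
  have uniq : ∀ {r : Setoid X} {m n}, ClassCard r m → ClassCard r n → m = n := fun hm hn =>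
    le_antisymm (hm.le_of_le hn le_rfl) (hn.le_of_le hm le_rfl)
  obtain ⟨m, n, hm, hn, hmn, hm', hn'⟩ := Req.exists_classCard_lt hX h1
  obtain ⟨n₂, k, hn₂, hk, hnk, -, hk'⟩ := Req.exists_classCard_lt hX h2
  obtain ⟨k₂, l, hk₂, hl, hkl, -, hl'⟩ := Req.exists_classCard_lt hX h3
  obtain rfl := uniq hn hn₂
  obtain rfl := uniq hk hk₂
  have e1 : n = 3 := by omega
  have e2 : k = 9 := by omega
  exact ⟨e1 ▸ hn, e2 ▸ hk⟩

/-- A small relation below a large one are the middle terms of a chain of length three. -/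
theorem Req.exists_chain [Finite X] (hX : Nat.card X = 27) {a : SmallRel X} {A : LargeRel X}
    (h : a.1 ≤ A.1) : ∃ b w : Req X, b < a.toReq ∧ a.toReq < A.toReq ∧ A.toReq < w := by
  have : Nonempty X := (Nat.card_pos_iff.mp (by omega)).1
  have ne : ∀ {r s : Setoid X} {m n}, ClassCard r m → ClassCard s n → m < n → r ≠ s := by
    rintro r _ m n hm hn hmn rfl
    exact absurd (hn.le_of_le hm le_rfl) (by omega)
  refine ⟨⟨⊥, (classCard_bot X).isRegularEquiv⟩, ⟨⊤, (classCard_top X).isRegularEquiv⟩,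
    lt_of_le_of_ne (bot_le (a := a.1)) fun h' => ?_, lt_of_le_of_ne h fun h' => ?_,
    lt_of_le_of_ne (le_top (a := A.1)) fun h' => ?_⟩
  · exact ne (classCard_bot X) a.2 (by norm_num) (congrArg Subtype.val h')
  · exact ne a.2 A.2 (by norm_num) (congrArg Subtype.val h')
  · exact ne A.2 (classCard_top X) (by omega) (congrArg Subtype.val h')

theorem Req.classCard_map [Finite X] (hX : Nat.card X = 27) (Λ : Req X ≃o Req X) :
    (∀ a : SmallRel X, ClassCard (Λ a.toReq).1 3) ∧
      ∀ A : LargeRel X, ClassCard (Λ A.toReq).1 9 := by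
  constructor
  · intro a
    obtain ⟨A, hA⟩ := a.exists_le_large hX
    obtain ⟨b, w, h1, h2, h3⟩ := Req.exists_chain hX hA
    exact (Req.classCard_of_chain hX (Λ.lt_iff_lt.mpr h1) (Λ.lt_iff_lt.mpr h2)
      (Λ.lt_iff_lt.mpr h3)).1
  · intro A
    obtain ⟨a, ha⟩ := A.exists_small_le hX
    obtain ⟨b, w, h1, h2, h3⟩ := Req.exists_chain hX ha
    exact (Req.classCard_of_chain hX (Λ.lt_iff_lt.mpr h1) (Λ.lt_iff_lt.mpr h2)
      (Λ.lt_iff_lt.mpr h3)).2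

theorem Req.map_bot [Finite X] (Λ : Req X ≃o Req X) {r : Req X} (h : r.1 = ⊥) : Λ r = r := by
  have hle : ∀ s : Req X, r ≤ s := fun s => by
    change r.1 ≤ s.1
    rw [h]
    exact bot_le
  exact le_antisymm (by rw [← Λ.le_symm_apply]; exact hle _) (hle _)

theorem Req.map_top [Finite X] (Λ : Req X ≃o Req X) {r : Req X} (h : r.1 = ⊤) : Λ r = r := by
  have hle : ∀ s : Req X, s ≤ r := fun s => by
    change s.1 ≤ r.1
    rw [h]
    exact le_top
  exact le_antisymm (hle _) (by rw [← Λ.symm_apply_le]; exact hle _)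

theorem Req.orderIso_ext [Finite X] (hX : Nat.card X = 27) {Λ M : Req X ≃o Req X}
    (h₁ : ∀ a : SmallRel X, Λ a.toReq = M a.toReq) (h₂ : ∀ A : LargeRel X, Λ A.toReq = M A.toReq) :
    Λ = M := by
  refine OrderIso.ext (funext fun r => ?_)
  rcases r.2.cases hX with h | h | h | h
  · rw [Req.map_bot Λ h, Req.map_bot M h]
  · exact h₁ ⟨r.1, h⟩
  · exact h₂ ⟨r.1, h⟩
  · rw [Req.map_top Λ h, Req.map_top M h]

theorem permReq_surjective (hX : Nat.card X = 27) : Function.Surjective (permReq X) := by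
  have : Finite X := Nat.finite_of_card_ne_zero (by omega)
  intro Λ
  let φ : IncidenceAut X :=
    { small := ⟨fun a => ⟨(Λ a.toReq).1, (Req.classCard_map hX Λ).1 a⟩,
        fun a => ⟨(Λ.symm a.toReq).1, (Req.classCard_map hX Λ.symm).1 a⟩,
        fun a => Subtype.ext (show (Λ.symm (Λ a.toReq)).1 = a.1 from
          congrArg (fun r : Req X => r.1) (Λ.symm_apply_apply a.toReq)),
        fun a => Subtype.ext (show (Λ (Λ.symm a.toReq)).1 = a.1 from
          congrArg (fun r : Req X => r.1) (Λ.apply_symm_apply a.toReq))⟩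
      large := ⟨fun a => ⟨(Λ a.toReq).1, (Req.classCard_map hX Λ).2 a⟩,
        fun a => ⟨(Λ.symm a.toReq).1, (Req.classCard_map hX Λ.symm).2 a⟩,
        fun a => Subtype.ext (show (Λ.symm (Λ a.toReq)).1 = a.1 from
          congrArg (fun r : Req X => r.1) (Λ.symm_apply_apply a.toReq)),
        fun a => Subtype.ext (show (Λ (Λ.symm a.toReq)).1 = a.1 from
          congrArg (fun r : Req X => r.1) (Λ.apply_symm_apply a.toReq))⟩
      le_iff := fun a A => Λ.le_iff_le (x := a.toReq) (y := A.toReq) }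
  obtain ⟨σ, hσ₁, hσ₂⟩ := φ.exists_perm hX
  exact ⟨σ, Req.orderIso_ext hX (fun a => Subtype.ext (hσ₁ a).symm)
    (fun A => Subtype.ext (hσ₂ A).symm)⟩

/-! ### The action on small blocks, and faithfulness -/

/-- The action of the permutations of `X` on the small blocks, by special permutations. -/
def permBlock (X : Type*) : Equiv.Perm X →* specialPerm X where
  toFun σ := ⟨
    { toFun := fun α => ⟨σ '' α.1, by rw [Set.ncard_image_of_injective _ σ.injective, α.2]⟩
      invFun := fun α => ⟨σ.symm '' α.1, by
        rw [Set.ncard_image_of_injective _ σ.symm.injective, α.2]⟩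
      left_inv := fun α => Subtype.ext (σ.symm_image_image α.1)
      right_inv := fun α => Subtype.ext (σ.image_symm_image α.1) },
    fun α β => by
      change _ = ((σ '' α.1) ∩ (σ '' β.1)).ncard
      rw [← Set.image_inter σ.injective, Set.ncard_image_of_injective _ σ.injective],
    fun α β γ => by
      change _ ↔ σ '' γ.1 ⊆ (σ '' α.1) ∪ (σ '' β.1)
      rw [← Set.image_union, Set.image_subset_image_iff σ.injective]⟩
  map_one' := Subtype.ext (Equiv.ext fun α => Subtype.ext (Set.image_id α.1))
  map_mul' σ τ := Subtype.ext (Equiv.ext fun α => Subtype.ext (Set.image_comp σ τ α.1))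

theorem permBlock_apply (σ : Equiv.Perm X) (α : SmallBlock X) :
    ((permBlock X σ).1 α).1 = σ '' α.1 := rfl

theorem permBlock_surjective (hX : Nat.card X = 27) : Function.Surjective (permBlock X) := by
  intro ρ
  obtain ⟨σ, hσ⟩ := exists_perm_of_mem_specialPerm hX ρ.2
  refine ⟨σ, Subtype.ext (Equiv.ext fun α => Subtype.ext ?_)⟩
  rw [permBlock_apply]
  ext x
  obtain ⟨p, rfl⟩ := σ.surjective x
  rw [σ.injective.mem_set_image, hσ]

theorem permBlock_injective (hX : Nat.card X = 27) : Function.Injective (permBlock X) := by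
  refine (injective_iff_map_eq_one _).mpr fun σ hσ => Equiv.ext fun p => ?_
  refine SmallBlock.eq_of_forall_mem_iff hX fun γ => ?_
  have h : σ '' γ.1 = γ.1 := by rw [← permBlock_apply, hσ]; rfl
  nth_rw 1 [← h]
  rw [σ.injective.mem_set_image]
  rfl

theorem image_mem_classes_permEquiv {σ : Equiv.Perm X} {r : Setoid X} {c : Set X}
    (h : c ∈ r.classes) : σ '' c ∈ (permEquiv σ r).classes := by
  obtain ⟨y, rfl⟩ := h
  refine ⟨σ y, ?_⟩
  rw [Equiv.image_eq_preimage_symm]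
  ext x
  change r (σ.symm x) y ↔ r (σ.symm x) (σ.symm (σ y))
  rw [Equiv.symm_apply_apply]

theorem eq_one_of_permEquiv_eq (hX : Nat.card X = 27) {σ : Equiv.Perm X}
    (h : ∀ a : SmallRel X, permEquiv σ a.1 = a.1) : σ = 1 := by
  refine (injective_iff_map_eq_one _).mp (permBlock_injective hX) σ
    (Subtype.ext (Equiv.ext fun α => ?_))
  refine (block_eq_of_forall_mem_classes hX fun a ha => ?_).symm
  have := image_mem_classes_permEquiv (σ := σ) ha
  rwa [h] at this

theorem FactorPair.gamma_injective (hX : Nat.card X = 27) :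
    Function.Injective (FactorPair.gamma X) := by
  refine (injective_iff_map_eq_one _).mpr fun σ hσ => eq_one_of_permEquiv_eq hX fun a => ?_
  obtain ⟨t, ht⟩ := a.exists_factorPair hX
  have h1 : (FactorPair.gamma X σ).1 t = t := by rw [hσ]; rfl
  rw [← ht]
  exact congrArg FactorPair.fst h1

theorem permReq_injective (hX : Nat.card X = 27) : Function.Injective (permReq X) := by
  have : Finite X := Nat.finite_of_card_ne_zero (by omega)
  refine (injective_iff_map_eq_one _).mpr fun σ hσ => eq_one_of_permEquiv_eq hX fun a => ?_
  have h1 : permReq X σ a.toReq = a.toReq := by rw [hσ]; rfl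
  exact congrArg Subtype.val h1

theorem smallWithBlock_injective (hX : Nat.card X = 27) :
    Function.Injective (smallWithBlock (X := X)) := by
  have : Finite X := Nat.finite_of_card_ne_zero (by omega)
  intro α β h
  refine block_eq_of_forall_mem_classes hX fun a ha => ?_
  have h1 : a.toReq ∈ smallWithBlock α := ⟨(isSmallEquiv_iff hX _).mpr a.2, ha⟩
  rw [h] at h1
  exact h1.2

theorem permReq_image_smallWithBlock (hX : Nat.card X = 27) (σ : Equiv.Perm X)
    (α : SmallBlock X) :
    permReq X σ '' smallWithBlock α = smallWithBlock ((permBlock X σ).1 α) := by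
  have key : ∀ (σ : Equiv.Perm X) (α : SmallBlock X) (r : Req X), r ∈ smallWithBlock α →
      permReq X σ r ∈ smallWithBlock ((permBlock X σ).1 α) := by
    rintro σ α r ⟨h₁, h₂⟩
    exact ⟨(isSmallEquiv_iff hX _).mpr (((isSmallEquiv_iff hX _).mp h₁).permEquiv σ),
      image_mem_classes_permEquiv h₂⟩
  ext r
  constructor
  · rintro ⟨s, hs, rfl⟩
    exact key σ α s hs
  · intro hr
    have h1 := key σ⁻¹ _ r hr
    have h2 : (permBlock X σ⁻¹).1 ((permBlock X σ).1 α) = α := by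
      have : (permBlock X σ⁻¹ * permBlock X σ).1 α = α := by
        rw [← map_mul, inv_mul_cancel, map_one]
        rfl
      exact this
    have h3 : permReq X σ (permReq X σ⁻¹ r) = r := by
      have : (permReq X σ * permReq X σ⁻¹) r = r := by
        rw [← map_mul, mul_inv_cancel, map_one]
        rfl
      exact this
    rw [h2] at h1
    exact ⟨_, h1, h3⟩

end

/-- The four groups are isomorphic through `Γ`, `R`, `B` and `P`; each of the last three maps is
the only function that satisfies its defining rule, and it is a group isomorphism. -/
theorem mainTheorem1 {X : Type*} (hX : Nat.card X = 27) :
    Function.Bijective (FactorPair.gamma X) ∧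
    (∃ R : FactorPair.aut X ≃* (Req X ≃o Req X),
      ∀ f : FactorPair.aut X → (Req X ≃o Req X), IsMapR f ↔ f = R) ∧
    (∃ B : (Req X ≃o Req X) ≃* specialPerm X,
      ∀ f : (Req X ≃o Req X) → specialPerm X, IsMapB f ↔ f = B) ∧
    (∃ P : specialPerm X ≃* Equiv.Perm X,
      ∀ f : specialPerm X → Equiv.Perm X, IsMapP f ↔ f = P) := by
  have : Finite X := Nat.finite_of_card_ne_zero (by omega)
  have hΓ : Function.Bijective (FactorPair.gamma X) :=
    ⟨FactorPair.gamma_injective hX, FactorPair.gamma_surjective hX⟩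
  let eΓ := MulEquiv.ofBijective (FactorPair.gamma X) hΓ
  let eΛ := MulEquiv.ofBijective (permReq X) ⟨permReq_injective hX, permReq_surjective hX⟩
  let eρ := MulEquiv.ofBijective (permBlock X) ⟨permBlock_injective hX, permBlock_surjective hX⟩
  -- In each case the composite isomorphism obeys the rule, and the rule leaves no choice.
  refine ⟨hΓ, ⟨eΓ.symm.trans eΛ, fun f => ?_⟩, ⟨eΛ.symm.trans eρ, fun f => ?_⟩,
    ⟨eρ.symm, fun f => ?_⟩⟩
  · have hR : IsMapR (eΓ.symm.trans eΛ) := by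
      intro Φ t _ _
      obtain ⟨σ, rfl⟩ := eΓ.surjective Φ
      rw [MulEquiv.trans_apply, eΓ.symm_apply_apply]
      exact ⟨rfl, rfl⟩
    refine ⟨fun hf => funext fun Φ => Req.orderIso_ext hX (fun a => ?_) fun A => ?_, ?_⟩
    · obtain ⟨t, ht⟩ := a.exists_factorPair hX
      have h3 : ClassCard t.fst 3 := ht ▸ a.2
      have hs := (isSmallEquiv_iff hX _).mpr h3
      have hl := (isLargeEquiv_iff hX _).mpr (t.classCard_snd (n := 9) (by rw [hX]) (by omega) h3)
      have : a.toReq = t.fstReq := Subtype.ext ht.symm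
      rw [this, (hf Φ t hs hl).1, (hR Φ t hs hl).1]
    · obtain ⟨t, ht⟩ := A.exists_factorPair hX
      have h9 : ClassCard t.snd 9 := ht ▸ A.2
      have hl := (isLargeEquiv_iff hX _).mpr h9
      have hs := (isSmallEquiv_iff hX _).mpr (t.classCard_fst (m := 3) (by rw [hX]) (by omega) h9)
      have : A.toReq = t.sndReq := Subtype.ext ht.symm
      rw [this, (hf Φ t hs hl).2, (hR Φ t hs hl).2]
    · rintro rfl
      exact hR
  · have hB : IsMapB (eΛ.symm.trans eρ) := by
      intro Λ α β
      obtain ⟨σ, rfl⟩ := eΛ.surjective Λ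
      rw [MulEquiv.trans_apply, eΛ.symm_apply_apply]
      change _ ↔ permReq X σ '' _ = _
      rw [permReq_image_smallWithBlock hX, (smallWithBlock_injective hX).eq_iff]
      rfl
    refine ⟨fun hf => funext fun Λ => Subtype.ext (Equiv.ext fun α => ?_), ?_⟩
    · rw [hf Λ α, ← hB Λ α]
    · rintro rfl
      exact hB
  · have hP : ∀ (σ : Equiv.Perm X) (α β : SmallBlock X) (p : X), α.1 ∩ β.1 = {p} →
        ((eρ σ).1 α).1 ∩ ((eρ σ).1 β).1 = {σ p} := by
      intro σ α β p h
      change (σ '' α.1) ∩ (σ '' β.1) = _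
      rw [← Set.image_inter σ.injective, h, Set.image_singleton]
    constructor
    · intro hf
      funext ρ
      obtain ⟨σ, rfl⟩ := eρ.surjective ρ
      ext p
      obtain ⟨α, β, h⟩ := exists_blocks_inter_eq hX p
      rw [hf (eρ σ) α β p (σ p) h (hP σ α β p h), eρ.symm_apply_apply]
    · rintro rfl ρ α β p x h h'
      obtain ⟨σ, rfl⟩ := eρ.surjective ρ
      rw [hP σ α β p h] at h'
      rw [eρ.symm_apply_apply]
      exact Set.singleton_injective h'
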